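/- Let $K$ be an algebraically closed field of characteristic zero and $S=K[x_0,\dots,x_n]$ with the standard grading; write $S_d$ for the space of homogeneous polynomials of degree $d$. Let $\mathfrak m=(x_0,\dots,x_n)$. For a homogeneous ideal $J\subsetneq S$ let $e(S/J)$ be the Hilbert–Samuel multiplicity of the $S_{\mathfrak m}$-module $M=(S/J)_{\mathfrak m}$: if $\dim M\ge 1$, the function $k\mapsto \operatorname{length}(\mathfrak m^kM/\mathfrak m^{k+1}M)$ agrees for large $k$ with a polynomial of degree $\dim M-1$ whose leading coefficient is $e(S/J)/(\dim M-1)!$; if $\dim M=0$, then $e(S/J)=\operatorname{length}(M)$. An ideal of $S$ is called a linear prime if it equals $(x,y)$ for some linearly independent $x,y\in S_1$, and a quadratic prime if it equals $(x,Q)$ for some nonzero $x\in S_1$ and some $Q\in S_2$ such that $Q$ is irreducible modulo $x$. Let $Q_1,Q_2\in S_2$ have no common factor and let $I=(Q_1,Q_2)$. Let $I=\mathfrak q_1\cap\cdots\cap\mathfrak q_m$ be an irredundant primary decomposition (with distinct radicals) and $\mathfrak p_i=\operatorname{rad}(\mathfrak q_i)$. Then each $\mathfrak p_i$ is a minimal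 prime of $I$, and: 1. $e(S/\mathfrak q_i)\le 4$ for all $i$. 2. If $I$ is not radical, then $e(S/\mathfrak p_i)\le 2$ for all $i$. 3. If $I$ is not radical, then every $\mathfrak p_i$ is a linear prime or a quadratic prime. 4. If $I$ is radical but not prime, then either $I$ has a minimal prime that is a linear prime, or $I$ has exactly two minimal primes and both are quadratic primes. -/

import Mathlib

noncomputable section

/-- The Hilbert-Samuel function `n ↦ length (𝔪ⁿ M / 𝔪ⁿ⁺¹ M)` of a module over a local ring
`(R, 𝔪)`. -/
def hilbertSamuelFunction (R M : Type*) [CommRing R] [IsLocalRing R] [AddCommGroup M]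
    [Module R M] (n : ℕ) : ℕ∞ :=
  Module.length R
    (↥(IsLocalRing.maximalIdeal R ^ n • (⊤ : Submodule R M)) ⧸
      (IsLocalRing.maximalIdeal R ^ (n + 1) • (⊤ : Submodule R M)).submoduleOf
        (IsLocalRing.maximalIdeal R ^ n • (⊤ : Submodule R M)))

/-- `P` is the Hilbert-Samuel polynomial of `M`: the Hilbert-Samuel function is finite and equal
to `P n` for all large `n`. -/
def IsHilbertSamuelPolynomial (R M : Type*) [CommRing R] [IsLocalRing R] [AddCommGroup M]
    [Module R M] (P : Polynomial ℚ) : Prop :=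
  ∀ᶠ n : ℕ in Filter.atTop,
    ∃ k : ℕ, hilbertSamuelFunction R M n = (k : ℕ∞) ∧ P.eval (n : ℚ) = (k : ℚ)

/-- The Hilbert-Samuel multiplicity `e(𝔪, M)` exists and equals `e`.
If `dim M = d + 1` is positive, the Hilbert-Samuel polynomial has degree `d` and leading
coefficient `e / d!`. If `dim M = 0`, the multiplicity is the length of `M`
(the usual convention). It is a predicate, so that no default value is ever involved. -/
def HasHilbertSamuelMultiplicity (R M : Type*) [CommRing R] [IsLocalRing R] [AddCommGroup M]
    [Module R M] (e : ℕ) : Prop :=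
  (Module.supportDim R M = 0 ∧ Module.length R M = (e : ℕ∞)) ∨
  ∃ d : ℕ, Module.supportDim R M = ((d + 1 : ℕ) : WithBot ℕ∞) ∧
    ∃ P : Polynomial ℚ, IsHilbertSamuelPolynomial R M P ∧ P.degree = (d : WithBot ℕ) ∧
      (d.factorial : ℚ) * P.leadingCoeff = (e : ℚ)

/-- The ideal `(x₀, …, xₙ)` is prime. -/
instance isPrime_idealOfVars (K : Type*) [Field K] (n : ℕ) :
    (MvPolynomial.idealOfVars (Fin (n + 1)) K).IsPrime := by
  have h : MvPolynomial.idealOfVars (Fin (n + 1)) K =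
      RingHom.ker (MvPolynomial.constantCoeff (σ := Fin (n + 1)) (R := K)) := by
    ext p
    have := MvPolynomial.mem_pow_idealOfVars_iff' (σ := Fin (n + 1)) (R := K) 1 p
    rw [pow_one] at this
    rw [this, RingHom.mem_ker, MvPolynomial.constantCoeff_eq]
    simp [Finsupp.degree_eq_zero_iff]
  rw [h]
  exact RingHom.ker_isPrime _

/-- `e(S/J) = e`, where `S = K[x₀, …, xₙ]`: the Hilbert-Samuel multiplicity of the localization
of `S/J` at the irrelevant maximal ideal `𝔪 = (x₀, …, xₙ)`, as a module over `S_𝔪`. -/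
def HasMultiplicity {K : Type*} [Field K] {n : ℕ}
    (J : Ideal (MvPolynomial (Fin (n + 1)) K)) (e : ℕ) : Prop :=
  HasHilbertSamuelMultiplicity
    (Localization.AtPrime (MvPolynomial.idealOfVars (Fin (n + 1)) K))
    (LocalizedModule (MvPolynomial.idealOfVars (Fin (n + 1)) K).primeCompl
      (MvPolynomial (Fin (n + 1)) K ⧸ J)) e

/-- `𝔭 = (x, y)` for linearly independent linear forms `x, y`. -/
def IsLinearPrime {K : Type*} [Field K] {n : ℕ}
    (p : Ideal (MvPolynomial (Fin (n + 1)) K)) : Prop :=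
  ∃ x y : MvPolynomial (Fin (n + 1)) K, x.IsHomogeneous 1 ∧ y.IsHomogeneous 1 ∧
    LinearIndependent K ![x, y] ∧ p = Ideal.span {x, y}

/-- `𝔭 = (x, Q)` for a nonzero linear form `x` and a quadratic form `Q` which is irreducible
modulo `x`. -/
def IsQuadraticPrime {K : Type*} [Field K] {n : ℕ}
    (p : Ideal (MvPolynomial (Fin (n + 1)) K)) : Prop :=
  ∃ x Q : MvPolynomial (Fin (n + 1)) K, x.IsHomogeneous 1 ∧ x ≠ 0 ∧ Q.IsHomogeneous 2 ∧
    Irreducible (Ideal.Quotient.mk (Ideal.span {x}) Q) ∧ p = Ideal.span {x, Q}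

end

/-! Two coprime quadrics have no common zero on a suitable projective line. In linear coordinates x,
y, z₁, …, zₘ in which that line is {z = 0}, the quotient S/(I, z) has K-basis 1, x, y, xy. Put A =
K[z₁, …, zₘ] and B = S/I. By graded Nakayama 1, x, y, xy generate B over A. The Hilbert series of
the complete intersection is (1+T)²/(1−T)ᵐ, which is exactly that of a graded free module with
generators in degrees 0, 1, 1, 2. Hence there is no relation and B is free of rank 4 over A
(`NoetherCoordinates.nonempty_basis`). This replaces any appeal to Cohen–Macaulay theory.

Everything else is read off from this finite free extension. Since B is torsion-free, every
associated prime of I meets A in 0, and by incomparability it is then minimal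
(`radical_mem_minimalPrimes`). A minimal prime P of B is the annihilator of some g, so B/P ≅ Bg
embeds in B. For distinct minimal primes these submodules are independent, so the ranks of the B/P
sum to at most 4. If B is not reduced, the same device forces every B/P to have rank at most 2
(`finrank_quotient_le_two_of_not_isReduced`).

A graded prime p of rank at most 2 contains a linear form (`NoetherCoordinates.exists_linear_mem`).
Completing squares gives x² = D and y² = E in S/p with D, E quadratic forms in A. A relation among
1, x, y over A then either makes D or E a square, or puts xy in A; each case produces a linear form
in p. Modulo that form l, one of the quadrics in I is nonzero. It is either irreducible, which makes
p quadratic, or it splits into linear factors, one of which lies in p; Krull's height theorem shows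
that p has no further generators. If I is radical but not prime and has no linear minimal prime, all
ranks are at least 2 while their sum is at most 4, which leaves exactly two primes of rank 2.

For multiplicities, the Hilbert–Samuel function at the irrelevant ideal of a graded quotient is its
Hilbert function (`hilbertSamuelFunction_eq_hilbertFn`). It is at least the Hilbert function of A,
which embeds in the quotient, and at most that of a graded free A-module of rank 4 (respectively 2).
This fixes the degree of the polynomial and bounds its leading coefficient. -/

/-! ### Homogeneous components of products. -/

open MvPolynomial in
theorem MvPolynomial.IsHomogeneous.homogeneousComponent_mul {σ R : Type*} [CommRing R]
    {f : MvPolynomial σ R} {d : ℕ} (hf : f.IsHomogeneous d) (g : MvPolynomial σ R) (k : ℕ) :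
    homogeneousComponent (k + d) (f * g) = f * homogeneousComponent k g := by
  conv_lhs => rw [← sum_homogeneousComponent g]
  rw [Finset.mul_sum, map_sum]
  have h : ∀ i ∈ Finset.range (g.totalDegree + 1),
      homogeneousComponent (k + d) (f * homogeneousComponent i g) =
        if i = k then f * homogeneousComponent i g else 0 := by
    intro i _
    rw [homogeneousComponent_of_mem (hf.mul (homogeneousComponent_isHomogeneous i g))]
    congr 1
    simp only [eq_iff_iff]
    omega
  rw [Finset.sum_congr rfl h]
  by_cases hk : k ∈ Finset.range (g.totalDegree + 1)
  · rw [Finset.sum_ite_eq' _ k, if_pos hk]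
  · rw [Finset.sum_ite_eq' _ k, if_neg hk, homogeneousComponent_eq_zero, mul_zero]
    simpa using hk

open MvPolynomial in
theorem MvPolynomial.IsHomogeneous.homogeneousComponent_mul_of_lt {σ R : Type*} [CommRing R]
    {f : MvPolynomial σ R} {d : ℕ} (hf : f.IsHomogeneous d) (g : MvPolynomial σ R) {k : ℕ}
    (hk : k < d) : homogeneousComponent k (f * g) = 0 := by
  conv_lhs => rw [← sum_homogeneousComponent g]
  rw [Finset.mul_sum, map_sum]
  refine Finset.sum_eq_zero fun i _ => ?_
  rw [homogeneousComponent_of_mem (hf.mul (homogeneousComponent_isHomogeneous i g)), if_neg]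
  omega

/-! ### Graded ideals, Hilbert functions and Hilbert series. -/

section HilbertFunction

open MvPolynomial

variable {σ K : Type*} [Field K]

/-- An ideal of a polynomial ring is graded if it contains the homogeneous components of its
elements. -/
def IsGradedIdeal (J : Ideal (MvPolynomial σ K)) : Prop :=
  ∀ f ∈ J, ∀ k, homogeneousComponent k f ∈ J

theorem isGradedIdeal_bot : IsGradedIdeal (⊥ : Ideal (MvPolynomial σ K)) := by
  intro f hf k
  rw [Ideal.mem_bot] at hf
  simp [hf]

theorem isGradedIdeal_span_singleton {f : MvPolynomial σ K} {d : ℕ} (hf : f.IsHomogeneous d) :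
    IsGradedIdeal (Ideal.span {f}) := by
  intro g hg k
  obtain ⟨c, rfl⟩ := Ideal.mem_span_singleton'.mp hg
  rw [mul_comm c f]
  by_cases hk : k < d
  · rw [hf.homogeneousComponent_mul_of_lt c hk]
    exact Ideal.zero_mem _
  · obtain ⟨j, rfl⟩ := Nat.exists_eq_add_of_le' (not_lt.mp hk)
    rw [hf.homogeneousComponent_mul]
    exact Ideal.mul_mem_right _ _ (Ideal.mem_span_singleton_self f)

theorem IsGradedIdeal.sup {J J' : Ideal (MvPolynomial σ K)} (h : IsGradedIdeal J)
    (h' : IsGradedIdeal J') : IsGradedIdeal (J ⊔ J') := by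
  intro f hf k
  obtain ⟨a, ha, b, hb, rfl⟩ := Submodule.mem_sup.mp hf
  rw [map_add]
  exact Submodule.add_mem_sup (h a ha k) (h' b hb k)

/-- The colon ideal `J : f`. -/
def colonIdeal (J : Ideal (MvPolynomial σ K)) (f : MvPolynomial σ K) :
    Ideal (MvPolynomial σ K) where
  carrier := {g | f * g ∈ J}
  add_mem' := fun {a b} ha hb => by
    simp only [Set.mem_ofPred_eq] at *
    rw [mul_add]; exact Ideal.add_mem _ ha hb
  zero_mem' := by simp
  smul_mem' := fun c x hx => by
    simp only [Set.mem_ofPred_eq, smul_eq_mul] at *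
    rw [mul_left_comm]; exact Ideal.mul_mem_left _ _ hx

theorem mem_colonIdeal {J : Ideal (MvPolynomial σ K)} {f g : MvPolynomial σ K} :
    g ∈ colonIdeal J f ↔ f * g ∈ J := Iff.rfl

theorem le_colonIdeal (J : Ideal (MvPolynomial σ K)) (f : MvPolynomial σ K) :
    J ≤ colonIdeal J f := fun _ hg => Ideal.mul_mem_left _ _ hg

theorem IsGradedIdeal.colonIdeal {J : Ideal (MvPolynomial σ K)} (hJ : IsGradedIdeal J)
    {f : MvPolynomial σ K} {d : ℕ} (hf : f.IsHomogeneous d) : IsGradedIdeal (colonIdeal J f) := by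
  intro g hg k
  rw [mem_colonIdeal, ← hf.homogeneousComponent_mul]
  exact hJ _ hg _

/-- The degree `k` part of an ideal. -/
noncomputable def gradedPart (J : Ideal (MvPolynomial σ K)) (k : ℕ) : Submodule K (MvPolynomial σ K) :=
  J.restrictScalars K ⊓ homogeneousSubmodule σ K k

theorem mem_gradedPart {J : Ideal (MvPolynomial σ K)} {k : ℕ} {f : MvPolynomial σ K} :
    f ∈ gradedPart J k ↔ f ∈ J ∧ f.IsHomogeneous k := Iff.rfl

theorem gradedPart_le (J : Ideal (MvPolynomial σ K)) (k : ℕ) :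
    gradedPart J k ≤ homogeneousSubmodule σ K k := inf_le_right

/-- The Hilbert function `k ↦ dim (S/J)_k`. -/
noncomputable def hilbertFn (J : Ideal (MvPolynomial σ K)) (k : ℕ) : ℕ :=
  Module.finrank K (homogeneousSubmodule σ K k) - Module.finrank K (gradedPart J k)

/-- The Hilbert series of `S/J`. -/
noncomputable def hilbertSeries (J : Ideal (MvPolynomial σ K)) : PowerSeries ℚ :=
  PowerSeries.mk fun k => (hilbertFn J k : ℚ)

theorem gradedPart_bot (k : ℕ) : gradedPart (⊥ : Ideal (MvPolynomial σ K)) k = ⊥ := by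
  rw [eq_bot_iff]
  intro f hf
  exact (mem_gradedPart.mp hf).1

theorem hilbertFn_bot (k : ℕ) : hilbertFn (⊥ : Ideal (MvPolynomial σ K)) k =
    Module.finrank K (homogeneousSubmodule σ K k) := by
  rw [hilbertFn, gradedPart_bot, finrank_bot, Nat.sub_zero]

theorem hilbertFn_sup_span_of_lt (J : Ideal (MvPolynomial σ K)) (hJ : IsGradedIdeal J)
    {f : MvPolynomial σ K} {d : ℕ} (hf : f.IsHomogeneous d) {k : ℕ} (hk : k < d) :
    hilbertFn (J ⊔ Ideal.span {f}) k = hilbertFn J k := by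
  have : gradedPart (J ⊔ Ideal.span {f}) k = gradedPart J k := by
    refine le_antisymm ?_ (inf_le_inf_right _ (show J ≤ J ⊔ Ideal.span {f} from le_sup_left))
    intro g hg
    obtain ⟨hg, hgd⟩ := mem_gradedPart.mp hg
    obtain ⟨a, ha, b, hb, rfl⟩ := Submodule.mem_sup.mp hg
    obtain ⟨c, rfl⟩ := Ideal.mem_span_singleton'.mp hb
    rw [← homogeneousComponent_eq_self hgd, map_add, mul_comm c f,
      hf.homogeneousComponent_mul_of_lt c hk, add_zero]
    exact ⟨hJ _ ha _, homogeneousComponent_isHomogeneous _ _⟩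
  rw [hilbertFn, this, hilbertFn]

variable [Finite σ]

instance finite_homogeneousSubmodule (k : ℕ) :
    Module.Finite K (homogeneousSubmodule σ K k) :=
  Module.Finite.iff_fg.mpr (homogeneousSubmodule_fg σ K k)

instance finite_gradedPart (J : Ideal (MvPolynomial σ K)) (k : ℕ) :
    Module.Finite K (gradedPart J k) :=
  Submodule.finiteDimensional_of_le (gradedPart_le J k)

/-- The truncated subtraction in `hilbertFn` loses nothing, because the graded part of J lies in the
finite-dimensional space of all forms of that degree. -/
theorem hilbertFn_add (J : Ideal (MvPolynomial σ K)) (k : ℕ) :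
    hilbertFn J k + Module.finrank K (gradedPart J k) =
      Module.finrank K (homogeneousSubmodule σ K k) :=
  Nat.sub_add_cancel (Submodule.finrank_mono (gradedPart_le J k))

theorem hilbertFn_anti {J J' : Ideal (MvPolynomial σ K)} (h : J ≤ J') (k : ℕ) :
    hilbertFn J' k ≤ hilbertFn J k := by
  have : gradedPart J k ≤ gradedPart J' k := inf_le_inf_right _ h
  exact Nat.sub_le_sub_left (Submodule.finrank_mono this) _

/-- Multiplication by `f ≠ 0` gives the exact sequence
`0 → (S/(J:f))_k → (S/J)_{k+d} → (S/(J+f))_{k+d} → 0`. -/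
theorem hilbertFn_add_degree {J : Ideal (MvPolynomial σ K)} (hJ : IsGradedIdeal J)
    {f : MvPolynomial σ K} {d : ℕ} (hf : f.IsHomogeneous d) (hf0 : f ≠ 0) (k : ℕ) :
    hilbertFn J (k + d) = hilbertFn (colonIdeal J f) k + hilbertFn (J ⊔ Ideal.span {f}) (k + d) := by
  have hinj : Function.Injective (LinearMap.mulLeft K f) := fun a b hab =>
    mul_left_cancel₀ hf0 (by simpa using hab)
  have hsup : gradedPart (J ⊔ Ideal.span {f}) (k + d) =
      gradedPart J (k + d) ⊔ (homogeneousSubmodule σ K k).map (LinearMap.mulLeft K f) := by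
    apply le_antisymm
    · intro g hg
      obtain ⟨hg, hgd⟩ := mem_gradedPart.mp hg
      obtain ⟨a, ha, b, hb, rfl⟩ := Submodule.mem_sup.mp hg
      obtain ⟨c, rfl⟩ := Ideal.mem_span_singleton'.mp hb
      rw [← homogeneousComponent_eq_self hgd, map_add, mul_comm c f, hf.homogeneousComponent_mul]
      refine Submodule.add_mem_sup ⟨hJ _ ha _, homogeneousComponent_isHomogeneous _ _⟩ ?_
      exact ⟨_, homogeneousComponent_isHomogeneous k c, rfl⟩
    · refine sup_le (inf_le_inf_right _ (show J ≤ J ⊔ Ideal.span {f} from le_sup_left)) ?_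
      rintro _ ⟨c, hc, rfl⟩
      refine ⟨?_, ?_⟩
      · exact Ideal.mem_sup_right (Ideal.mul_mem_right _ _ (Ideal.mem_span_singleton_self f))
      · rw [add_comm k d]; exact hf.mul hc
  have hinf : gradedPart J (k + d) ⊓ (homogeneousSubmodule σ K k).map (LinearMap.mulLeft K f) =
      (gradedPart (colonIdeal J f) k).map (LinearMap.mulLeft K f) := by
    ext g
    constructor
    · rintro ⟨h1, c, hc, rfl⟩
      exact ⟨c, ⟨h1.1, hc⟩, rfl⟩
    · rintro ⟨c, ⟨h1, h2⟩, rfl⟩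
      refine ⟨⟨h1, ?_⟩, ⟨c, h2, rfl⟩⟩
      rw [add_comm k d]; exact hf.mul h2
  have e1 := Submodule.finrank_sup_add_finrank_inf_eq (gradedPart J (k + d))
    ((homogeneousSubmodule σ K k).map (LinearMap.mulLeft K f))
  rw [← hsup, hinf, ← (Submodule.equivMapOfInjective _ hinj _).finrank_eq,
    ← (Submodule.equivMapOfInjective _ hinj _).finrank_eq] at e1
  have e2 := hilbertFn_add J (k + d)
  have e3 := hilbertFn_add (colonIdeal J f) k
  have e4 := hilbertFn_add (J ⊔ Ideal.span {f}) (k + d)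
  omega

theorem hilbertSeries_eq {J : Ideal (MvPolynomial σ K)} (hJ : IsGradedIdeal J)
    {f : MvPolynomial σ K} {d : ℕ} (hf : f.IsHomogeneous d) (hf0 : f ≠ 0) :
    hilbertSeries J = PowerSeries.X ^ d * hilbertSeries (colonIdeal J f) +
      hilbertSeries (J ⊔ Ideal.span {f}) := by
  ext k
  rw [map_add, PowerSeries.coeff_X_pow_mul']
  simp only [hilbertSeries, PowerSeries.coeff_mk]
  split_ifs with h
  · obtain ⟨j, rfl⟩ := Nat.exists_eq_add_of_le' h
    rw [hilbertFn_add_degree hJ hf hf0, Nat.add_sub_cancel]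
    push_cast
    rfl
  · rw [hilbertFn_sup_span_of_lt J hJ hf (not_le.mp h), zero_add]

/-- The Hilbert series of the quotient by a nonzerodivisor. -/
theorem hilbertSeries_sup_span {J : Ideal (MvPolynomial σ K)} (hJ : IsGradedIdeal J)
    {f : MvPolynomial σ K} {d : ℕ} (hf : f.IsHomogeneous d) (hf0 : f ≠ 0)
    (hreg : ∀ g, f * g ∈ J → g ∈ J) :
    hilbertSeries (J ⊔ Ideal.span {f}) = (1 - PowerSeries.X ^ d) * hilbertSeries J := by
  have hc : colonIdeal J f = J := le_antisymm (fun g hg => hreg g hg) (le_colonIdeal J f)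
  have h := hilbertSeries_eq hJ hf hf0
  rw [hc] at h
  linear_combination -h

/-- **Hilbert-Serre**: the Hilbert series of a graded quotient is rational. -/
theorem exists_hilbertSeries_mul_eq {J : Ideal (MvPolynomial σ K)} (hJ : IsGradedIdeal J) :
    ∃ (N : ℕ) (p : Polynomial ℚ),
      hilbertSeries J * (1 - PowerSeries.X) ^ N = (p : PowerSeries ℚ) := by
  induction J using IsNoetherian.induction with
  | hgt J ih =>
  -- Noetherian induction. In the base case J contains all variables, so S/J lives in degree 0 and
  -- its series is a constant.
  by_cases hX : ∀ i, (X i : MvPolynomial σ K) ∈ J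
  · refine ⟨0, Polynomial.C (hilbertFn J 0 : ℚ), ?_⟩
    ext k
    rw [pow_zero, mul_one, hilbertSeries, PowerSeries.coeff_mk, Polynomial.coeff_coe,
      Polynomial.coeff_C]
    split_ifs with hk
    · rw [hk]
    · rw [hilbertFn]
      have : gradedPart J k = homogeneousSubmodule σ K k := by
        refine inf_eq_right.mpr fun f hf => ?_
        have h1 : f ∈ idealOfVars σ K ^ k := by
          rw [mem_pow_idealOfVars_iff']
          intro x hx
          exact (mem_homogeneousSubmodule k f).mp hf |>.coeff_eq_zero hx.ne
        have h2 : idealOfVars σ K ≤ J := Ideal.span_le.mpr (by rintro _ ⟨i, rfl⟩; exact hX i)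
        exact h2 (Ideal.pow_le_self hk h1)
      rw [this, Nat.sub_self, Nat.cast_zero]
  · push Not at hX
    obtain ⟨i, hi⟩ := hX
    have h1 : J < J ⊔ Ideal.span {X i} := by
      refine lt_of_le_of_ne le_sup_left fun h => hi ?_
      rw [h]
      exact Ideal.mem_sup_right (Ideal.mem_span_singleton_self _)
    obtain ⟨N, p, hp⟩ := ih _ h1 (hJ.sup (isGradedIdeal_span_singleton (isHomogeneous_X K i)))
    have hXi : (X i : MvPolynomial σ K) ≠ 0 := X_ne_zero i
    -- If X i is a nonzerodivisor modulo J, one more factor 1 − T suffices. Otherwise J : X i is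
    -- strictly larger than J, and the induction hypothesis applies to both outer terms of the exact
    -- sequence.
    by_cases hc : colonIdeal J (X i) = J
    · refine ⟨N + 1, p, ?_⟩
      rw [hilbertSeries_sup_span hJ (isHomogeneous_X K i) hXi
        (fun g hg => by rw [← hc]; exact hg)] at hp
      rw [← hp]
      ring
    · obtain ⟨N', p', hp'⟩ := ih _ (lt_of_le_of_ne (le_colonIdeal J _) (Ne.symm hc))
        (hJ.colonIdeal (isHomogeneous_X K i))
      refine ⟨N + N', Polynomial.X * p' * (1 - Polynomial.X) ^ N +
        p * (1 - Polynomial.X) ^ N', ?_⟩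
      rw [hilbertSeries_eq hJ (isHomogeneous_X K i) hXi]
      push_cast
      rw [← hp, ← hp']
      ring

theorem exists_polynomial_eval_eq_hilbertFn {J : Ideal (MvPolynomial σ K)}
    (hJ : IsGradedIdeal J) :
    ∃ P : Polynomial ℚ, ∀ᶠ n : ℕ in Filter.atTop, P.eval (n : ℚ) = hilbertFn J n := by
  obtain ⟨N, p, hp⟩ := exists_hilbertSeries_mul_eq hJ
  refine ⟨Polynomial.hilbertPoly p N, ?_⟩
  filter_upwards [Filter.eventually_gt_atTop p.natDegree] with n hn
  rw [← Polynomial.coeff_mul_invOneSubPow_eq_hilbertPoly_eval N hn, ← hp, mul_assoc]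
  have : ((1 : PowerSeries ℚ) - PowerSeries.X) ^ N * (PowerSeries.invOneSubPow ℚ N : PowerSeries ℚ)
      = 1 := by
    rw [← PowerSeries.invOneSubPow_inv_eq_one_sub_pow]
    exact (PowerSeries.invOneSubPow ℚ N).inv_val
  rw [this, mul_one, hilbertSeries, PowerSeries.coeff_mk]

/-- Stars and bars: monomials of degree k form a basis. -/
theorem finrank_homogeneousSubmodule (K : Type*) [Field K] (N k : ℕ) :
    Module.finrank K (homogeneousSubmodule (Fin N) K k) = N.multichoose k := by
  rw [homogeneousSubmodule_eq_finsupp_supported,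
    (AddMonoidAlgebra.supportedEquivFinsupp {d : Fin N →₀ ℕ | d.degree = k}).finrank_eq]
  have e : {d : Fin N →₀ ℕ | d.degree = k} =
      ((Finset.finsuppAntidiag Finset.univ k : Finset (Fin N →₀ ℕ)) : Set (Fin N →₀ ℕ)) := by
    ext d
    simp [Finset.mem_finsuppAntidiag, Finsupp.degree_eq_sum]
  rw [e, Module.finrank_finsupp_self, ← Nat.card_eq_fintype_card, Nat.card_coe_set_eq,
    Set.ncard_coe_finset, Finset.card_finsuppAntidiag_nat_eq_multichoose, Finset.card_univ, Fintype.card_fin]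

theorem hilbertSeries_bot_mul (K : Type*) [Field K] (N : ℕ) :
    hilbertSeries (⊥ : Ideal (MvPolynomial (Fin N) K)) * (1 - PowerSeries.X) ^ N = 1 := by
  have h : hilbertSeries (⊥ : Ideal (MvPolynomial (Fin N) K)) =
      (PowerSeries.invOneSubPow ℚ N : PowerSeries ℚ) := by
    ext k
    rw [hilbertSeries, PowerSeries.coeff_mk, hilbertFn_bot, finrank_homogeneousSubmodule]
    cases N with
    | zero =>
      rw [PowerSeries.invOneSubPow_zero, Units.val_one, PowerSeries.coeff_one]
      cases k <;> simp
    | succ d =>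
      rw [PowerSeries.invOneSubPow_val_succ_eq_mk_add_choose, PowerSeries.coeff_mk,
        Nat.multichoose_eq, show d + 1 + k - 1 = d + k by omega, Nat.choose_symm_add]
  rw [h, ← PowerSeries.invOneSubPow_inv_eq_one_sub_pow]
  exact (PowerSeries.invOneSubPow ℚ N).val_inv

end HilbertFunction

/-! ### Integer-valued polynomials and growth estimates. -/

open Polynomial in
/-- A polynomial with rational coefficients and degree at most `d` whose values at all large natural
numbers are integers has integral `d ! • (coeff d)`. -/
theorem Polynomial.exists_int_eq_factorial_mul_coeff (d : ℕ) (P : ℚ[X]) (hd : P.natDegree ≤ d)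
    (h : ∀ᶠ n : ℕ in Filter.atTop, ∃ z : ℤ, P.eval (n : ℚ) = z) :
    ∃ z : ℤ, (d.factorial : ℚ) * P.coeff d = z := by
  induction d generalizing P with
  | zero =>
    obtain ⟨n, z, hz⟩ := h.exists
    refine ⟨z, ?_⟩
    rw [← hz, eq_C_of_natDegree_le_zero hd]
    simp
  | succ d ih =>
    -- Induction via the forward difference P(X+1) − P. Only coefficients from index d upwards
    -- matter, and there the binomial expansion reduces to the terms i = d and i = d + 1.
    have hco : ∀ j, d ≤ j → (P.comp (X + 1) - P).coeff j =
        (d + 1 : ℚ) * (if j = d then P.coeff (d + 1) else 0) := by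
      intro j hj
      have h1 : (P.comp (X + 1)).coeff j = ∑ i ∈ Finset.range (d + 2), P.coeff i * (i.choose j : ℚ) := by
        rw [comp_eq_sum_left, sum_over_range' _ (by simp) (d + 2) (by omega), finsetSum_coeff]
        refine Finset.sum_congr rfl fun i _ => ?_
        rw [coeff_C_mul, coeff_X_add_one_pow]
      rw [coeff_sub, h1, Finset.sum_range_succ, Finset.sum_range_succ,
        Finset.sum_eq_zero (fun i hi => by
          rw [Nat.choose_eq_zero_of_lt (by simp at hi; omega), Nat.cast_zero, mul_zero])]
      rcases Nat.eq_or_lt_of_le hj with rfl | hj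
      · simp; ring
      · rcases Nat.eq_or_lt_of_le (Nat.succ_le_of_lt hj) with rfl | hj'
        · simp
        · rw [Nat.choose_eq_zero_of_lt hj, Nat.choose_eq_zero_of_lt hj',
            coeff_eq_zero_of_natDegree_lt (show P.natDegree < j by omega), if_neg (by omega)]
          simp
    obtain ⟨z, hz⟩ := ih (P.comp (X + 1) - P) (by
      rw [natDegree_le_iff_coeff_eq_zero]
      intro j hj
      rw [hco j hj.le, if_neg (by omega), mul_zero]) (by
      have h' := (Filter.tendsto_add_atTop_nat 1).eventually h
      filter_upwards [h, h'] with n ⟨a, ha⟩ ⟨b, hb⟩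
      refine ⟨b - a, ?_⟩
      rw [eval_sub, eval_comp, ha]
      push_cast at hb ⊢
      simp [hb])
    refine ⟨z, ?_⟩
    rw [← hz, hco d le_rfl, if_pos rfl, Nat.factorial_succ]
    push_cast
    ring

open Polynomial in
theorem Polynomial.leadingCoeff_nonneg_of_eventually (P : ℚ[X])
    (h : ∀ᶠ n : ℕ in Filter.atTop, 0 ≤ P.eval (n : ℚ)) : 0 ≤ P.leadingCoeff := by
  by_contra hlt
  push Not at hlt
  by_cases hd : 0 < P.degree
  · have h1 := (P.tendsto_atBot_of_leadingCoeff_nonpos hd hlt.le).comp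
      (tendsto_natCast_atTop_atTop (R := ℚ))
    obtain ⟨n, hn, hn'⟩ := (h.and (h1.eventually_lt_atBot 0)).exists
    exact absurd hn (not_le.mpr hn')
  · obtain ⟨n, hn⟩ := h.exists
    have e := eq_C_of_degree_le_zero (not_lt.mp hd)
    rw [e, eval_C] at hn
    rw [e, leadingCoeff_C] at hlt
    exact absurd hn (not_le.mpr hlt)

open Polynomial in
/-- A polynomial squeezed between `(n+d).choose d` and `c * (n+d).choose d`, with integer values. -/
theorem Polynomial.exists_degree_eq_of_le_of_le (d c : ℕ) (H : ℕ → ℕ) (P : ℚ[X])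
    (hP : ∀ᶠ n : ℕ in Filter.atTop, P.eval (n : ℚ) = H n)
    (hlow : ∀ᶠ n : ℕ in Filter.atTop, (n + d).choose d ≤ H n)
    (hupp : ∀ᶠ n : ℕ in Filter.atTop, H n ≤ c * (n + d).choose d) :
    ∃ e : ℕ, P.degree = (d : WithBot ℕ) ∧ (d.factorial : ℚ) * P.leadingCoeff = e ∧ e ≤ c := by
  set h := preHilbertPoly ℚ d 0 with hh
  have heval : ∀ n : ℕ, h.eval (n : ℚ) = (n + d).choose d := fun n => by
    rw [hh, preHilbertPoly_eq_choose_sub_add ℚ d (Nat.zero_le n), Nat.sub_zero]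
  have hf : (0 : ℚ) < d.factorial := by exact_mod_cast d.factorial_pos
  have hnd : h.natDegree = d := natDegree_preHilbertPoly ℚ d 0
  have hlc : h.coeff d = (d.factorial : ℚ)⁻¹ := coeff_preHilbertPoly_self ℚ d 0
  -- With h(n) = (n+d choose d), both P − h and c·h − P are eventually nonnegative. If P had degree
  -- above d, its leading coefficient would have to be both nonnegative and nonpositive.
  have h1 : 0 ≤ (P - h).leadingCoeff := leadingCoeff_nonneg_of_eventually _ (by
    filter_upwards [hP, hlow] with n h1 h2
    rw [eval_sub, heval, h1, sub_nonneg]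
    exact_mod_cast h2)
  have h2 : 0 ≤ (C (c : ℚ) * h - P).leadingCoeff := leadingCoeff_nonneg_of_eventually _ (by
    filter_upwards [hP, hupp] with n h1 h2
    rw [eval_sub, eval_mul, eval_C, heval, h1, sub_nonneg]
    exact_mod_cast h2)
  have key : ∀ j, h.natDegree < j → h.coeff j = 0 := fun j hj => coeff_eq_zero_of_natDegree_lt hj
  have hle : P.natDegree ≤ d := by
    by_contra hlt
    push Not at hlt
    have hP0 : P.coeff P.natDegree ≠ 0 := by
      rw [coeff_natDegree, leadingCoeff_ne_zero]
      rintro rfl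
      simp at hlt
    have e1 : (P - h).natDegree = P.natDegree :=
      natDegree_sub_eq_left_of_natDegree_lt (by omega)
    have e2 : (C (c : ℚ) * h - P).natDegree = P.natDegree :=
      natDegree_sub_eq_right_of_natDegree_lt ((natDegree_C_mul_le _ _).trans_lt (by omega))
    rw [leadingCoeff, e1, coeff_sub, key _ (by omega), sub_zero] at h1
    rw [leadingCoeff, e2, coeff_sub, coeff_C_mul, key _ (by omega), mul_zero, zero_sub] at h2
    exact hP0 (le_antisymm (by linarith) h1)
  have hcoeff : ∀ Q : ℚ[X], Q.natDegree ≤ d → 0 ≤ Q.leadingCoeff → 0 ≤ Q.coeff d := by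
    intro Q hQ hl
    rcases hQ.eq_or_lt with hQ | hQ
    · rwa [leadingCoeff, hQ] at hl
    · rw [coeff_eq_zero_of_natDegree_lt hQ]
  have c1 := hcoeff _ ((natDegree_sub_le_of_le hle hnd.le).trans (max_self d).le) h1
  have c2 := hcoeff _ ((natDegree_sub_le_of_le ((natDegree_C_mul_le _ _).trans hnd.le) hle).trans
    (max_self d).le) h2
  rw [coeff_sub, hlc] at c1
  rw [coeff_sub, coeff_C_mul, hlc] at c2
  have hpos : 0 < P.coeff d := lt_of_lt_of_le (inv_pos.mpr hf) (by linarith)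
  have hdeg : P.natDegree = d := le_antisymm hle (le_natDegree_of_ne_zero hpos.ne')
  obtain ⟨z, hz⟩ := exists_int_eq_factorial_mul_coeff d P hle (by
    filter_upwards [hP] with n hn
    exact ⟨H n, by rw [hn]; simp⟩)
  have hz0 : 0 ≤ z := by
    have : (0 : ℚ) ≤ z := hz ▸ by positivity
    exact_mod_cast this
  lift z to ℕ using hz0
  refine ⟨z, ?_, ?_, ?_⟩
  · rw [degree_eq_natDegree (by rintro rfl; simp at hpos), hdeg]
  · rw [leadingCoeff, hdeg, hz]; simp
  · have : (z : ℚ) ≤ c := by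
      have hz' : (d.factorial : ℚ) * P.coeff d = z := by rw [hz]; simp
      rw [← hz']
      have : (d.factorial : ℚ) * P.coeff d ≤ d.factorial * (c * (d.factorial : ℚ)⁻¹) :=
        mul_le_mul_of_nonneg_left (by linarith) hf.le
      refine this.trans_eq ?_
      field_simp
    exact_mod_cast this

/-! ### Hilbert–Samuel functions over a coefficient field. -/

/-- The length of a module killed by the maximal ideal is its dimension over a coefficient field. -/
theorem length_eq_finrank_of_maximalIdeal_smul_eq_zero {R K X V : Type*} [CommRing R] [IsLocalRing R]
    [Field K] [Algebra K R] [AddCommGroup X] [Module R X] [AddCommGroup V] [Module K V]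
    [Module.Finite K V]
    (hX : ∀ r ∈ IsLocalRing.maximalIdeal R, ∀ x : X, r • x = 0)
    (hK : ∀ r : R, ∃ c : K, r - algebraMap K R c ∈ IsLocalRing.maximalIdeal R)
    (φ : V →+ X) (hφ : ∀ (c : K) v, φ (c • v) = algebraMap K R c • φ v)
    (hsurj : Function.Surjective φ) (W : Submodule K V) (hW : ∀ v, φ v = 0 ↔ v ∈ W) :
    Module.length R X = ((Module.finrank K V - Module.finrank K W : ℕ) : ℕ∞) := by
  let : Module K X := Module.compHom X (algebraMap K R)
  have hsmul : ∀ (c : K) (x : X), c • x = algebraMap K R c • x := fun _ _ => rfl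
  have : IsScalarTower K R X := ⟨fun c r x => by rw [hsmul, Algebra.smul_def, mul_smul]⟩
  -- R acts on X through its residue field K, so K-subspaces and R-submodules are the same thing.
  let e : Submodule K X ≃o Submodule R X :=
    { toFun := fun N =>
        { N with
          smul_mem' := fun r x hx => by
            obtain ⟨c, hc⟩ := hK r
            have h : r • x = c • x := by
              rw [hsmul, ← sub_eq_zero, ← sub_smul]
              exact hX _ hc x
            rw [h]
            exact N.smul_mem c hx }
      invFun := fun N => N.restrictScalars K
      left_inv := fun N => rfl
      right_inv := fun N => rfl
      map_rel_iff' := Iff.rfl }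
  have h1 : Module.length R X = Module.length K X := by
    rw [Module.length, Module.length, WithBot.unbot_inj, Order.krullDim_eq_of_orderIso e]
  let ψ : V →ₗ[K] X := { φ with map_smul' := fun c v => hφ c v }
  have hψ : Function.Surjective ψ := hsurj
  have : Module.Finite K X := Module.Finite.of_surjective ψ hψ
  have hker : LinearMap.ker ψ = W := by
    ext v
    exact hW v
  rw [h1, Module.length_eq_finrank]
  have h2 := ψ.finrank_range_add_finrank_ker
  rw [LinearMap.range_eq_top.mpr hψ, finrank_top, hker] at h2
  rw [← h2, Nat.add_sub_cancel]

theorem Submodule.mem_submoduleOf_iff {R M : Type*} [Ring R] [AddCommGroup M] [Module R M]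
    {N P : Submodule R M} {x : P} : x ∈ N.submoduleOf P ↔ (x : M) ∈ N := Iff.rfl

/-- An abstract comparison: a K-space V mapping onto 𝔪ⁿM modulo 𝔪ⁿ⁺¹M, with known kernel W, computes
the length. It is applied with V the forms of degree n. -/
theorem hilbertSamuelFunction_eq_finrank {R K M V : Type*} [CommRing R] [IsLocalRing R]
    [Field K] [Algebra K R] [AddCommGroup M] [Module R M] [AddCommGroup V] [Module K V]
    [Module.Finite K V] (n : ℕ)
    (hK : ∀ r : R, ∃ c : K, r - algebraMap K R c ∈ IsLocalRing.maximalIdeal R)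
    (φ : V →+ M) (hφ : ∀ (c : K) v, φ (c • v) = algebraMap K R c • φ v)
    (hmem : ∀ v, φ v ∈ IsLocalRing.maximalIdeal R ^ n • (⊤ : Submodule R M))
    (hsurj : ∀ x ∈ IsLocalRing.maximalIdeal R ^ n • (⊤ : Submodule R M),
      ∃ v, φ v - x ∈ IsLocalRing.maximalIdeal R ^ (n + 1) • (⊤ : Submodule R M))
    (W : Submodule K V)
    (hW : ∀ v, φ v ∈ IsLocalRing.maximalIdeal R ^ (n + 1) • (⊤ : Submodule R M) ↔ v ∈ W) :
    hilbertSamuelFunction R M n =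
      ((Module.finrank K V - Module.finrank K W : ℕ) : ℕ∞) := by
  rw [hilbertSamuelFunction]
  set N : ℕ → Submodule R M := fun k => IsLocalRing.maximalIdeal R ^ k • ⊤ with hN
  have hNs : ∀ j, IsLocalRing.maximalIdeal R • N j = N (j + 1) := fun j => by
    simp only [hN]
    rw [pow_succ', Submodule.mul_smul]
  change Module.length R (N n ⧸ (N (n + 1)).submoduleOf (N n)) = _
  let φ₀ : V →+ N n :=
    { toFun := fun v => ⟨φ v, hmem v⟩
      map_zero' := Subtype.ext (by simp)
      map_add' := fun f g => Subtype.ext (by simp) }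
  let ψ : V →+ (N n ⧸ (N (n + 1)).submoduleOf (N n)) :=
    (Submodule.mkQ ((N (n + 1)).submoduleOf (N n))).toAddMonoidHom.comp φ₀
  refine length_eq_finrank_of_maximalIdeal_smul_eq_zero ?_ hK ψ ?_ ?_ W ?_
  · intro r hr x
    obtain ⟨x, rfl⟩ := Submodule.mkQ_surjective _ x
    rw [← map_smul, Submodule.mkQ_apply, Submodule.Quotient.mk_eq_zero, Submodule.mem_submoduleOf_iff,
      ← hNs]
    exact Submodule.smul_mem_smul hr x.2
  · intro c f
    change Submodule.mkQ _ (φ₀ (c • f)) = _ • Submodule.mkQ _ (φ₀ f)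
    rw [← map_smul]
    congr 1
    exact Subtype.ext (hφ c f)
  · intro x
    obtain ⟨x, rfl⟩ := Submodule.mkQ_surjective _ x
    obtain ⟨v, hv⟩ := hsurj x.1 x.2
    refine ⟨v, ?_⟩
    change Submodule.mkQ _ (φ₀ _) = _
    rw [Submodule.mkQ_apply, Submodule.mkQ_apply, Submodule.Quotient.eq, Submodule.mem_submoduleOf_iff]
    exact hv
  · intro v
    change Submodule.mkQ _ (φ₀ v) = 0 ↔ _
    rw [Submodule.mkQ_apply, Submodule.Quotient.mk_eq_zero, Submodule.mem_submoduleOf_iff]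
    exact hW v

/-! ### Localization of a graded quotient at the irrelevant ideal. -/

section Localization

open MvPolynomial

variable {K : Type*} [Field K] {n : ℕ}

theorem mem_idealOfVars_iff_constantCoeff {f : MvPolynomial (Fin (n + 1)) K} :
    f ∈ idealOfVars (Fin (n + 1)) K ↔ constantCoeff f = 0 := by
  rw [← pow_one (idealOfVars _ _), mem_pow_idealOfVars_iff', constantCoeff_eq]
  constructor
  · intro h
    exact h 0 (by simp)
  · intro h x hx
    rw [Nat.lt_one_iff, Finsupp.degree_eq_zero_iff] at hx
    rw [hx, h]

theorem mem_pow_idealOfVars_of_isHomogeneous {f : MvPolynomial (Fin (n + 1)) K} {k : ℕ}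
    (hf : f.IsHomogeneous k) : f ∈ idealOfVars (Fin (n + 1)) K ^ k := by
  rw [mem_pow_idealOfVars_iff']
  exact fun x hx => hf.coeff_eq_zero hx.ne

theorem sub_homogeneousComponent_mem_pow {f : MvPolynomial (Fin (n + 1)) K} {k : ℕ}
    (hf : f ∈ idealOfVars (Fin (n + 1)) K ^ k) :
    f - homogeneousComponent k f ∈ idealOfVars (Fin (n + 1)) K ^ (k + 1) := by
  rw [mem_pow_idealOfVars_iff'] at hf ⊢
  intro x hx
  rw [coeff_sub, coeff_homogeneousComponent]
  split_ifs with h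
  · exact sub_self _
  · rw [sub_zero]
    exact hf x (by omega)

theorem homogeneousComponent_eq_zero_of_mem_pow {f : MvPolynomial (Fin (n + 1)) K} {k : ℕ}
    (hf : f ∈ idealOfVars (Fin (n + 1)) K ^ (k + 1)) : homogeneousComponent k f = 0 := by
  rw [mem_pow_idealOfVars_iff'] at hf
  ext x
  rw [coeff_homogeneousComponent, coeff_zero]
  split_ifs with h
  · exact hf x (by omega)
  · rfl

local notation "𝔪" => idealOfVars (Fin (n + 1)) K
local notation "Sₘ" => Localization.AtPrime (idealOfVars (Fin (n + 1)) K)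

variable (q : Ideal (MvPolynomial (Fin (n + 1)) K))

/-- The canonical map from the polynomial ring to the localization of a quotient at the
irrelevant ideal. -/
noncomputable def toLocalizedQuotient : MvPolynomial (Fin (n + 1)) K →ₗ[MvPolynomial (Fin (n + 1)) K]
    LocalizedModule (𝔪).primeCompl (MvPolynomial (Fin (n + 1)) K ⧸ q) :=
  (LocalizedModule.mkLinearMap _ _).comp (Submodule.mkQ q)

theorem toLocalizedQuotient_eq_iff {f g : MvPolynomial (Fin (n + 1)) K} :
    toLocalizedQuotient q f = toLocalizedQuotient q g ↔
      ∃ t : MvPolynomial (Fin (n + 1)) K, t ∉ 𝔪 ∧ t * (f - g) ∈ q := by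
  rw [← sub_eq_zero, ← map_sub]
  rw [toLocalizedQuotient, LinearMap.comp_apply, IsLocalizedModule.eq_zero_iff (𝔪).primeCompl]
  constructor
  · rintro ⟨t, ht⟩
    refine ⟨t, t.2, ?_⟩
    rw [← Submodule.Quotient.mk_eq_zero]
    exact ht
  · rintro ⟨t, ht, htq⟩
    refine ⟨⟨t, ht⟩, ?_⟩
    rw [← Submodule.Quotient.mk_eq_zero] at htq
    exact htq

theorem algebraMap_mem_maximalIdeal_pow {f : MvPolynomial (Fin (n + 1)) K} {k : ℕ}
    (hf : f ∈ 𝔪 ^ k) : algebraMap _ Sₘ f ∈ IsLocalRing.maximalIdeal Sₘ ^ k := by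
  rw [← Localization.AtPrime.map_eq_maximalIdeal, ← Ideal.map_pow]
  exact Ideal.mem_map_of_mem _ hf

theorem toLocalizedQuotient_mem {f : MvPolynomial (Fin (n + 1)) K} {k : ℕ} (hf : f ∈ 𝔪 ^ k) :
    toLocalizedQuotient q f ∈ IsLocalRing.maximalIdeal Sₘ ^ k •
      (⊤ : Submodule Sₘ (LocalizedModule (𝔪).primeCompl (MvPolynomial (Fin (n + 1)) K ⧸ q))) := by
  have : toLocalizedQuotient q f = algebraMap _ Sₘ f • toLocalizedQuotient q 1 := by
    rw [algebraMap_smul, ← map_smul, smul_eq_mul, mul_one]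
  rw [this]
  exact Submodule.smul_mem_smul (algebraMap_mem_maximalIdeal_pow hf) trivial

/-- Clearing denominators: it lets membership in the powers of the local maximal ideal be tested on
polynomials in 𝔪ᵏ. -/
theorem exists_smul_eq_toLocalizedQuotient {k : ℕ}
    {x : LocalizedModule (𝔪).primeCompl (MvPolynomial (Fin (n + 1)) K ⧸ q)}
    (hx : x ∈ IsLocalRing.maximalIdeal Sₘ ^ k •
      (⊤ : Submodule Sₘ (LocalizedModule (𝔪).primeCompl (MvPolynomial (Fin (n + 1)) K ⧸ q)))) :
    ∃ s ∉ 𝔪, ∃ g ∈ 𝔪 ^ k, s • x = toLocalizedQuotient q g := by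
  induction hx using Submodule.smul_induction_on' with
  | smul r hr y _ =>
    rw [← Localization.AtPrime.map_eq_maximalIdeal, ← Ideal.map_pow,
      IsLocalization.mem_map_algebraMap_iff (𝔪).primeCompl] at hr
    obtain ⟨⟨⟨a, ha⟩, s⟩, hs⟩ := hr
    obtain ⟨⟨y', t⟩, hy⟩ := IsLocalizedModule.surj (𝔪).primeCompl
      (LocalizedModule.mkLinearMap (𝔪).primeCompl (MvPolynomial (Fin (n + 1)) K ⧸ q)) y
    obtain ⟨b, rfl⟩ := Submodule.mkQ_surjective q y'
    refine ⟨s * t, (s * t).2, a * b, Ideal.mul_mem_right _ _ ha, ?_⟩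
    have h1 : (s : MvPolynomial (Fin (n + 1)) K) • r = algebraMap _ Sₘ a := by
      rw [Algebra.smul_def, mul_comm]; exact hs
    have h2 : (t : MvPolynomial (Fin (n + 1)) K) • y = toLocalizedQuotient q b := hy
    calc ((s * t : (𝔪).primeCompl) : MvPolynomial (Fin (n + 1)) K) • r • y
        = ((s : MvPolynomial (Fin (n + 1)) K) • r) • ((t : MvPolynomial (Fin (n + 1)) K) • y) := by
          rw [smul_assoc, Submonoid.coe_mul, mul_smul,
            ← algebraMap_smul Sₘ (t : MvPolynomial (Fin (n + 1)) K) (r • y),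
            ← algebraMap_smul Sₘ (t : MvPolynomial (Fin (n + 1)) K) y, smul_smul, smul_smul,
            mul_comm]
      _ = toLocalizedQuotient q (a * b) := by
          rw [h1, h2, algebraMap_smul, ← map_smul, smul_eq_mul]
  | add x _ y _ hx hy =>
    obtain ⟨s, hs, g, hg, h⟩ := hx
    obtain ⟨s', hs', g', hg', h'⟩ := hy
    refine ⟨s * s', fun hm => ?_, s' * g + s * g',
      Ideal.add_mem _ (Ideal.mul_mem_left _ _ hg) (Ideal.mul_mem_left _ _ hg'), ?_⟩
    · rcases (isPrime_idealOfVars K n).mem_or_mem hm with h | h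
      exacts [hs h, hs' h]
    · rw [smul_add, map_add, ← smul_eq_mul s' g, ← smul_eq_mul s g', map_smul, map_smul, ← h, ← h',
        smul_smul, smul_smul, mul_comm s' s]

/-- A graded ring is its own associated graded ring: elements outside 𝔪 act on each graded piece
modulo higher degree through their nonzero constant term, so localizing changes no graded piece. -/
theorem hilbertSamuelFunction_eq_hilbertFn (hq : IsGradedIdeal q) (k : ℕ) :
    hilbertSamuelFunction Sₘ
      (LocalizedModule (𝔪).primeCompl (MvPolynomial (Fin (n + 1)) K ⧸ q)) k = hilbertFn q k := by
  have hC : ∀ (c : K) (x : LocalizedModule (𝔪).primeCompl (MvPolynomial (Fin (n + 1)) K ⧸ q)),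
      algebraMap K Sₘ c • x = (C c : MvPolynomial (Fin (n + 1)) K) • x := fun c x => by
    rw [IsScalarTower.algebraMap_apply K (MvPolynomial (Fin (n + 1)) K) Sₘ, algebraMap_smul,
      algebraMap_eq]
  have h0 : ∀ f, f ∈ 𝔪 → algebraMap _ Sₘ f ∈ IsLocalRing.maximalIdeal Sₘ := fun f hf => by
    rw [← pow_one (IsLocalRing.maximalIdeal Sₘ)]
    exact algebraMap_mem_maximalIdeal_pow (by rwa [pow_one])
  have hsub : ∀ s : MvPolynomial (Fin (n + 1)) K, s - C (constantCoeff s) ∈ 𝔪 := fun s => by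
    rw [mem_idealOfVars_iff_constantCoeff]; simp
  let φ : homogeneousSubmodule (Fin (n + 1)) K k →+
      LocalizedModule (𝔪).primeCompl (MvPolynomial (Fin (n + 1)) K ⧸ q) :=
    (toLocalizedQuotient q).toAddMonoidHom.comp
      (homogeneousSubmodule (Fin (n + 1)) K k).subtype.toAddMonoidHom
  have hφf : ∀ f : homogeneousSubmodule (Fin (n + 1)) K k, φ f = toLocalizedQuotient q f.1 :=
    fun _ => rfl
  have hmul : ∀ (j : ℕ) (r : MvPolynomial (Fin (n + 1)) K), r ∈ 𝔪 → ∀ x ∈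
      IsLocalRing.maximalIdeal Sₘ ^ j • (⊤ : Submodule Sₘ
        (LocalizedModule (𝔪).primeCompl (MvPolynomial (Fin (n + 1)) K ⧸ q))),
      r • x ∈ IsLocalRing.maximalIdeal Sₘ ^ (j + 1) • (⊤ : Submodule Sₘ
        (LocalizedModule (𝔪).primeCompl (MvPolynomial (Fin (n + 1)) K ⧸ q))) := by
    intro j r hr x hx
    rw [pow_succ', Submodule.mul_smul, ← algebraMap_smul Sₘ r x]
    exact Submodule.smul_mem_smul (h0 r hr) hx
  rw [hilbertSamuelFunction_eq_finrank (K := K) (V := homogeneousSubmodule (Fin (n + 1)) K k)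
    k ?_ φ ?_ ?_ ?_ ((gradedPart q k).submoduleOf (homogeneousSubmodule (Fin (n + 1)) K k)) ?_]
  · rw [hilbertFn, (Submodule.submoduleOfEquivOfLe (gradedPart_le q k)).finrank_eq]
  · intro r
    obtain ⟨⟨a, s⟩, hs⟩ := IsLocalization.surj (𝔪).primeCompl r
    have hs0 : constantCoeff (s : MvPolynomial (Fin (n + 1)) K) ≠ 0 := fun h =>
      s.2 (mem_idealOfVars_iff_constantCoeff.mpr h)
    -- The residue of a/s is a(0)/s(0).
    refine ⟨(constantCoeff (s : MvPolynomial (Fin (n + 1)) K))⁻¹ * constantCoeff a, ?_⟩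
    have hu := IsLocalization.map_units Sₘ s
    rw [← Ideal.unit_mul_mem_iff_mem _ hu, mul_sub, mul_comm _ r, hs,
      IsScalarTower.algebraMap_apply K (MvPolynomial (Fin (n + 1)) K) Sₘ, ← map_mul, ← map_sub]
    apply h0
    rw [mem_idealOfVars_iff_constantCoeff]
    simp [hs0]
  · intro c f
    rw [hφf, hφf]
    change toLocalizedQuotient q (c • f.1) = _
    rw [hC, ← map_smul, smul_eq_C_mul, smul_eq_mul]
  · intro f
    exact toLocalizedQuotient_mem q (mem_pow_idealOfVars_of_isHomogeneous f.2)
  · intro x hx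
    obtain ⟨s, hs, g, hg, h⟩ := exists_smul_eq_toLocalizedQuotient q hx
    have hs0 : constantCoeff s ≠ 0 := fun h => hs (mem_idealOfVars_iff_constantCoeff.mpr h)
    -- From s·x = g with s ≡ s(0) modulo 𝔪 and g ≡ gₖ modulo 𝔪ᵏ⁺¹ it follows that x ≡ s(0)⁻¹gₖ in
    -- the next quotient.
    refine ⟨⟨C (constantCoeff s)⁻¹ * homogeneousComponent k g,
      (homogeneousComponent_isHomogeneous k g).C_mul _⟩, ?_⟩
    rw [hφf]
    have h1 := hmul k _ (hsub s) x hx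
    have h2 := toLocalizedQuotient_mem q (sub_homogeneousComponent_mem_pow hg)
    have h3 : algebraMap K Sₘ (constantCoeff s)⁻¹ •
        ((s - C (constantCoeff s)) • x - toLocalizedQuotient q (g - homogeneousComponent k g)) =
        toLocalizedQuotient q (C (constantCoeff s)⁻¹ * homogeneousComponent k g) - x := by
      have h4 : (s - C (constantCoeff s)) • x =
          toLocalizedQuotient q g - (C (constantCoeff s) : MvPolynomial (Fin (n + 1)) K) • x := by
        rw [eq_sub_iff_add_eq, ← add_smul, sub_add_cancel, h]
      rw [h4, map_sub, hC, sub_sub_sub_cancel_left, smul_sub, smul_smul, ← C_mul,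
        inv_mul_cancel₀ hs0, C_1, one_smul, ← smul_eq_mul (C _), map_smul]
    rw [← h3]
    exact Submodule.smul_mem _ _ (Submodule.sub_mem _ h1 h2)
  · intro f
    rw [hφf, Submodule.mem_submoduleOf_iff]
    change _ ↔ f.1 ∈ gradedPart q k
    constructor
    · intro hf
      obtain ⟨s, hs, g, hg, h⟩ := exists_smul_eq_toLocalizedQuotient q hf
      rw [← map_smul, toLocalizedQuotient_eq_iff] at h
      obtain ⟨t, ht, h⟩ := h
      -- The degree k component of t(sf − g) is (ts)(0)·f, since g has order above k. It lies in q
      -- because q is graded, and (ts)(0) is invertible.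
      have h1 := hq _ h k
      have h2 : homogeneousComponent k (t * g) = 0 :=
        homogeneousComponent_eq_zero_of_mem_pow (Ideal.mul_mem_left _ _ hg)
      have h3 := (show f.1.IsHomogeneous k from f.2).homogeneousComponent_mul (t * s) 0
      rw [smul_eq_mul, mul_sub, map_sub, h2, sub_zero,
        show t * (s * f.1) = f.1 * (t * s) by ring] at h1
      rw [zero_add] at h3
      rw [h3, homogeneousComponent_zero] at h1
      have h4 : constantCoeff (t * s) ≠ 0 := by
        rw [map_mul]
        exact mul_ne_zero (fun h => ht (mem_idealOfVars_iff_constantCoeff.mpr h))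
          (fun h => hs (mem_idealOfVars_iff_constantCoeff.mpr h))
      refine ⟨?_, f.2⟩
      have h5 := Ideal.mul_mem_right (C (constantCoeff (t * s))⁻¹) _ h1
      rw [mul_assoc, ← constantCoeff_eq, ← C_mul, mul_inv_cancel₀ h4, C_1, mul_one] at h5
      exact h5
    · intro hf
      have : toLocalizedQuotient q f.1 = toLocalizedQuotient q 0 :=
        (toLocalizedQuotient_eq_iff q).mpr ⟨1, fun h => by
          simp [mem_idealOfVars_iff_constantCoeff] at h, by simpa using hf.1⟩
      rw [this, map_zero]
      exact Submodule.zero_mem _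

end Localization

/-- Additivity of length along the 𝔪-adic filtration. It serves the dimension-zero case, where the
multiplicity is the length itself. -/
theorem length_eq_sum_hilbertSamuelFunction_add (R M : Type*) [CommRing R] [IsLocalRing R]
    [AddCommGroup M] [Module R M] (k : ℕ) :
    Module.length R M = ∑ j ∈ Finset.range k, hilbertSamuelFunction R M j +
      Module.length R ↥(IsLocalRing.maximalIdeal R ^ k • (⊤ : Submodule R M)) := by
  induction k with
  | zero =>
    rw [Finset.range_zero, Finset.sum_empty, zero_add, pow_zero, Ideal.one_eq_top,
      Submodule.top_smul, Module.length_top]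
  | succ k ih =>
    have hle : IsLocalRing.maximalIdeal R ^ (k + 1) • (⊤ : Submodule R M) ≤
        IsLocalRing.maximalIdeal R ^ k • (⊤ : Submodule R M) :=
      Submodule.smul_mono_left (Ideal.pow_le_pow_right k.le_succ)
    rw [ih, Finset.sum_range_succ, add_assoc, hilbertSamuelFunction,
      Module.length_eq_add_of_exact
        ((IsLocalRing.maximalIdeal R ^ (k + 1) • (⊤ : Submodule R M)).submoduleOf
          (IsLocalRing.maximalIdeal R ^ k • (⊤ : Submodule R M))).subtype
        (Submodule.mkQ _) (Submodule.subtype_injective _) (Submodule.mkQ_surjective _)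
        (LinearMap.exact_subtype_mkQ _),
      (Submodule.submoduleOfEquivOfLe hle).length_eq, add_comm (Module.length R _)]

/-! ### Dimension of the localized quotient via an integral extension. -/

section SupportDim

variable {S A : Type*} [CommRing S] [CommRing A] [Algebra A S] (𝔪 q : Ideal S) [𝔪.IsPrime]

theorem mem_support_localizedModule_quotient_iff
    {P : PrimeSpectrum (Localization.AtPrime 𝔪)} :
    P ∈ Module.support (Localization.AtPrime 𝔪) (LocalizedModule 𝔪.primeCompl (S ⧸ q)) ↔
      q ≤ P.asIdeal.comap (algebraMap S (Localization.AtPrime 𝔪)) := by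
  rw [Module.mem_support_iff_exists_annihilator]
  constructor
  · rintro ⟨x, hx⟩ f hf
    rw [Ideal.mem_comap]
    apply hx
    rw [Submodule.mem_annihilator_span_singleton, algebraMap_smul]
    induction x using LocalizedModule.induction_on with
    | h x s =>
      rw [LocalizedModule.smul'_mk]
      obtain ⟨x, rfl⟩ := Ideal.Quotient.mk_surjective x
      have : f • (Ideal.Quotient.mk q x) = 0 := by
        rw [Algebra.smul_def, Ideal.Quotient.algebraMap_eq, ← map_mul, Ideal.Quotient.eq_zero_iff_mem]
        exact Ideal.mul_mem_right _ _ hf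
      rw [this, LocalizedModule.zero_mk]
  · intro h
    refine ⟨LocalizedModule.mkLinearMap _ _ (Ideal.Quotient.mk q 1), fun r hr => ?_⟩
    rw [Submodule.mem_annihilator_span_singleton] at hr
    obtain ⟨⟨a, s⟩, hs⟩ := IsLocalization.surj 𝔪.primeCompl r
    have h1 : a • LocalizedModule.mkLinearMap 𝔪.primeCompl (S ⧸ q) (Ideal.Quotient.mk q 1) = 0 := by
      rw [← algebraMap_smul (Localization.AtPrime 𝔪) a, ← hs, mul_comm, mul_smul, hr, smul_zero]
    rw [← map_smul, IsLocalizedModule.eq_zero_iff 𝔪.primeCompl] at h1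
    obtain ⟨t, ht⟩ := h1
    have h2 : (t : S) * a ∈ q := by
      rw [← Ideal.Quotient.eq_zero_iff_mem, ← ht]
      change _ = (t : S) • a • Ideal.Quotient.mk q 1
      rw [Algebra.smul_def, Algebra.smul_def, Ideal.Quotient.algebraMap_eq, ← map_mul, ← map_mul,
        mul_one]
    have hdisj : ∀ u : 𝔪.primeCompl, algebraMap S (Localization.AtPrime 𝔪) u ∉ P.asIdeal :=
      fun u hu => P.2.ne_top (Ideal.eq_top_of_isUnit_mem _ hu (IsLocalization.map_units _ u))
    have h3 := h h2
    rw [Ideal.mem_comap, map_mul] at h3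
    have h4 := (P.2.mem_or_mem h3).resolve_left (hdisj t)
    change algebraMap S (Localization.AtPrime 𝔪) a ∈ P.asIdeal at h4
    rw [← hs] at h4
    exact (P.2.mem_or_mem h4).resolve_right (hdisj s)

/-- Incomparability: a strict chain of primes containing q contracts to a strict chain in A. -/
theorem supportDim_localizedModule_quotient_le [Algebra.IsIntegral A (S ⧸ q)] :
    Module.supportDim (Localization.AtPrime 𝔪) (LocalizedModule 𝔪.primeCompl (S ⧸ q)) ≤
      ringKrullDim A := by
  let f : Module.support (Localization.AtPrime 𝔪) (LocalizedModule 𝔪.primeCompl (S ⧸ q)) →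
      PrimeSpectrum A := fun P =>
    PrimeSpectrum.comap (algebraMap A S) (PrimeSpectrum.comap (algebraMap S _) P.1)
  refine Order.krullDim_le_of_strictMono f ?_
  intro P P' hlt
  have hP := (mem_support_localizedModule_quotient_iff 𝔪 q).mp P.2
  have hP' := (mem_support_localizedModule_quotient_iff 𝔪 q).mp P'.2
  have h1 : P.1.asIdeal < P'.1.asIdeal := hlt
  set p := P.1.asIdeal.comap (algebraMap S (Localization.AtPrime 𝔪)) with hp
  set p' := P'.1.asIdeal.comap (algebraMap S (Localization.AtPrime 𝔪)) with hp'
  have hlt' : p < p' := by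
    refine lt_of_le_of_ne (Ideal.comap_mono h1.le) fun h => h1.ne ?_
    rw [← IsLocalization.map_under 𝔪.primeCompl _ P.1.asIdeal,
      ← IsLocalization.map_under 𝔪.primeCompl _ P'.1.asIdeal]
    exact congrArg _ h
  have hpp : p.IsPrime := P.1.2.comap _
  have hpq : (p.map (Ideal.Quotient.mk q)).IsPrime :=
    Ideal.map_isPrime_of_surjective Ideal.Quotient.mk_surjective (by rwa [Ideal.mk_ker])
  have hc : ∀ J : Ideal S, q ≤ J → (J.map (Ideal.Quotient.mk q)).comap (Ideal.Quotient.mk q) = J :=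
    fun J hJ => by rw [Ideal.comap_map_of_surjective' _ Ideal.Quotient.mk_surjective, Ideal.mk_ker,
      sup_eq_left.mpr hJ]
  have hlt2 : p.map (Ideal.Quotient.mk q) < p'.map (Ideal.Quotient.mk q) := by
    refine lt_of_le_of_ne (Ideal.map_mono hlt'.le) fun h => hlt'.ne ?_
    rw [← hc p hP, ← hc p' hP', h]
  have h3 := Ideal.IsIntegral.comap_lt_comap (R := A) hlt2
  have e : algebraMap A (S ⧸ q) = (Ideal.Quotient.mk q).comp (algebraMap A S) := rfl
  rw [e, ← Ideal.comap_comap, ← Ideal.comap_comap, hc p hP, hc p' hP'] at h3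
  exact h3

/-- Going up lifts the chain from A to S/q. The condition on primes over the top of the chain keeps
the lifted chain inside 𝔪, so that it survives localization. -/
theorem length_le_supportDim_localizedModule_quotient [Algebra.IsIntegral A (S ⧸ q)]
    (l : LTSeries (PrimeSpectrum A)) (P₀ : Ideal (S ⧸ q)) [P₀.IsPrime]
    [P₀.LiesOver l.head.asIdeal]
    (hlast : ∀ P : Ideal S, P.IsPrime → q ≤ P → P.comap (algebraMap A S) = l.last.asIdeal →
      P ≤ 𝔪) :
    (l.length : WithBot ℕ∞) ≤
      Module.supportDim (Localization.AtPrime 𝔪) (LocalizedModule 𝔪.primeCompl (S ⧸ q)) := by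
  obtain ⟨L, hlen, -, hmap⟩ := Ideal.exists_ltSeries_of_hasGoingUp l P₀
  have hL : PrimeSpectrum.comap (algebraMap A (S ⧸ q)) L.last = l.last := by
    have h1 : L.toList.getLast? = some L.last := by
      rw [List.getLast?_eq_some_getLast L.toList_ne_nil, RelSeries.getLast_toList]
    have h2 : l.toList.getLast? = some l.last := by
      rw [List.getLast?_eq_some_getLast l.toList_ne_nil, RelSeries.getLast_toList]
    rw [← hmap, List.getLast?_map, h1] at h2
    simpa using h2
  have hker : ∀ J : Ideal (S ⧸ q), q ≤ J.comap (Ideal.Quotient.mk q) := fun J f hf => by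
    rw [Ideal.mem_comap, Ideal.Quotient.eq_zero_iff_mem.mpr hf]
    exact J.zero_mem
  have hle : ∀ i, (L i).asIdeal.comap (Ideal.Quotient.mk q) ≤ 𝔪 := by
    intro i
    refine (Ideal.comap_mono (show (L i).asIdeal ≤ L.last.asIdeal from
      L.monotone (Fin.le_last i))).trans ?_
    refine hlast _ (L.last.2.comap _) ?_ ?_
    · exact hker _
    · rw [Ideal.comap_comap, ← hL]
      rfl
  have hdisj : ∀ i, Disjoint (𝔪.primeCompl : Set S)
      ((L i).asIdeal.comap (Ideal.Quotient.mk q) : Set S) := by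
    intro i
    rw [Set.disjoint_left]
    exact fun x hx hx' => hx (hle i hx')
  have hpr : ∀ i, ((L i).asIdeal.comap (Ideal.Quotient.mk q)).IsPrime := fun i => (L i).2.comap _
  have hcm : ∀ i, (((L i).asIdeal.comap (Ideal.Quotient.mk q)).map
      (algebraMap S (Localization.AtPrime 𝔪))).comap (algebraMap S (Localization.AtPrime 𝔪)) =
        (L i).asIdeal.comap (Ideal.Quotient.mk q) := fun i =>
    IsLocalization.under_map_of_isPrime_disjoint 𝔪.primeCompl _ (hpr i) (hdisj i)
  let M : LTSeries (Module.support (Localization.AtPrime 𝔪)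
      (LocalizedModule 𝔪.primeCompl (S ⧸ q))) :=
    { length := L.length
      toFun := fun i => ⟨⟨((L i).asIdeal.comap (Ideal.Quotient.mk q)).map (algebraMap S _),
        IsLocalization.isPrime_of_isPrime_disjoint 𝔪.primeCompl _ _ (hpr i) (hdisj i)⟩, by
        rw [mem_support_localizedModule_quotient_iff]
        exact (hker _).trans_eq (hcm i).symm⟩
      step := fun i => by
        have h1 : (L i.castSucc).asIdeal < (L i.succ).asIdeal := L.step i
        change ((L i.castSucc).asIdeal.comap (Ideal.Quotient.mk q)).map _ <
          ((L i.succ).asIdeal.comap (Ideal.Quotient.mk q)).map _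
        refine lt_of_le_of_ne (Ideal.map_mono (Ideal.comap_mono h1.le)) fun h => h1.ne ?_
        have h2 := congrArg (Ideal.comap (algebraMap S (Localization.AtPrime 𝔪))) h
        rw [hcm, hcm] at h2
        exact Ideal.comap_injective_of_surjective _ Ideal.Quotient.mk_surjective h2 }
  rw [← hlen]
  exact Order.LTSeries.length_le_krullDim M

end SupportDim

/-! ### A full flag of primes ending at the origin. -/

section Flag

open MvPolynomial

theorem exists_ltSeries_primeSpectrum_mvPolynomial (K : Type*) [Field K] (m : ℕ) :
    ∃ l : LTSeries (PrimeSpectrum (MvPolynomial (Fin m) K)), l.length = m ∧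
      l.head.asIdeal = ⊥ ∧ ∀ i, (X i : MvPolynomial (Fin m) K) ∈ l.last.asIdeal := by
  -- φ j kills the first j variables and fixes the others; the kernels of these maps are the members
  -- of the flag.
  let φ : ℕ → MvPolynomial (Fin m) K →ₐ[K] MvPolynomial (Fin m) K := fun j =>
    aeval fun i : Fin m => if i.1 < j then 0 else X i
  have hφ : ∀ j i, φ j (X i) = if i.1 < j then 0 else X i := fun j i => aeval_X _ _
  have hcomp : ∀ j, (φ (j + 1)).comp (φ j) = φ (j + 1) := by
    intro j
    ext i : 1
    rw [AlgHom.comp_apply, hφ, hφ]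
    split_ifs with h1 h2 h2
    · exact map_zero _
    · omega
    · rw [hφ, if_pos h2]
    · rw [hφ, if_neg h2]
  refine ⟨{ length := m
            toFun := fun j => ⟨RingHom.ker (φ j.1), RingHom.ker_isPrime _⟩
            step := fun j => ?_ }, rfl, ?_, ?_⟩
  · change RingHom.ker (φ j.1) < RingHom.ker (φ (j.1 + 1))
    refine lt_of_le_of_ne (fun f hf => ?_) fun h => ?_
    · rw [RingHom.mem_ker] at hf ⊢
      rw [← hcomp, AlgHom.comp_apply, hf, map_zero]
    · have h1 : (X j : MvPolynomial (Fin m) K) ∈ RingHom.ker (φ (j.1 + 1)) := by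
        rw [RingHom.mem_ker, hφ, if_pos (Nat.lt_succ_self _)]
      rw [← h, RingHom.mem_ker, hφ, if_neg (lt_irrefl _)] at h1
      exact X_ne_zero j h1
  · change RingHom.ker (φ 0) = ⊥
    have : φ 0 = AlgHom.id K _ := by
      ext i : 1
      rw [hφ, if_neg (Nat.not_lt_zero _)]
      rfl
    rw [this]
    ext f
    rw [RingHom.mem_ker, Ideal.mem_bot]
    rfl
  · intro i
    change X i ∈ RingHom.ker (φ m)
    rw [RingHom.mem_ker, hφ, if_pos i.2]

end Flag

/-! ### Graded embeddings of polynomial rings given by linear forms. -/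

section GradedAlgebraMap

open MvPolynomial

variable {σ τ K : Type*} [Field K] [Algebra (MvPolynomial τ K) (MvPolynomial σ K)]
  [IsScalarTower K (MvPolynomial τ K) (MvPolynomial σ K)]

theorem algebraMap_eq_aeval (a : MvPolynomial τ K) :
    algebraMap (MvPolynomial τ K) (MvPolynomial σ K) a =
      aeval (fun i => algebraMap (MvPolynomial τ K) (MvPolynomial σ K) (X i)) a := by
  have : IsScalarTower.toAlgHom K (MvPolynomial τ K) (MvPolynomial σ K) =
      aeval (fun i => algebraMap (MvPolynomial τ K) (MvPolynomial σ K) (X i)) := by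
    ext i : 1
    rw [aeval_X]
    rfl
  exact DFunLike.congr_fun this a

variable (hz : ∀ i, (algebraMap (MvPolynomial τ K) (MvPolynomial σ K) (X i)).IsHomogeneous 1)

include hz

theorem isHomogeneous_algebraMap {a : MvPolynomial τ K} {k : ℕ} (ha : a.IsHomogeneous k) :
    (algebraMap (MvPolynomial τ K) (MvPolynomial σ K) a).IsHomogeneous k := by
  rw [algebraMap_eq_aeval]
  simpa using ha.aeval _ hz

theorem homogeneousComponent_algebraMap (a : MvPolynomial τ K) (k : ℕ) :
    homogeneousComponent k (algebraMap (MvPolynomial τ K) (MvPolynomial σ K) a) =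
      algebraMap (MvPolynomial τ K) (MvPolynomial σ K) (homogeneousComponent k a) := by
  conv_lhs => rw [← sum_homogeneousComponent a, map_sum, map_sum]
  have h : ∀ i ∈ Finset.range (a.totalDegree + 1), homogeneousComponent k
      (algebraMap (MvPolynomial τ K) (MvPolynomial σ K) (homogeneousComponent i a)) =
        if i = k then algebraMap (MvPolynomial τ K) (MvPolynomial σ K)
          (homogeneousComponent i a) else 0 := fun i _ => by
    rw [homogeneousComponent_of_mem
      (isHomogeneous_algebraMap hz (homogeneousComponent_isHomogeneous i a))]
    simp only [eq_comm]
  rw [Finset.sum_congr rfl h, Finset.sum_ite_eq']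
  split_ifs with hk
  · rfl
  · rw [homogeneousComponent_eq_zero, map_zero]
    simpa using hk

end GradedAlgebraMap

/-! ### Multiplicity bounds from finite extensions. -/

section Multiplicity

open MvPolynomial

variable {K : Type*} [Field K] {m : ℕ}

local notation "𝕊" => MvPolynomial (Fin (m + 1 + 1)) K
local notation "𝔸" => MvPolynomial (Fin m) K

/-- A embeds in S/q as a graded subring because q meets it in 0. -/
theorem multichoose_le_hilbertFn [Algebra 𝔸 𝕊] [IsScalarTower K 𝔸 𝕊]
    (hz : ∀ i, (algebraMap 𝔸 𝕊 (X i)).IsHomogeneous 1) {q : Ideal 𝕊}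
    (hinj : ∀ a, algebraMap 𝔸 𝕊 a ∈ q → a = 0) (k : ℕ) :
    m.multichoose k ≤ hilbertFn q k := by
  let f : 𝔸 →ₗ[K] 𝕊 := (IsScalarTower.toAlgHom K 𝔸 𝕊).toLinearMap
  have hf : ∀ a, f a = algebraMap 𝔸 𝕊 a := fun _ => rfl
  have hfi : Function.Injective f := by
    rw [← LinearMap.ker_eq_bot, LinearMap.ker_eq_bot']
    intro a ha
    exact hinj a (by rw [← hf, ha]; exact q.zero_mem)
  have h1 := Submodule.finrank_sup_add_finrank_inf_eq (gradedPart q k)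
    ((homogeneousSubmodule (Fin m) K k).map f)
  have h2 : gradedPart q k ⊓ (homogeneousSubmodule (Fin m) K k).map f = ⊥ := by
    rw [eq_bot_iff]
    rintro _ ⟨h, a, ha, rfl⟩
    rw [hinj a h.1]
    simp
  have h3 : gradedPart q k ⊔ (homogeneousSubmodule (Fin m) K k).map f ≤
      homogeneousSubmodule (Fin (m + 1 + 1)) K k := by
    refine sup_le (gradedPart_le q k) ?_
    rintro _ ⟨a, ha, rfl⟩
    exact isHomogeneous_algebraMap hz ha
  have h4 := Submodule.finrank_mono h3
  have h5 := hilbertFn_add q k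
  rw [h2, finrank_bot, ← (Submodule.equivMapOfInjective f hfi _).finrank_eq,
    finrank_homogeneousSubmodule K m k] at h1
  omega

theorem gradedPart_eq_of_hilbertFn_eq_zero {q : Ideal 𝕊} {k : ℕ} (h : hilbertFn q k = 0) :
    gradedPart q k = homogeneousSubmodule (Fin (m + 1 + 1)) K k := by
  refine Submodule.eq_of_le_of_finrank_eq (gradedPart_le q k) ?_
  have := hilbertFn_add q k
  omega

/-- The upper bound is dim A = m. For the lower bound the coordinate flag of A is lifted; its top
lies over the origin, where `hmax` confines the primes to the irrelevant ideal. -/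
theorem supportDim_localizedModule_quotient_eq [Algebra 𝔸 𝕊] {q : Ideal 𝕊}
    [Algebra.IsIntegral 𝔸 (𝕊 ⧸ q)]
    (hinj : ∀ a, algebraMap 𝔸 𝕊 a ∈ q → a = 0)
    (hmax : ∀ P : Ideal 𝕊, P.IsPrime → q ≤ P → (∀ i, algebraMap 𝔸 𝕊 (X i) ∈ P) →
      P ≤ idealOfVars (Fin (m + 1 + 1)) K) :
    Module.supportDim (Localization.AtPrime (idealOfVars (Fin (m + 1 + 1)) K))
      (LocalizedModule (idealOfVars (Fin (m + 1 + 1)) K).primeCompl (𝕊 ⧸ q)) =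
        (m : WithBot ℕ∞) := by
  refine le_antisymm ?_ ?_
  · refine (supportDim_localizedModule_quotient_le (A := 𝔸) _ q).trans ?_
    rw [MvPolynomial.ringKrullDim_of_isNoetherianRing, ringKrullDim_eq_zero_of_field]
    simp
  · obtain ⟨l, hl, hhead, hlast⟩ := exists_ltSeries_primeSpectrum_mvPolynomial K m
    have hi : Function.Injective (algebraMap 𝔸 (𝕊 ⧸ q)) := by
      rw [injective_iff_map_eq_zero]
      exact fun a ha => hinj a (Ideal.Quotient.eq_zero_iff_mem.mp ha)
    obtain ⟨P₀, -, hP₀, hc⟩ := Ideal.exists_ideal_over_prime_of_isIntegral (⊥ : Ideal 𝔸)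
      (⊥ : Ideal (𝕊 ⧸ q)) (by
        intro a ha
        rw [Ideal.mem_comap, Ideal.mem_bot] at ha
        exact hi (by rw [ha, map_zero]))
    have : P₀.LiesOver l.head.asIdeal := ⟨by rw [hhead]; exact hc.symm⟩
    have h := length_le_supportDim_localizedModule_quotient (A := 𝔸)
      (idealOfVars (Fin (m + 1 + 1)) K) q l P₀ (fun P hP hq hPl => hmax P hP hq fun i => by
        rw [← Ideal.mem_comap, hPl]
        exact hlast i)
    rwa [hl] at h

/-- A graded ideal `q` such that `S/q` is a finite extension of a polynomial ring in `m` linear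
forms, with Hilbert function bounded by that of a graded free module of rank `c`, has
multiplicity at most `c`. -/
theorem exists_hasMultiplicity_le [Algebra 𝔸 𝕊] [IsScalarTower K 𝔸 𝕊]
    (hz : ∀ i, (algebraMap 𝔸 𝕊 (X i)).IsHomogeneous 1) {q : Ideal 𝕊} (hq : IsGradedIdeal q)
    [Algebra.IsIntegral 𝔸 (𝕊 ⧸ q)]
    (hinj : ∀ a, algebraMap 𝔸 𝕊 a ∈ q → a = 0)
    (hmax : ∀ P : Ideal 𝕊, P.IsPrime → q ≤ P → (∀ i, algebraMap 𝔸 𝕊 (X i) ∈ P) →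
      P ≤ idealOfVars (Fin (m + 1 + 1)) K)
    {c : ℕ} (s : Fin c → ℕ)
    (hbound : ∀ k, hilbertFn q k ≤ ∑ i, if s i ≤ k then m.multichoose (k - s i) else 0) :
    ∃ e : ℕ, HasMultiplicity q e ∧ e ≤ c := by
  have hdim := supportDim_localizedModule_quotient_eq hinj hmax
  cases m with
  | succ d =>
    obtain ⟨P, hP⟩ := exists_polynomial_eval_eq_hilbertFn hq
    have hmc : ∀ k, (d + 1).multichoose k = (k + d).choose d := fun k => by
      rw [Nat.multichoose_eq, show d + 1 + k - 1 = k + d by omega, ← Nat.choose_symm_add,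
        add_comm]
    obtain ⟨e, h1, h2, h3⟩ := Polynomial.exists_degree_eq_of_le_of_le d c (hilbertFn q) P hP
      (Filter.Eventually.of_forall fun k => hmc k ▸ multichoose_le_hilbertFn hz hinj k)
      (Filter.Eventually.of_forall fun k => (hbound k).trans (by
        refine (Finset.sum_le_card_nsmul _ _ ((k + d).choose d) fun i _ => ?_).trans ?_
        · split_ifs
          · rw [hmc]
            exact Nat.choose_le_choose d (by omega)
          · exact Nat.zero_le _
        · simp))
    refine ⟨e, Or.inr ⟨d, hdim, P, ?_, h1, h2⟩, h3⟩
    filter_upwards [hP] with k hk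
    exact ⟨hilbertFn q k, hilbertSamuelFunction_eq_hilbertFn q hq k, hk⟩
  | zero =>
    -- Here A = K sits in degree 0, so each generator contributes only in its own degree.
    have hmc : ∀ k j, (if j ≤ k then Nat.multichoose 0 (k - j) else 0) = if k = j then 1 else 0 := by
      intro k j
      split_ifs with h1 h2 h2
      · rw [h2, Nat.sub_self, Nat.multichoose_zero_right]
      · obtain ⟨i, hi⟩ := Nat.exists_eq_succ_of_ne_zero (show k - j ≠ 0 by omega)
        rw [hi, Nat.multichoose_zero_succ]
      · omega
      · rfl
    simp only [hmc] at hbound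
    -- Any number exceeding all shifts would do: from degree k₀ on the quotient vanishes, so its
    -- length is the finite sum of the Hilbert function.
    set k₀ := ∑ i, s i + 1 with hk₀
    have hs : ∀ i, s i < k₀ := fun i =>
      Nat.lt_succ_of_le (Finset.single_le_sum (f := s) (fun _ _ => Nat.zero_le _) (Finset.mem_univ i))
    have hzero : ∀ k, k₀ ≤ k → hilbertFn q k = 0 := fun k hk => by
      refine Nat.eq_zero_of_le_zero ((hbound k).trans ?_)
      rw [Finset.sum_eq_zero]
      intro i _
      have := hs i
      rw [if_neg (by omega)]
    have hpow : ∀ g ∈ idealOfVars (Fin (0 + 1 + 1)) K ^ k₀, g ∈ q := by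
      intro g hg
      rw [← sum_homogeneousComponent g]
      refine Ideal.sum_mem _ fun k _ => ?_
      by_cases hk : k₀ ≤ k
      · have h1 := gradedPart_eq_of_hilbertFn_eq_zero (hzero k hk)
        have h2 := homogeneousComponent_isHomogeneous k g
        rw [← mem_homogeneousSubmodule, ← h1] at h2
        exact h2.1
      · have : homogeneousComponent k g = 0 :=
          homogeneousComponent_eq_zero_of_mem_pow (Ideal.pow_le_pow_right (by omega) hg)
        rw [this]
        exact q.zero_mem
    refine ⟨∑ k ∈ Finset.range k₀, hilbertFn q k, Or.inl ⟨hdim, ?_⟩, ?_⟩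
    · rw [length_eq_sum_hilbertSamuelFunction_add _ _ k₀, Nat.cast_sum,
        Finset.sum_congr rfl fun k _ => hilbertSamuelFunction_eq_hilbertFn q hq k]
      have hsub : ∀ x ∈ (IsLocalRing.maximalIdeal
          (Localization.AtPrime (idealOfVars (Fin (0 + 1 + 1)) K)) ^ k₀ •
          (⊤ : Submodule (Localization.AtPrime (idealOfVars (Fin (0 + 1 + 1)) K))
            (LocalizedModule (idealOfVars (Fin (0 + 1 + 1)) K).primeCompl
              (MvPolynomial (Fin (0 + 1 + 1)) K ⧸ q)))), x = 0 := by
        intro x hx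
        obtain ⟨t, ht, g, hg, h⟩ := exists_smul_eq_toLocalizedQuotient q hx
        have h1 : toLocalizedQuotient q g = toLocalizedQuotient q 0 :=
          (toLocalizedQuotient_eq_iff q).mpr ⟨1, fun h => by
            simp [mem_idealOfVars_iff_constantCoeff] at h, by simpa using hpow g hg⟩
        rw [h1, map_zero] at h
        exact IsLocalizedModule.smul_injective
          (LocalizedModule.mkLinearMap (idealOfVars (Fin (0 + 1 + 1)) K).primeCompl _)
          (⟨t, ht⟩ : (idealOfVars (Fin (0 + 1 + 1)) K).primeCompl) (h.trans (smul_zero _).symm)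
      rw [Module.length_eq_zero_iff.mpr, add_zero]
      exact ⟨fun a b => Subtype.ext ((hsub a.1 a.2).trans (hsub b.1 b.2).symm)⟩
    · refine (Finset.sum_le_sum fun k _ => hbound k).trans ?_
      rw [Finset.sum_comm]
      refine (Finset.sum_le_card_nsmul _ _ 1 fun i _ => ?_).trans (by simp)
      rw [Finset.sum_ite_eq']
      split_ifs <;> omega

end Multiplicity

/-! ### Linear and quadratic forms on a line. -/

section QuadraticForms

open MvPolynomial

variable {K : Type*} [Field K] {σ : Type*}

theorem MvPolynomial.IsHomogeneous.eval_add_smul {l : MvPolynomial σ K} (hl : l.IsHomogeneous 1)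
    (w v : σ → K) (c : K) : eval (w + c • v) l = eval w l + c * eval v l := by
  rw [← mem_homogeneousSubmodule, homogeneousSubmodule_one_eq_span_X] at hl
  induction hl using Submodule.span_induction with
  | mem x hx => obtain ⟨i, rfl⟩ := hx; simp
  | zero => simp
  | add x y _ _ hx hy => rw [map_add, map_add, map_add, hx, hy]; ring
  | smul a x _ hx => rw [smul_eval, smul_eval, smul_eval, hx]; ring

theorem mem_mul_of_isHomogeneous_two {Q : MvPolynomial σ K} (hQ : Q.IsHomogeneous 2) :
    Q ∈ homogeneousSubmodule σ K 1 * homogeneousSubmodule σ K 1 := by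
  rw [← pow_two, homogeneousSubmodule_one_pow]
  exact hQ

/-- The polar form of a quadratic form. -/
theorem MvPolynomial.IsHomogeneous.exists_polar {Q : MvPolynomial σ K} (hQ : Q.IsHomogeneous 2)
    (v : σ → K) : ∃ B : MvPolynomial σ K, B.IsHomogeneous 1 ∧ (∀ (w : σ → K) (c : K),
      eval (w + c • v) Q = eval w Q + c * eval w B + c ^ 2 * eval v Q) ∧
      eval v B = 2 * eval v Q := by
  induction mem_mul_of_isHomogeneous_two hQ using Submodule.mul_induction_on' with
  | mem_mul_mem l hl l' hl' =>
    refine ⟨C (eval v l) * l' + C (eval v l') * l,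
      (IsHomogeneous.C_mul hl' _).add (IsHomogeneous.C_mul hl _), fun w c => ?_, ?_⟩
    · simp only [map_mul, map_add, eval_C, IsHomogeneous.eval_add_smul hl,
        IsHomogeneous.eval_add_smul hl']
      ring
    · simp only [map_mul, map_add, eval_C]
      ring
  | add x hx y hy ihx ihy =>
    have h2 : ∀ z ∈ homogeneousSubmodule σ K 1 * homogeneousSubmodule σ K 1,
        z.IsHomogeneous 2 := fun z hz => by
      rw [← pow_two, homogeneousSubmodule_one_pow] at hz
      exact hz
    obtain ⟨B, hB, h1, h1'⟩ := ihx (h2 x hx)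
    obtain ⟨B', hB', h2, h2'⟩ := ihy (h2 y hy)
    refine ⟨B + B', hB.add hB', fun w c => ?_, ?_⟩
    · rw [map_add, map_add, map_add, map_add, h1, h2]; ring
    · rw [map_add, map_add, h1', h2']; ring

theorem MvPolynomial.exists_eval_ne_zero [Infinite K] {f : MvPolynomial σ K} (hf : f ≠ 0) :
    ∃ v, eval v f ≠ 0 := by
  by_contra! h
  exact hf (MvPolynomial.funext fun v => by rw [h v, map_zero])

/-- Two coprime quadratic forms have no common zero on some line, and generators of the pencil
can be chosen that are adapted to two points of the line. -/
theorem exists_line_of_isRelPrime [Infinite K] [Finite σ] {Q₁ Q₂ : MvPolynomial σ K}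
    (hQ₁ : Q₁.IsHomogeneous 2) (hQ₂ : Q₂.IsHomogeneous 2) (hcop : IsRelPrime Q₁ Q₂) :
    ∃ (P₁ P₂ : MvPolynomial σ K) (v w : σ → K), P₁.IsHomogeneous 2 ∧ P₂.IsHomogeneous 2 ∧
      P₁ ∈ Ideal.span {Q₁, Q₂} ∧ P₂ ∈ Ideal.span {Q₁, Q₂} ∧
      eval v P₁ = 1 ∧ eval v P₂ = 0 ∧ eval w P₁ = 0 ∧ eval w P₂ = 1 ∧
      ∀ c : K, eval (w + c • v) P₁ = 0 → eval (w + c • v) P₂ ≠ 0 := by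
  have hne : Q₁ ≠ 0 := by
    rintro rfl
    rw [isRelPrime_zero_left] at hcop
    have h1 := hcop.ne_zero
    have h2 := hQ₂.totalDegree h1
    obtain ⟨c, -, hc⟩ := MvPolynomial.isUnit_iff_eq_C_of_isReduced.mp hcop
    rw [hc, totalDegree_C] at h2
    omega
  obtain ⟨v, hv⟩ := exists_eval_ne_zero hne
  set P := C (eval v Q₁)⁻¹ * Q₁ with hP
  set Q := Q₂ - C (eval v Q₂) * P with hQ
  have hPh : P.IsHomogeneous 2 := hQ₁.C_mul _
  have hQh : Q.IsHomogeneous 2 := hQ₂.sub (hPh.C_mul _)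
  have hPv : eval v P = 1 := by
    rw [hP, map_mul, eval_C, inv_mul_cancel₀ hv]
  have hQv : eval v Q = 0 := by
    rw [hQ, map_sub, map_mul, eval_C, hPv, mul_one, sub_self]
  have hPI : P ∈ Ideal.span {Q₁, Q₂} := Ideal.mul_mem_left _ _ (Ideal.subset_span (by simp))
  have hQI : Q ∈ Ideal.span {Q₁, Q₂} := Ideal.sub_mem _ (Ideal.subset_span (by simp))
    (Ideal.mul_mem_left _ _ hPI)
  have hQ₁P : Q₁ = C (eval v Q₁) * P := by
    rw [hP, ← mul_assoc, ← C_mul, mul_inv_cancel₀ hv, C_1, one_mul]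
  have hcop' : IsRelPrime P Q := by
    intro d hdP hdQ
    refine hcop (hQ₁P ▸ hdP.mul_left _) ?_
    rw [← sub_add_cancel Q₂ (C (eval v Q₂) * P)]
    exact dvd_add hdQ (hdP.mul_left _)
  have hP0 : P ≠ 0 := by
    intro h; rw [h, map_zero] at hPv; exact zero_ne_one hPv
  have hQ0 : Q ≠ 0 := by
    intro h
    rw [h, isRelPrime_zero_right] at hcop'
    have h2 := hPh.totalDegree hP0
    obtain ⟨c, -, hc⟩ := MvPolynomial.isUnit_iff_eq_C_of_isReduced.mp hcop'
    rw [hc, totalDegree_C] at h2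
    omega
  obtain ⟨a, hah, ha, hav⟩ := hPh.exists_polar v
  obtain ⟨u, huh, hu, huv⟩ := hQh.exists_polar v
  rw [hPv, mul_one] at hav
  rw [hQv, mul_zero] at huv
  clear_value Q P
  -- On the line c ↦ w + c·v one has P = P(w) + c·a(w) + c² and Q = Q(w) + c·u(w). R(w) is the
  -- resultant of these two polynomials in c.
  set R := Q ^ 2 - a * u * Q + u ^ 2 * P with hR
  have hR0 : R ≠ 0 := by
    intro h0
    have h1 : Q * (a * u - Q) = u ^ 2 * P := by linear_combination hR - h0
    have h2 : P ∣ a * u - Q := hcop'.dvd_of_dvd_mul_left (h1 ▸ Dvd.intro_left _ rfl)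
    obtain ⟨c, hc⟩ := h2
    have hau : (a * u - Q).IsHomogeneous 2 := (hah.mul huh).sub hQh
    -- Both a·u − Q and P have degree 2, so only the constant term of c matters. It is 0, as seen by
    -- evaluating at v, where u and Q vanish and P is 1.
    have h4 : a * u - Q = 0 := by
      have h3 := hPh.homogeneousComponent_mul c 0
      rw [zero_add, ← hc, homogeneousComponent_eq_self hau, homogeneousComponent_zero] at h3
      have h5 := congrArg (eval v) h3
      rw [map_sub, map_mul, map_mul, huv, hQv, hPv, eval_C] at h5
      rw [h3, show coeff 0 c = 0 by linear_combination -h5, C_0, mul_zero]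
    rw [h4, mul_zero] at h1
    have h6 : u = 0 := by
      rcases mul_eq_zero.mp h1.symm with h | h
      · exact pow_eq_zero_iff two_ne_zero |>.mp h
      · exact absurd h hP0
    rw [h6, mul_zero, zero_sub, neg_eq_zero] at h4
    exact hQ0 h4
  obtain ⟨w, hw⟩ := exists_eval_ne_zero (mul_ne_zero hR0 hQ0)
  rw [map_mul] at hw
  have hRw := left_ne_zero_of_mul hw
  have hQw := right_ne_zero_of_mul hw
  -- The pencil is rescaled so that its generators take the values (1, 0) and (0, 1) at v and w.
  refine ⟨P - C (eval w P * (eval w Q)⁻¹) * Q, C (eval w Q)⁻¹ * Q, v, w, hPh.sub (hQh.C_mul _),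
    hQh.C_mul _, Ideal.sub_mem _ hPI (Ideal.mul_mem_left _ _ hQI), Ideal.mul_mem_left _ _ hQI,
    by simp [hPv, hQv], by simp [hQv], by simp [hQw], by simp [hQw], ?_⟩
  intro c h1 h2
  rw [map_mul, eval_C, mul_eq_zero, or_iff_right (inv_ne_zero hQw)] at h2
  rw [map_sub, map_mul, h2, mul_zero, sub_zero] at h1
  rw [hu, hQv] at h2
  rw [ha, hPv] at h1
  apply hRw
  rw [hR]
  simp only [map_add, map_sub, map_mul, map_pow]
  linear_combination (eval w Q - eval w u * c - eval w a * eval w u) * h2 + (eval w u) ^ 2 * h1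

/-- The coordinates are the dual basis of a basis of Kⁿ⁺¹ extending v, w. -/
theorem MvPolynomial.exists_coordinates [Infinite K] {n : ℕ} {v w : Fin (n + 1) → K}
    (hvw : LinearIndependent K ![v, w]) :
    ∃ m : ℕ, n = m + 1 ∧ ∃ (x y : MvPolynomial (Fin (n + 1)) K)
      (z : Fin m → MvPolynomial (Fin (n + 1)) K),
      x.IsHomogeneous 1 ∧ y.IsHomogeneous 1 ∧ (∀ i, (z i).IsHomogeneous 1) ∧
      eval v x = 1 ∧ eval v y = 0 ∧ (∀ i, eval v (z i) = 0) ∧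
      eval w x = 0 ∧ eval w y = 1 ∧ (∀ i, eval w (z i) = 0) ∧
      ∀ i, X i ∈ Submodule.span K (insert x (insert y (Set.range z))) := by
  classical
  let b₀ := Module.Basis.sumExtend hvw
  have hfin : Finite (Fin 2 ⊕ Module.Basis.sumExtendIndex hvw) := Module.Finite.finite_basis b₀
  have : Finite (Module.Basis.sumExtendIndex hvw) := Finite.sum_right (Fin 2)
  obtain ⟨m, ⟨e⟩⟩ := Finite.exists_equiv_fin (Module.Basis.sumExtendIndex hvw)
  let b : Module.Basis (Fin 2 ⊕ Fin m) K (Fin (n + 1) → K) :=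
    b₀.reindex (Equiv.sumCongr (Equiv.refl _) e)
  have hbl : ∀ i, b (Sum.inl i) = ![v, w] i := fun i => by
    simp only [b, Module.Basis.reindex_apply, Equiv.sumCongr_symm, Equiv.refl_symm,
      Equiv.sumCongr_apply, Sum.map_inl, Equiv.coe_refl, id]
    simp only [b₀, Module.Basis.sumExtend, Module.Basis.reindex_apply, Module.Basis.extend_apply_self]
    rfl
  have hcard := Module.finrank_eq_card_basis b
  rw [Module.finrank_fin_fun, Fintype.card_sum, Fintype.card_fin, Fintype.card_fin] at hcard
  let c : (Fin 2 ⊕ Fin m) → MvPolynomial (Fin (n + 1)) K := fun j =>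
    ∑ i, C (b.coord j (Pi.single i 1)) * X i
  have hch : ∀ j, (c j).IsHomogeneous 1 := fun j =>
    IsHomogeneous.sum _ _ _ fun i _ => (isHomogeneous_X K i).C_mul _
  have hce : ∀ j u, eval u (c j) = b.coord j u := by
    intro j u
    simp only [c, map_sum, map_mul, eval_C, eval_X]
    conv_rhs => rw [← LinearMap.sum_single_apply (φ := fun _ : Fin (n + 1) => K) u, map_sum]
    refine Finset.sum_congr rfl fun i _ => ?_
    rw [mul_comm, ← smul_eq_mul, ← map_smul]
    congr 1
    ext k
    simp [Pi.single_apply]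
  have hcb : ∀ j k, eval (b k) (c j) = if k = j then 1 else 0 := by
    intro j k
    rw [hce, Module.Basis.coord_apply, Module.Basis.repr_self, Finsupp.single_apply]
  have hv : v = b (Sum.inl 0) := by rw [hbl]; rfl
  have hw : w = b (Sum.inl 1) := by rw [hbl]; rfl
  refine ⟨m, by omega, c (Sum.inl 0), c (Sum.inl 1), fun i => c (Sum.inr i), hch _, hch _,
    fun i => hch _, ?_, ?_, ?_, ?_, ?_, ?_, ?_⟩
  · rw [hv, hcb]; simp
  · rw [hv, hcb]; simp
  · intro i; rw [hv, hcb]; simp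
  · rw [hw, hcb]; simp
  · rw [hw, hcb]; simp
  · intro i; rw [hw, hcb]; simp
  · intro i
    have hX : (X i : MvPolynomial (Fin (n + 1)) K) = ∑ j, (b j i) • c j := by
      refine MvPolynomial.funext fun u => ?_
      rw [eval_X, map_sum]
      conv_lhs => rw [← b.sum_repr u, Finset.sum_apply]
      refine Finset.sum_congr rfl fun j _ => ?_
      rw [smul_eval, hce, Pi.smul_apply, smul_eq_mul, mul_comm, Module.Basis.coord_apply]
    rw [hX]
    refine Submodule.sum_mem _ fun j _ => Submodule.smul_mem _ _ (Submodule.subset_span ?_)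
    rcases j with j | j
    · fin_cases j
      · exact Or.inl rfl
      · exact Or.inr (Or.inl rfl)
    · exact Or.inr (Or.inr ⟨j, rfl⟩)

end QuadraticForms

/-! ### Noether normalization by linear forms. -/

section NoetherCoordinates

open MvPolynomial

/-- Linear coordinates `x, y, z₁, …, zₘ` in which the ideal `I` contains, modulo the `zᵢ`, quadratic
forms `x² + αxy` and `y² + βxy` with `αβ ≠ 1`. The points `v`, `w` are dual to `x`, `y`. -/
structure NoetherCoordinates {K : Type*} [Field K] {m : ℕ}
    (I : Ideal (MvPolynomial (Fin (m + 1 + 1)) K)) where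
  x : MvPolynomial (Fin (m + 1 + 1)) K
  y : MvPolynomial (Fin (m + 1 + 1)) K
  z : Fin m → MvPolynomial (Fin (m + 1 + 1)) K
  v : Fin (m + 1 + 1) → K
  w : Fin (m + 1 + 1) → K
  hx : x.IsHomogeneous 1
  hy : y.IsHomogeneous 1
  hz : ∀ i, (z i).IsHomogeneous 1
  vx : eval v x = 1
  vy : eval v y = 0
  vz : ∀ i, eval v (z i) = 0
  wx : eval w x = 0
  wy : eval w y = 1
  wz : ∀ i, eval w (z i) = 0
  X_mem : ∀ i, X i ∈ Submodule.span K (insert x (insert y (Set.range z)))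
  α : K
  β : K
  hαβ : α * β ≠ 1
  xx_mem : x ^ 2 + C α * (x * y) ∈ I ⊔ Ideal.span (Set.range z)
  yy_mem : y ^ 2 + C β * (x * y) ∈ I ⊔ Ideal.span (Set.range z)

variable {K : Type*} [Field K]

theorem MvPolynomial.IsHomogeneous.eval_zero_eq_zero {σ : Type*} {Q : MvPolynomial σ K} {d : ℕ}
    (hQ : Q.IsHomogeneous d) (hd : d ≠ 0) : eval (0 : σ → K) Q = 0 := by
  rw [MvPolynomial.eval_zero, constantCoeff_eq]
  exact hQ.coeff_eq_zero (by simpa using hd.symm)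

/-- If v and w were dependent, then v = 0 or some w + c·v = 0. But both quadrics vanish at the
origin. -/
theorem linearIndependent_pair_of_eval {σ : Type*} {P₁ P₂ : MvPolynomial σ K} {v w : σ → K}
    (h₁ : P₁.IsHomogeneous 2) (h₂ : P₂.IsHomogeneous 2) (hv : eval v P₁ = 1)
    (h : ∀ c : K, eval (w + c • v) P₁ = 0 → eval (w + c • v) P₂ ≠ 0) :
    LinearIndependent K ![v, w] := by
  rw [LinearIndependent.pair_iff]
  intro s t hst
  by_cases ht : t = 0
  · rw [ht, zero_smul, add_zero] at hst
    refine ⟨?_, ht⟩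
    rcases smul_eq_zero.mp hst with hs | hv0
    · exact hs
    · rw [hv0, h₁.eval_zero_eq_zero two_ne_zero] at hv
      exact absurd hv zero_ne_one
  · exfalso
    have hw : w + (t⁻¹ * s) • v = 0 := by
      have := congrArg (fun u => t⁻¹ • u) hst
      simp only [smul_add, smul_smul, inv_mul_cancel₀ ht, one_smul, smul_zero] at this
      rw [add_comm]
      exact this
    have h' := h (t⁻¹ * s)
    rw [hw, h₁.eval_zero_eq_zero two_ne_zero, h₂.eval_zero_eq_zero two_ne_zero] at h'
    exact h' rfl rfl

/-- Modulo the zᵢ a linear form is determined by its values at the dual points v and w. -/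
theorem sub_mem_span_of_isHomogeneous_one {σ ι : Type*} {x y : MvPolynomial σ K}
    {z : ι → MvPolynomial σ K} {v w : σ → K}
    (vx : eval v x = 1) (vy : eval v y = 0) (vz : ∀ i, eval v (z i) = 0)
    (wx : eval w x = 0) (wy : eval w y = 1) (wz : ∀ i, eval w (z i) = 0)
    (X_mem : ∀ i, X i ∈ Submodule.span K (insert x (insert y (Set.range z))))
    {l : MvPolynomial σ K} (hl : l.IsHomogeneous 1) :
    l - (C (eval v l) * x + C (eval w l) * y) ∈ Ideal.span (Set.range z) := by
  have hl' : l ∈ Submodule.span K (insert x (insert y (Set.range z))) := by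
    rw [← mem_homogeneousSubmodule, homogeneousSubmodule_one_eq_span_X] at hl
    refine Submodule.span_le.mpr ?_ hl
    rintro _ ⟨i, rfl⟩
    exact X_mem i
  clear hl
  induction hl' using Submodule.span_induction with
  | mem u hu =>
    rcases hu with rfl | rfl | ⟨i, rfl⟩
    · simp [vx, wx]
    · simp [vy, wy]
    · rw [vz, wz, C_0, zero_mul, zero_mul, add_zero, sub_zero]
      exact Ideal.subset_span ⟨i, rfl⟩
  | zero => simp
  | add a b _ _ ha hb =>
    convert Ideal.add_mem _ ha hb using 1
    simp only [map_add]
    ring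
  | smul c a _ ha =>
    convert Ideal.mul_mem_left _ (C c) ha using 1
    simp only [smul_eq_C_mul, map_mul, eval_C]
    ring

theorem exists_sub_mem_span_of_isHomogeneous_two {σ ι : Type*} {x y : MvPolynomial σ K}
    {z : ι → MvPolynomial σ K} {v w : σ → K}
    (vx : eval v x = 1) (vy : eval v y = 0) (vz : ∀ i, eval v (z i) = 0)
    (wx : eval w x = 0) (wy : eval w y = 1) (wz : ∀ i, eval w (z i) = 0)
    (X_mem : ∀ i, X i ∈ Submodule.span K (insert x (insert y (Set.range z))))
    {Q : MvPolynomial σ K} (hQ : Q.IsHomogeneous 2) :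
    ∃ c : K, Q - (C (eval v Q) * x ^ 2 + C c * (x * y) + C (eval w Q) * y ^ 2) ∈
      Ideal.span (Set.range z) := by
  induction mem_mul_of_isHomogeneous_two hQ using Submodule.mul_induction_on' with
  | mem_mul_mem l hl l' hl' =>
    refine ⟨eval v l * eval w l' + eval w l * eval v l', ?_⟩
    have h1 := sub_mem_span_of_isHomogeneous_one vx vy vz wx wy wz X_mem hl
    have h2 := sub_mem_span_of_isHomogeneous_one vx vy vz wx wy wz X_mem hl'
    have h3 := Ideal.add_mem _ (Ideal.mul_mem_right l' _ h1)
      (Ideal.mul_mem_left _ (C (eval v l) * x + C (eval w l) * y) h2)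
    convert h3 using 1
    simp only [map_mul, map_add]
    ring
  | add a ha b hb iha ihb =>
    have h2 : ∀ u ∈ homogeneousSubmodule σ K 1 * homogeneousSubmodule σ K 1,
        u.IsHomogeneous 2 := fun u hu => by
      rw [← pow_two, homogeneousSubmodule_one_pow] at hu
      exact hu
    obtain ⟨c, hc⟩ := iha (h2 a ha)
    obtain ⟨c', hc'⟩ := ihb (h2 b hb)
    refine ⟨c + c', ?_⟩
    convert Ideal.add_mem _ hc hc' using 1
    simp only [map_add]
    ring

theorem one_le_of_isRelPrime [Infinite K] {n : ℕ} {Q₁ Q₂ : MvPolynomial (Fin (n + 1)) K}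
    (hQ₁ : Q₁.IsHomogeneous 2) (hQ₂ : Q₂.IsHomogeneous 2) (hcop : IsRelPrime Q₁ Q₂) : 1 ≤ n := by
  obtain ⟨P₁, P₂, v, w, h₁, h₂, -, -, hv₁, -, -, -, h⟩ := exists_line_of_isRelPrime hQ₁ hQ₂ hcop
  obtain ⟨m, hm, -⟩ := exists_coordinates (linearIndependent_pair_of_eval h₁ h₂ hv₁ h)
  omega

theorem nonempty_noetherCoordinates [Infinite K] {m : ℕ}
    {Q₁ Q₂ : MvPolynomial (Fin (m + 1 + 1)) K}
    (hQ₁ : Q₁.IsHomogeneous 2) (hQ₂ : Q₂.IsHomogeneous 2) (hcop : IsRelPrime Q₁ Q₂) :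
    Nonempty (NoetherCoordinates (Ideal.span {Q₁, Q₂})) := by
  obtain ⟨P₁, P₂, v, w, h₁, h₂, hI₁, hI₂, hv₁, hv₂, hw₁, hw₂, h⟩ :=
    exists_line_of_isRelPrime hQ₁ hQ₂ hcop
  obtain ⟨m', hm, x, y, z, hx, hy, hz, vx, vy, vz, wx, wy, wz, hX⟩ :=
    exists_coordinates (linearIndependent_pair_of_eval h₁ h₂ hv₁ h)
  obtain rfl : m = m' := by omega
  obtain ⟨a, ha⟩ := exists_sub_mem_span_of_isHomogeneous_two vx vy vz wx wy wz hX h₁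
  obtain ⟨b, hb⟩ := exists_sub_mem_span_of_isHomogeneous_two vx vy vz wx wy wz hX h₂
  rw [hv₁, hw₁, C_0, C_1, one_mul, zero_mul, add_zero] at ha
  rw [hv₂, hw₂, C_0, C_1, one_mul, zero_mul, zero_add] at hb
  have hspan : ∀ c : K, ∀ f ∈ Ideal.span (Set.range z), eval (w + c • v) f = 0 := by
    intro c f hf
    have : Ideal.span (Set.range z) ≤ RingHom.ker (eval (w + c • v)) := by
      rw [Ideal.span_le]
      rintro _ ⟨i, rfl⟩
      rw [SetLike.mem_coe, RingHom.mem_ker, (hz i).eval_add_smul, vz, wz, mul_zero, add_zero]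
    exact this hf
  have hex : ∀ c : K, eval (w + c • v) x = c := fun c => by rw [hx.eval_add_smul, vx, wx]; ring
  have hey : ∀ c : K, eval (w + c • v) y = 1 := fun c => by rw [hy.eval_add_smul, vy, wy]; ring
  refine ⟨⟨x, y, z, v, w, hx, hy, hz, vx, vy, vz, wx, wy, wz, hX, a, b, ?_, ?_, ?_⟩⟩
  · intro hab
    have e1 := hspan (-a) _ ha
    have e2 := hspan (-a) _ hb
    simp only [map_sub, map_add, map_mul, map_pow, eval_C, hex, hey] at e1 e2
    exact h (-a) (by linear_combination e1) (by linear_combination e2 - hab)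
  · have := Submodule.sub_mem_sup (S := Ideal.span {Q₁, Q₂}) hI₁ ha
    convert this using 1; ring
  · have := Submodule.sub_mem_sup (S := Ideal.span {Q₁, Q₂}) hI₂ hb
    convert this using 1; ring

end NoetherCoordinates

/-! ### Graded Nakayama lemma. -/

section GradedGenerators

open MvPolynomial

variable {K : Type*} [Field K] {σ τ : Type*} [Algebra (MvPolynomial τ K) (MvPolynomial σ K)]
  [IsScalarTower K (MvPolynomial τ K) (MvPolynomial σ K)]

local notation "𝕊" => MvPolynomial σ K
local notation "𝔸" => MvPolynomial τ K

/-- The polynomials of degree `k - s`, or `0` if `k < s`. -/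
noncomputable def shiftedPart (τ K : Type*) [Field K] (s k : ℕ) :
    Submodule K (MvPolynomial τ K) :=
  if s ≤ k then homogeneousSubmodule τ K (k - s) else ⊥

theorem C_eq_algebraMap_C (c : K) : (C c : 𝕊) = algebraMap 𝔸 𝕊 (C c) := by
  rw [← algebraMap_eq, ← algebraMap_eq, ← IsScalarTower.algebraMap_apply]

/-- Graded Nakayama lemma: if the `b i` span `S` modulo `I` and the variables of `A`, they generate
`S/I` over `A`, with homogeneous coefficients. -/
theorem exists_sub_sum_mem_of_span [Finite τ]
    (hz : ∀ i, (algebraMap 𝔸 𝕊 (X i)).IsHomogeneous 1) {I : Ideal 𝕊} (hI : IsGradedIdeal I)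
    {c : ℕ} {b : Fin c → 𝕊} {s : Fin c → ℕ} (hb : ∀ i, (b i).IsHomogeneous (s i))
    (hgen : ∀ f : 𝕊, ∃ r : Fin c → K, f - ∑ i, C (r i) * b i ∈
      I ⊔ Ideal.span (Set.range fun i : τ => algebraMap 𝔸 𝕊 (X i)))
    (k : ℕ) : ∀ f : 𝕊, f.IsHomogeneous k → ∃ a : Fin c → 𝔸, (∀ i, a i ∈ shiftedPart τ K (s i) k) ∧
      f - ∑ i, algebraMap 𝔸 𝕊 (a i) * b i ∈ I := by
  have := Fintype.ofFinite τ
  induction k using Nat.strong_induction_on with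
  | _ k ih =>
    intro f hf
    obtain ⟨r, hr⟩ := hgen f
    obtain ⟨g, hg, u, hu, hgu⟩ := Submodule.mem_sup.mp hr
    obtain ⟨h, rfl⟩ := (Ideal.mem_span_range_iff_exists_fun).mp hu
    have hcomp := congrArg (homogeneousComponent k) hgu
    rw [map_add, map_sub, map_sum, map_sum, homogeneousComponent_of_mem hf, if_pos rfl] at hcomp
    have h1 : ∀ i, ∃ a : 𝔸, a ∈ shiftedPart τ K (s i) k ∧
        homogeneousComponent k (C (r i) * b i) = algebraMap 𝔸 𝕊 a * b i := by
      intro i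
      rw [homogeneousComponent_C_mul, homogeneousComponent_of_mem (hb i)]
      by_cases hk : k = s i
      · refine ⟨C (r i), ?_, ?_⟩
        · rw [shiftedPart, if_pos hk.ge, mem_homogeneousSubmodule, hk, Nat.sub_self]
          exact isHomogeneous_C _ _
        · rw [if_pos hk, ← C_eq_algebraMap_C]
      · refine ⟨0, zero_mem _, ?_⟩
        rw [if_neg hk, map_zero, zero_mul, mul_zero]
    have h2 : ∀ j, ∃ a : Fin c → 𝔸, (∀ i, a i ∈ shiftedPart τ K (s i) k) ∧
        homogeneousComponent k (h j * algebraMap 𝔸 𝕊 (X j)) -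
          ∑ i, algebraMap 𝔸 𝕊 (a i) * b i ∈ I := by
      intro j
      cases k with
      | zero =>
        refine ⟨0, fun i => zero_mem _, ?_⟩
        rw [mul_comm, (hz j).homogeneousComponent_mul_of_lt _ zero_lt_one]
        simp
      | succ k =>
        obtain ⟨a, ha, hfa⟩ := ih k (Nat.lt_succ_self k) _
          (homogeneousComponent_isHomogeneous k (h j))
        refine ⟨fun i => X j * a i, fun i => ?_, ?_⟩
        · have := ha i
          simp only [shiftedPart] at this ⊢
          split_ifs at this with h1
          · rw [if_pos (h1.trans (Nat.le_succ k))]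
            have h3 := (isHomogeneous_X K j).mul ((mem_homogeneousSubmodule _ _).mp this)
            rw [mem_homogeneousSubmodule]
            convert h3 using 1
            omega
          · rw [(Submodule.mem_bot K).mp this, mul_zero]
            exact zero_mem _
        · rw [mul_comm, (hz j).homogeneousComponent_mul]
          convert I.mul_mem_left (algebraMap 𝔸 𝕊 (X j)) hfa using 1
          rw [mul_sub, Finset.mul_sum]
          simp only [map_mul, mul_assoc]
    choose a ha ha' using h1
    choose e he he' using h2
    refine ⟨fun i => a i + ∑ j, e j i, fun i => add_mem (ha i) (sum_mem fun j _ => he j i), ?_⟩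
    have h3 := I.add_mem (hI g hg k) (I.sum_mem fun j (_ : j ∈ Finset.univ) => he' j)
    convert h3 using 1
    rw [Finset.sum_sub_distrib, Finset.sum_congr rfl fun i _ => ha' i] at *
    rw [Finset.sum_comm]
    simp only [map_add, map_sum, add_mul, Finset.sum_add_distrib, Finset.sum_mul]
    linear_combination -hcomp

/-- The map `(a, g) ↦ ∑ aᵢ bᵢ + g` in degree `k`. -/
noncomputable def shiftedMap (I : Ideal 𝕊) {c : ℕ} (b : Fin c → 𝕊) (s : Fin c → ℕ) (k : ℕ) :
    ((∀ i, shiftedPart τ K (s i) k) × gradedPart I k) →ₗ[K] 𝕊 :=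
  LinearMap.coprod (∑ i, (LinearMap.mulRight K (b i)) ∘ₗ
    (IsScalarTower.toAlgHom K 𝔸 𝕊).toLinearMap ∘ₗ (shiftedPart τ K (s i) k).subtype ∘ₗ
      LinearMap.proj i) (gradedPart I k).subtype

theorem shiftedMap_apply (I : Ideal 𝕊) {c : ℕ} (b : Fin c → 𝕊) (s : Fin c → ℕ) (k : ℕ)
    (a : ∀ i, shiftedPart τ K (s i) k) (g : gradedPart I k) :
    shiftedMap I b s k (a, g) = ∑ i, algebraMap 𝔸 𝕊 (a i) * b i + g := by
  simp [shiftedMap]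

theorem homogeneousSubmodule_le_range_shiftedMap [Finite τ]
    (hz : ∀ i, (algebraMap 𝔸 𝕊 (X i)).IsHomogeneous 1) {I : Ideal 𝕊} (hI : IsGradedIdeal I)
    {c : ℕ} {b : Fin c → 𝕊} {s : Fin c → ℕ} (hb : ∀ i, (b i).IsHomogeneous (s i))
    (hgen : ∀ f : 𝕊, ∃ r : Fin c → K, f - ∑ i, C (r i) * b i ∈
      I ⊔ Ideal.span (Set.range fun i : τ => algebraMap 𝔸 𝕊 (X i)))
    (k : ℕ) : LinearMap.range (shiftedMap (τ := τ) I b s k) = homogeneousSubmodule σ K k := by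
  have hmem : ∀ a : 𝔸, ∀ i, a ∈ shiftedPart τ K (s i) k →
      (algebraMap 𝔸 𝕊 a * b i).IsHomogeneous k := by
    intro a i ha
    rw [shiftedPart] at ha
    split_ifs at ha with h
    · have := (isHomogeneous_algebraMap hz ((mem_homogeneousSubmodule _ _).mp ha)).mul (hb i)
      rwa [Nat.sub_add_cancel h] at this
    · rw [(Submodule.mem_bot K).mp ha, map_zero, zero_mul]
      exact isHomogeneous_zero _ _ _
  apply le_antisymm
  · rintro _ ⟨⟨a, g⟩, rfl⟩
    rw [shiftedMap_apply]
    exact add_mem (sum_mem fun i _ => hmem _ i (a i).2) (gradedPart_le I k g.2)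
  · intro f hf
    obtain ⟨a, ha, hfa⟩ := exists_sub_sum_mem_of_span hz hI hb hgen k f hf
    refine ⟨(fun i => ⟨a i, ha i⟩, ⟨_, mem_gradedPart.mpr ⟨hfa, ?_⟩⟩), ?_⟩
    · exact IsHomogeneous.sub hf (IsHomogeneous.sum _ _ _ fun i _ => hmem _ i (ha i))
    · rw [shiftedMap_apply]
      simp

end GradedGenerators

/-! ### Freeness from equality of Hilbert functions. -/

section GradedFree

open MvPolynomial

variable {K : Type*} [Field K] {σ : Type*} {m : ℕ} [Algebra (MvPolynomial (Fin m) K) (MvPolynomial σ K)]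
  [IsScalarTower K (MvPolynomial (Fin m) K) (MvPolynomial σ K)]

local notation "𝕊" => MvPolynomial σ K
local notation "𝔸" => MvPolynomial (Fin m) K

instance finite_shiftedPart {τ : Type*} [Finite τ] (s k : ℕ) :
    Module.Finite K (shiftedPart τ K s k) := by
  by_cases h : s ≤ k
  · rw [shiftedPart, if_pos h]
    infer_instance
  · rw [shiftedPart, if_neg h]
    infer_instance

theorem finrank_shiftedPart (s k : ℕ) : Module.finrank K (shiftedPart (Fin m) K s k) =
    if s ≤ k then m.multichoose (k - s) else 0 := by
  by_cases h : s ≤ k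
  · rw [shiftedPart, if_pos h, if_pos h]
    exact finrank_homogeneousSubmodule K m _
  · rw [shiftedPart, if_neg h, if_neg h]
    exact finrank_bot K _

/-- In each degree `shiftedMap` is onto the forms of that degree, and `hfn` says that source and
target have the same finite dimension. It is therefore injective, which excludes relations. -/
theorem eq_zero_of_sum_algebraMap_mul_mem [Finite σ]
    (hz : ∀ i, (algebraMap 𝔸 𝕊 (X i)).IsHomogeneous 1) {I : Ideal 𝕊} (hI : IsGradedIdeal I)
    {c : ℕ} {b : Fin c → 𝕊} {s : Fin c → ℕ} (hb : ∀ i, (b i).IsHomogeneous (s i))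
    (hgen : ∀ f : 𝕊, ∃ r : Fin c → K, f - ∑ i, C (r i) * b i ∈
      I ⊔ Ideal.span (Set.range fun i : Fin m => algebraMap 𝔸 𝕊 (X i)))
    (hfn : ∀ k, hilbertFn I k = ∑ i, if s i ≤ k then m.multichoose (k - s i) else 0)
    {a : Fin c → 𝔸} (ha : ∑ i, algebraMap 𝔸 𝕊 (a i) * b i ∈ I) : a = 0 := by
  have hker : ∀ k, LinearMap.ker (shiftedMap (τ := Fin m) I b s k) = ⊥ := by
    intro k
    have h1 := LinearMap.finrank_range_add_finrank_ker (shiftedMap (τ := Fin m) I b s k)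
    rw [homogeneousSubmodule_le_range_shiftedMap hz hI hb hgen k, Module.finrank_prod,
      Module.finrank_pi_fintype, ← hilbertFn_add I k, hfn] at h1
    simp only [finrank_shiftedPart] at h1
    apply Submodule.finrank_eq_zero.mp
    omega
  funext i
  refine (sum_homogeneousComponent (a i)).symm.trans (Finset.sum_eq_zero fun j _ => ?_)
  -- The component aᵢ of degree j is isolated by looking at the relation in total degree j + sᵢ. The
  -- `if` guards the truncated subtraction when a generator has larger degree.
  have hmem : ∀ i', (if s i' ≤ j + s i then homogeneousComponent (j + s i - s i') (a i') else 0) ∈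
      shiftedPart (Fin m) K (s i') (j + s i) := by
    intro i'
    rw [shiftedPart]
    split_ifs
    · exact homogeneousComponent_isHomogeneous _ _
    · exact zero_mem _
  have hcomp : homogeneousComponent (j + s i) (∑ i, algebraMap 𝔸 𝕊 (a i) * b i) =
      ∑ i', algebraMap 𝔸 𝕊
        (if s i' ≤ j + s i then homogeneousComponent (j + s i - s i') (a i') else 0) * b i' := by
    rw [map_sum]
    refine Finset.sum_congr rfl fun i' _ => ?_
    rw [mul_comm]
    split_ifs with h
    · conv_lhs => rw [← Nat.sub_add_cancel h]
      rw [(hb i').homogeneousComponent_mul, homogeneousComponent_algebraMap hz, mul_comm]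
    · rw [(hb i').homogeneousComponent_mul_of_lt _ (not_le.mp h), map_zero, zero_mul]
  have h0 := hI _ ha (j + s i)
  have hmem0 : ((fun i' => ⟨_, hmem i'⟩, ⟨_, mem_gradedPart.mpr ⟨I.neg_mem h0,
      (homogeneousComponent_isHomogeneous _ _).neg⟩⟩) :
      (∀ i', shiftedPart (Fin m) K (s i') (j + s i)) × gradedPart I (j + s i)) ∈
      LinearMap.ker (shiftedMap (τ := Fin m) I b s (j + s i)) := by
    rw [LinearMap.mem_ker, shiftedMap_apply]
    exact (congrArg (· + _) hcomp.symm).trans (add_neg_cancel _)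
  rw [hker, Submodule.mem_bot, Prod.mk_eq_zero] at hmem0
  have := congrArg Subtype.val (congrFun hmem0.1 i)
  simpa using this

end GradedFree

/-! ### Hilbert functions of complete intersections. -/

section CompleteIntersection

open MvPolynomial

variable {K : Type*} [Field K]

theorem MvPolynomial.IsHomogeneous.not_isUnit {σ : Type*} {Q : MvPolynomial σ K} {d : ℕ}
    (hQ : Q.IsHomogeneous d) (hd : d ≠ 0) : ¬ IsUnit Q := fun h => by
  have := h.map (eval (0 : σ → K))
  rw [hQ.eval_zero_eq_zero hd] at this
  exact not_isUnit_zero this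

/-- The pair f, g is a regular sequence, and each nonzerodivisor of degree d contributes a factor 1
− Tᵈ. -/
theorem hilbertSeries_span_pair {n : ℕ} {f g : MvPolynomial (Fin n) K} {d e : ℕ}
    (hf : f.IsHomogeneous d) (hg : g.IsHomogeneous e) (hf0 : f ≠ 0) (hg0 : g ≠ 0)
    (hcop : ∀ h, f ∣ g * h → f ∣ h) :
    hilbertSeries (Ideal.span {f, g}) =
      (1 - PowerSeries.X ^ e) * ((1 - PowerSeries.X ^ d) * hilbertSeries (⊥ : Ideal (MvPolynomial (Fin n) K))) := by
  have h1 := hilbertSeries_sup_span (isGradedIdeal_bot (σ := Fin n) (K := K)) hf hf0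
    fun h hh => (mul_eq_zero.mp hh).resolve_left hf0
  rw [bot_sup_eq] at h1
  rw [Ideal.span_insert, hilbertSeries_sup_span (isGradedIdeal_span_singleton hf) hg hg0, h1]
  intro h hh
  rw [Ideal.mem_span_singleton] at hh ⊢
  exact hcop h hh

theorem isGradedIdeal_span_pair {σ : Type*} {f g : MvPolynomial σ K} {d e : ℕ}
    (hf : f.IsHomogeneous d) (hg : g.IsHomogeneous e) : IsGradedIdeal (Ideal.span {f, g}) := by
  rw [Ideal.span_insert]
  exact (isGradedIdeal_span_singleton hf).sup (isGradedIdeal_span_singleton hg)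

/-- A factor (1 − T)² cancels two variables, since the series of a polynomial ring in N variables is
(1 − T)⁻ᴺ. -/
theorem hilbertSeries_mul_of_eq {m : ℕ} {J : Ideal (MvPolynomial (Fin (m + 1 + 1)) K)}
    {P : PowerSeries ℚ}
    (h : hilbertSeries J = P * (1 - PowerSeries.X) ^ 2 *
      hilbertSeries (⊥ : Ideal (MvPolynomial (Fin (m + 1 + 1)) K))) :
    hilbertSeries J = P * hilbertSeries (⊥ : Ideal (MvPolynomial (Fin m) K)) := by
  have h1 := hilbertSeries_bot_mul K m
  have h2 := hilbertSeries_bot_mul K (m + 1 + 1)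
  have h0 : ((1 : PowerSeries ℚ) - PowerSeries.X) ≠ 0 := fun h => by
    simpa using congrArg (PowerSeries.coeff 0) h
  apply mul_right_cancel₀ (pow_ne_zero (m + 1 + 1) h0)
  rw [h]
  linear_combination (P * (1 - PowerSeries.X) ^ 2) * (h2 - h1)

theorem coeff_X_pow_mul_hilbertSeries_bot (m s k : ℕ) :
    PowerSeries.coeff k (PowerSeries.X ^ s * hilbertSeries (⊥ : Ideal (MvPolynomial (Fin m) K))) =
      ((if s ≤ k then m.multichoose (k - s) else 0 : ℕ) : ℚ) := by
  rw [PowerSeries.coeff_X_pow_mul']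
  split_ifs
  · rw [hilbertSeries, PowerSeries.coeff_mk, hilbertFn_bot, finrank_homogeneousSubmodule]
  · simp

theorem hilbertFn_eq_sum_of_hilbertSeries_eq {m c : ℕ} {J : Ideal (MvPolynomial (Fin (m + 1 + 1)) K)}
    {s : Fin c → ℕ}
    (h : hilbertSeries J = (∑ i, PowerSeries.X ^ s i) *
      hilbertSeries (⊥ : Ideal (MvPolynomial (Fin m) K))) (k : ℕ) :
    hilbertFn J k = ∑ i, if s i ≤ k then m.multichoose (k - s i) else 0 := by
  have h1 := congrArg (PowerSeries.coeff k) h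
  rw [Finset.sum_mul, map_sum, Finset.sum_congr rfl fun i _ =>
    coeff_X_pow_mul_hilbertSeries_bot m (s i) k, ← Nat.cast_sum] at h1
  rw [hilbertSeries, PowerSeries.coeff_mk] at h1
  exact_mod_cast h1

/-- The shifts come from (1 − T²)² = (1 + T + T + T²)(1 − T)². -/
theorem hilbertFn_span_pair_of_two_two {m : ℕ} {f g : MvPolynomial (Fin (m + 1 + 1)) K}
    (hf : f.IsHomogeneous 2) (hg : g.IsHomogeneous 2) (hcop : IsRelPrime f g) (k : ℕ) :
    hilbertFn (Ideal.span {f, g}) k =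
      ∑ i, if (![0, 1, 1, 2] : Fin 4 → ℕ) i ≤ k then
        m.multichoose (k - (![0, 1, 1, 2] : Fin 4 → ℕ) i) else 0 := by
  have hf0 : f ≠ 0 := by
    rintro rfl
    exact hg.not_isUnit two_ne_zero (isRelPrime_zero_left.mp hcop)
  have hg0 : g ≠ 0 := by
    rintro rfl
    exact hf.not_isUnit two_ne_zero (isRelPrime_zero_right.mp hcop)
  apply hilbertFn_eq_sum_of_hilbertSeries_eq
  apply hilbertSeries_mul_of_eq
  rw [hilbertSeries_span_pair hf hg hf0 hg0 fun h hh => hcop.dvd_of_dvd_mul_left hh]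
  simp [Fin.sum_univ_succ]
  ring

/-- The shifts come from (1 − T)(1 − T²) = (1 + T)(1 − T)². -/
theorem hilbertFn_span_pair_of_one_two {m : ℕ} {f g : MvPolynomial (Fin (m + 1 + 1)) K}
    (hf : f.IsHomogeneous 1) (hg : g.IsHomogeneous 2) (hf0 : f ≠ 0) (hg0 : g ≠ 0)
    (hcop : ∀ h, f ∣ g * h → f ∣ h) (k : ℕ) :
    hilbertFn (Ideal.span {f, g}) k =
      ∑ i, if (![0, 1] : Fin 2 → ℕ) i ≤ k then
        m.multichoose (k - (![0, 1] : Fin 2 → ℕ) i) else 0 := by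
  apply hilbertFn_eq_sum_of_hilbertSeries_eq
  apply hilbertSeries_mul_of_eq
  rw [hilbertSeries_span_pair hf hg hf0 hg0 hcop]
  simp [Fin.sum_univ_succ]
  ring

end CompleteIntersection

/-! ### Freeness of S/I with basis 1, x, y, xy. -/

namespace NoetherCoordinates

open MvPolynomial

variable {K : Type*} [Field K] {m : ℕ} {I : Ideal (MvPolynomial (Fin (m + 1 + 1)) K)}
  (N : NoetherCoordinates I)

/-- The ideal generated by `I` and the forms `zᵢ`. -/
noncomputable def fiberIdeal : Ideal (MvPolynomial (Fin (m + 1 + 1)) K) := I ⊔ Ideal.span (Set.range N.z)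

/-- Eliminating xy² gives y(x² + αxy) − αx(y² + βxy) = (1 − αβ)x²y, and the scalar is invertible. -/
theorem xxy_mem : N.x * (N.x * N.y) ∈ N.fiberIdeal := by
  have h1 := N.fiberIdeal.sub_mem (N.fiberIdeal.mul_mem_left N.y N.xx_mem)
    (N.fiberIdeal.mul_mem_left (C N.α * N.x) N.yy_mem)
  have h0 : 1 - N.α * N.β ≠ 0 := sub_ne_zero.mpr N.hαβ.symm
  have h2 := N.fiberIdeal.mul_mem_left (C (1 - N.α * N.β)⁻¹) h1
  convert h2 using 1
  have h3 : (C (1 - N.α * N.β)⁻¹ : MvPolynomial (Fin (m + 1 + 1)) K) * (1 - C N.α * C N.β) = 1 := by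
    rw [← C_mul, ← C_1, ← C_sub, ← C_mul, inv_mul_cancel₀ h0]
  linear_combination -N.x * (N.x * N.y) * h3

theorem xyy_mem : N.y * (N.x * N.y) ∈ N.fiberIdeal := by
  have h1 := N.fiberIdeal.sub_mem (N.fiberIdeal.mul_mem_left N.x N.yy_mem)
    (N.fiberIdeal.mul_mem_left (C N.β * N.y) N.xx_mem)
  have h0 : 1 - N.α * N.β ≠ 0 := sub_ne_zero.mpr N.hαβ.symm
  have h2 := N.fiberIdeal.mul_mem_left (C (1 - N.α * N.β)⁻¹) h1
  convert h2 using 1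
  have h3 : (C (1 - N.α * N.β)⁻¹ : MvPolynomial (Fin (m + 1 + 1)) K) * (1 - C N.α * C N.β) = 1 := by
    rw [← C_mul, ← C_1, ← C_sub, ← C_mul, inv_mul_cancel₀ h0]
  linear_combination -N.y * (N.x * N.y) * h3

theorem exists_sub_mem (f : MvPolynomial (Fin (m + 1 + 1)) K) :
    ∃ a b c d : K, f - (C a + C b * N.x + C c * N.y + C d * (N.x * N.y)) ∈ N.fiberIdeal := by
  -- The span of 1, x, y, xy modulo the fiber ideal is stable under multiplication by every linear
  -- form, hence is everything.
  have hmul : ∀ l ∈ Submodule.span K (insert N.x (insert N.y (Set.range N.z))),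
      ∀ f : MvPolynomial (Fin (m + 1 + 1)) K,
      (∃ a b c d : K, f - (C a + C b * N.x + C c * N.y + C d * (N.x * N.y)) ∈ N.fiberIdeal) →
      ∃ a b c d : K, f * l - (C a + C b * N.x + C c * N.y + C d * (N.x * N.y)) ∈ N.fiberIdeal := by
    intro l hl
    induction hl using Submodule.span_induction with
    | mem u hu =>
      rintro f ⟨a, b, c, d, hf⟩
      rcases hu with rfl | rfl | ⟨i, rfl⟩
      -- Multiplying by x uses x² ≡ −αxy and x²y ≡ 0; the case of y below is symmetric.
      · refine ⟨0, a, 0, c - N.α * b, ?_⟩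
        convert add_mem (add_mem (N.fiberIdeal.mul_mem_left N.x hf)
          (N.fiberIdeal.mul_mem_left (C b) N.xx_mem))
          (N.fiberIdeal.mul_mem_left (C d) N.xxy_mem) using 1
        simp only [C_0, C_sub, C_mul]
        ring
      · refine ⟨0, 0, a, b - N.β * c, ?_⟩
        convert add_mem (add_mem (N.fiberIdeal.mul_mem_left N.y hf)
          (N.fiberIdeal.mul_mem_left (C c) N.yy_mem))
          (N.fiberIdeal.mul_mem_left (C d) N.xyy_mem) using 1
        simp only [C_0, C_sub, C_mul]
        ring
      · refine ⟨0, 0, 0, 0, ?_⟩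
        simp only [C_0, zero_mul, add_zero, sub_zero]
        exact Ideal.mul_mem_left _ _ (Ideal.mem_sup_right (Ideal.subset_span ⟨i, rfl⟩))
    | zero =>
      intro f _
      exact ⟨0, 0, 0, 0, by simp⟩
    | add p q _ _ hp hq =>
      intro f hf
      obtain ⟨a, b, c, d, h⟩ := hp f hf
      obtain ⟨a', b', c', d', h'⟩ := hq f hf
      refine ⟨a + a', b + b', c + c', d + d', ?_⟩
      convert add_mem h h' using 1
      simp only [C_add]
      ring
    | smul r p _ hp =>
      intro f hf
      obtain ⟨a, b, c, d, h⟩ := hp f hf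
      refine ⟨r * a, r * b, r * c, r * d, ?_⟩
      convert N.fiberIdeal.mul_mem_left (C r) h using 1
      simp only [C_mul, smul_eq_C_mul]
      ring
  induction f using MvPolynomial.induction_on with
  | C a => exact ⟨a, 0, 0, 0, by simp⟩
  | add p q hp hq =>
    obtain ⟨a, b, c, d, h⟩ := hp
    obtain ⟨a', b', c', d', h'⟩ := hq
    refine ⟨a + a', b + b', c + c', d + d', ?_⟩
    convert add_mem h h' using 1
    simp only [C_add]
    ring
  | mul_X p i hp => exact hmul _ (N.X_mem i) p hp

/-- The fiber over the origin is supported at the origin: x²y and xy² force x or y into P, then the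
two quadratic relations give the other one, so P contains every variable. -/
theorem le_idealOfVars {P : Ideal (MvPolynomial (Fin (m + 1 + 1)) K)} (hP : P.IsPrime)
    (hI : I ≤ P) (hz : ∀ i, N.z i ∈ P) : P ≤ idealOfVars (Fin (m + 1 + 1)) K := by
  have hJ : N.fiberIdeal ≤ P := sup_le hI (Ideal.span_le.mpr (by rintro _ ⟨i, rfl⟩; exact hz i))
  have hxP : N.x ∈ P ∨ N.y ∈ P := by
    rcases hP.mem_or_mem (hJ N.xxy_mem) with h | h
    · exact Or.inl h
    · exact hP.mem_or_mem h
  have hxy : N.x ∈ P ∧ N.y ∈ P := by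
    rcases hxP with h | h
    · refine ⟨h, hP.mem_of_pow_mem 2 ?_⟩
      exact (P.add_mem_iff_left (P.mul_mem_left _ (P.mul_mem_right _ h))).mp (hJ N.yy_mem)
    · refine ⟨hP.mem_of_pow_mem 2 ?_, h⟩
      exact (P.add_mem_iff_left (P.mul_mem_left _ (P.mul_mem_left _ h))).mp (hJ N.xx_mem)
  have hX : ∀ i, (X i : MvPolynomial (Fin (m + 1 + 1)) K) ∈ P := by
    intro i
    have : Submodule.span K (insert N.x (insert N.y (Set.range N.z))) ≤ P.restrictScalars K := by
      rw [Submodule.span_le]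
      rintro _ (rfl | rfl | ⟨j, rfl⟩)
      exacts [hxy.1, hxy.2, hz j]
    exact this (N.X_mem i)
  intro f hf
  rw [mem_idealOfVars_iff_constantCoeff]
  by_contra hc
  have h1 : f - C (constantCoeff f) ∈ P := by
    have h2 : idealOfVars (Fin (m + 1 + 1)) K ≤ P := by
      rw [idealOfVars, Ideal.span_le]
      rintro _ ⟨i, rfl⟩
      exact hX i
    exact h2 (by rw [mem_idealOfVars_iff_constantCoeff]; simp)
  have h2 : C (constantCoeff f) ∈ P := by
    simpa using P.sub_mem hf h1
  exact hP.ne_top (Ideal.eq_top_of_isUnit_mem _ h2 ((isUnit_iff_ne_zero.mpr hc).map C))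

local notation "𝕊" => MvPolynomial (Fin (m + 1 + 1)) K
local notation "𝔸" => MvPolynomial (Fin m) K

/-- The generators `1, x, y, xy`. -/
noncomputable def gens : Fin 4 → 𝕊 := ![1, N.x, N.y, N.x * N.y]

theorem isHomogeneous_gens (i : Fin 4) :
    (N.gens i).IsHomogeneous ((![0, 1, 1, 2] : Fin 4 → ℕ) i) := by
  fin_cases i
  exacts [isHomogeneous_one _ _, N.hx, N.hy, N.hx.mul N.hy]

variable [Algebra (MvPolynomial (Fin m) K) (MvPolynomial (Fin (m + 1 + 1)) K)]
  (hz : ∀ i, algebraMap (MvPolynomial (Fin m) K) (MvPolynomial (Fin (m + 1 + 1)) K) (X i) = N.z i)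

include hz

theorem exists_sub_sum_gens_mem_sup (f : 𝕊) : ∃ r : Fin 4 → K, f - ∑ i, C (r i) * N.gens i ∈
    I ⊔ Ideal.span (Set.range fun i : Fin m => algebraMap 𝔸 𝕊 (X i)) := by
  obtain ⟨a, b, c, d, h⟩ := N.exists_sub_mem f
  refine ⟨![a, b, c, d], ?_⟩
  rw [show (fun i => algebraMap 𝔸 𝕊 (X i)) = N.z from funext hz]
  convert h using 1
  · rfl
  · simp [Fin.sum_univ_succ, gens]
    ring

variable [IsScalarTower K (MvPolynomial (Fin m) K) (MvPolynomial (Fin (m + 1 + 1)) K)]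

theorem exists_sub_sum_gens_mem (hI : IsGradedIdeal I) (f : 𝕊) :
    ∃ a : Fin 4 → 𝔸, f - ∑ i, algebraMap 𝔸 𝕊 (a i) * N.gens i ∈ I := by
  have h : ∀ k, ∃ a : Fin 4 → 𝔸, homogeneousComponent k f -
      ∑ i, algebraMap 𝔸 𝕊 (a i) * N.gens i ∈ I := fun k => by
    obtain ⟨a, -, ha⟩ := exists_sub_sum_mem_of_span (fun i => hz i ▸ N.hz i) hI
      N.isHomogeneous_gens (N.exists_sub_sum_gens_mem_sup hz) k _
      (homogeneousComponent_isHomogeneous k f)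
    exact ⟨a, ha⟩
  choose a ha using h
  refine ⟨fun i => ∑ k ∈ Finset.range (f.totalDegree + 1), a k i, ?_⟩
  convert I.sum_mem fun k (_ : k ∈ Finset.range (f.totalDegree + 1)) => ha k using 1
  rw [Finset.sum_sub_distrib, sum_homogeneousComponent, Finset.sum_comm]
  simp only [map_sum, Finset.sum_mul]

/-- `S/I` is free over `A` with basis `1, x, y, xy`. -/
theorem nonempty_basis (hI : IsGradedIdeal I) (hfn : ∀ k, hilbertFn I k =
      ∑ i, if (![0, 1, 1, 2] : Fin 4 → ℕ) i ≤ k then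
        m.multichoose (k - (![0, 1, 1, 2] : Fin 4 → ℕ) i) else 0) :
    Nonempty (Module.Basis (Fin 4) 𝔸 (𝕊 ⧸ I)) := by
  have hmk : ∀ a : Fin 4 → 𝔸, ∑ i, a i • Ideal.Quotient.mk I (N.gens i) =
      Ideal.Quotient.mk I (∑ i, algebraMap 𝔸 𝕊 (a i) * N.gens i) := by
    intro a
    rw [map_sum]
    refine Finset.sum_congr rfl fun i _ => ?_
    rw [← Algebra.smul_def]
    rfl
  refine ⟨Module.Basis.mk (v := fun i => Ideal.Quotient.mk I (N.gens i)) ?_ ?_⟩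
  · rw [Fintype.linearIndependent_iff]
    intro a ha
    rw [hmk, Ideal.Quotient.eq_zero_iff_mem] at ha
    exact congrFun (eq_zero_of_sum_algebraMap_mul_mem (fun i => hz i ▸ N.hz i) hI
      N.isHomogeneous_gens (N.exists_sub_sum_gens_mem_sup hz) hfn ha)
  · rintro b -
    obtain ⟨f, rfl⟩ := Ideal.Quotient.mk_surjective b
    obtain ⟨a, ha⟩ := N.exists_sub_sum_gens_mem hz hI f
    rw [(Ideal.Quotient.eq).mpr ha, ← hmk]
    exact Submodule.sum_mem _ fun i _ => Submodule.smul_mem _ _ (Submodule.subset_span ⟨i, rfl⟩)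

end NoetherCoordinates

/-! ### Ranks of minimal primes in a finite extension. -/

section FiniteTorsionFree

variable {A B : Type*} [CommRing A] [CommRing B] [Algebra A B]

/-- Minimal primes of a Noetherian ring are associated. The annihilated element g realizes B/P as
the submodule Bg of B, so ranks can be compared inside B. -/
theorem exists_forall_mem_iff_mul_eq_zero [IsNoetherianRing B] {P : Ideal B}
    (hP : P ∈ minimalPrimes B) : ∃ g : B, ∀ b, b ∈ P ↔ b * g = 0 := by
  have h : P ∈ (Module.annihilator B B).minimalPrimes := by
    rwa [(Module.annihilator_eq_bot (R := B) (M := B)).mpr inferInstance]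
  obtain ⟨g, hg⟩ := (isAssociatedPrime_iff.mp
    (Module.associatedPrimes.minimalPrimes_annihilator_subset_associatedPrimes B B h)).2
  exact ⟨g, fun b => by rw [hg, Submodule.mem_colon_singleton, Submodule.mem_bot, smul_eq_mul]⟩

theorem comap_eq_bot_of_forall_mem_iff [IsDomain A] [Module.IsTorsionFree A B] {P : Ideal B} {g : B} (hg0 : g ≠ 0)
    (hg : ∀ b ∈ P, b * g = 0) {a : A} (ha : algebraMap A B a ∈ P) : a = 0 := by
  have := hg _ ha
  rw [← Algebra.smul_def] at this
  exact (smul_eq_zero.mp this).resolve_right hg0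

/-- A strictly smaller prime would contract to an ideal strictly below 0, by incomparability. -/
theorem mem_minimalPrimes_of_comap_eq_bot [Algebra.IsIntegral A B] {P : Ideal B} (hP : P.IsPrime)
    (h : ∀ a, algebraMap A B a ∈ P → a = 0) : P ∈ minimalPrimes B := by
  refine ⟨⟨hP, bot_le⟩, fun Q hQ hQP => ?_⟩
  have := hQ.1
  by_contra hne
  have h1 := Ideal.IsIntegral.comap_lt_comap (R := A) (lt_of_le_not_ge hQP hne)
  have h2 : P.comap (algebraMap A B) = ⊥ := by
    rw [eq_bot_iff]
    exact fun a ha => h a ha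
  rw [h2] at h1
  exact not_lt_bot h1

theorem finrank_range_mulRight {P : Ideal B} {g : B} (hg : ∀ b, b ∈ P ↔ b * g = 0) :
    Module.finrank A (LinearMap.range (LinearMap.mulRight A g)) = Module.finrank A (B ⧸ P) := by
  rw [← (LinearMap.mulRight A g).quotKerEquivRange.finrank_eq]
  have : LinearMap.ker (LinearMap.mulRight A g) = P.restrictScalars A := by
    ext b
    rw [LinearMap.mem_ker, LinearMap.mulRight_apply, Submodule.restrictScalars_mem, hg]
  rw [this]
  exact (Submodule.Quotient.restrictScalarsEquiv A P).finrank_eq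

variable [IsDomain A] [IsNoetherianRing A] [Module.Finite A B]

theorem Submodule.finrank_add_finrank_eq_of_disjoint {s t : Submodule A B} (h : Disjoint s t) :
    Module.finrank A s + Module.finrank A t = Module.finrank A ↥(s ⊔ t) := by
  have h1 := Submodule.rank_sup_add_rank_inf_eq s t
  rw [h.eq_bot, rank_bot, add_zero, ← Module.finrank_eq_rank, ← Module.finrank_eq_rank,
    ← Module.finrank_eq_rank] at h1
  exact_mod_cast h1.symm

theorem finrank_quotient_add_three_le {P₁ P₂ P₃ : Ideal B} (h₁ : P₁ ∈ minimalPrimes B)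
    (h₂ : P₂ ∈ minimalPrimes B) (h₃ : P₃ ∈ minimalPrimes B) (h₁₂ : P₁ ≠ P₂) (h₁₃ : P₁ ≠ P₃)
    (h₂₃ : P₂ ≠ P₃) :
    Module.finrank A (B ⧸ P₁) + Module.finrank A (B ⧸ P₂) + Module.finrank A (B ⧸ P₃) ≤
      Module.finrank A B := by
  have : IsNoetherianRing B := IsNoetherianRing.of_finite A B
  obtain ⟨g₁, hg₁⟩ := exists_forall_mem_iff_mul_eq_zero h₁
  obtain ⟨g₂, hg₂⟩ := exists_forall_mem_iff_mul_eq_zero h₂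
  obtain ⟨g₃, hg₃⟩ := exists_forall_mem_iff_mul_eq_zero h₃
  have hle : ∀ {P Q : Ideal B}, P ∈ minimalPrimes B → Q ∈ minimalPrimes B → P ≤ Q → P = Q :=
    fun hP hQ h => le_antisymm h (hQ.2 hP.1 h)
  have hp₁ := h₁.1.1
  have hp₂ := h₂.1.1
  have hp₃ := h₃.1.1
  rw [← finrank_range_mulRight hg₁, ← finrank_range_mulRight hg₂, ← finrank_range_mulRight hg₃,
    Submodule.finrank_add_finrank_eq_of_disjoint, Submodule.finrank_add_finrank_eq_of_disjoint]
  · exact Submodule.finrank_le _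
  · rw [Submodule.disjoint_def]
    rintro _ hx ⟨b, rfl⟩
    obtain ⟨_, ⟨b₁, rfl⟩, _, ⟨b₂, rfl⟩, h⟩ := Submodule.mem_sup.mp hx
    simp only [LinearMap.mulRight_apply] at h ⊢
    rw [← hg₃]
    by_contra hb
    -- An element b·g₃ of Bg₁ + Bg₂ is killed by P₁P₂. If b ∉ P₃, then P₁ or P₂ lies in P₃, against
    -- minimality and distinctness.
    have : P₁ * P₂ ≤ P₃ := by
      rw [Ideal.mul_le]
      intro r hr s hs
      refine (hp₃.mem_or_mem ((hg₃ (r * s * b)).mpr ?_)).resolve_right hb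
      have e1 := (hg₁ r).mp hr
      have e2 := (hg₂ s).mp hs
      linear_combination (-r * s) * h + (b₁ * s) * e1 + (b₂ * r) * e2
    rcases hp₃.mul_le.mp this with h | h
    · exact h₁₃ (hle h₁ h₃ h)
    · exact h₂₃ (hle h₂ h₃ h)
  · rw [Submodule.disjoint_def]
    rintro _ ⟨b₁, rfl⟩ ⟨b, h⟩
    simp only [LinearMap.mulRight_apply] at h ⊢
    rw [← h, ← hg₂]
    by_contra hb
    refine h₁₂ (hle h₁ h₂ fun r hr => (hp₂.mem_or_mem ((hg₂ (r * b)).mpr ?_)).resolve_right hb)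
    have e1 := (hg₁ r).mp hr
    linear_combination r * h + b₁ * e1

theorem finrank_quotient_add_two_le {P₁ P₂ : Ideal B} (h₁ : P₁ ∈ minimalPrimes B)
    (h₂ : P₂ ∈ minimalPrimes B) (h₁₂ : P₁ ≠ P₂) :
    Module.finrank A (B ⧸ P₁) + Module.finrank A (B ⧸ P₂) ≤ Module.finrank A B := by
  have : IsNoetherianRing B := IsNoetherianRing.of_finite A B
  obtain ⟨g₁, hg₁⟩ := exists_forall_mem_iff_mul_eq_zero h₁
  obtain ⟨g₂, hg₂⟩ := exists_forall_mem_iff_mul_eq_zero h₂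
  have hp₂ := h₂.1.1
  rw [← finrank_range_mulRight hg₁, ← finrank_range_mulRight hg₂,
    Submodule.finrank_add_finrank_eq_of_disjoint]
  · exact Submodule.finrank_le _
  · rw [Submodule.disjoint_def]
    rintro _ ⟨b₁, rfl⟩ ⟨b, h⟩
    simp only [LinearMap.mulRight_apply] at h ⊢
    rw [← h, ← hg₂]
    by_contra hb
    have hle : P₁ ≤ P₂ := fun r hr => by
      refine (hp₂.mem_or_mem ((hg₂ (r * b)).mpr ?_)).resolve_right hb
      have e1 := (hg₁ r).mp hr
      linear_combination r * h + b₁ * e1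
    exact h₁₂ (le_antisymm hle (h₂.2 h₁.1 hle))

/-- If B/P had rank at least 3, P would have rank at most 1, too small to contain Bg, so g ∉ P. A
nonzero nilpotent n lies in P, so rank 1 makes every element of P proportional to n over A and hence
nilpotent. Then P is the only candidate for an associated prime containing ann(n). But g kills n,
which forces g ∈ P. -/
theorem finrank_quotient_le_two_of_not_isReduced [Module.IsTorsionFree A B] (hB : ¬ IsReduced B)
    (hr : Module.finrank A B = 4) {P : Ideal B} (hP : P ∈ minimalPrimes B) :
    Module.finrank A (B ⧸ P) ≤ 2 := by
  have : IsNoetherianRing B := IsNoetherianRing.of_finite A B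
  obtain ⟨g, hg⟩ := exists_forall_mem_iff_mul_eq_zero hP
  have hpr := hP.1.1
  have hg0 : ∀ {g : B} {Q : Ideal B}, Q.IsPrime → (∀ b, b ∈ Q ↔ b * g = 0) → g ≠ 0 := by
    rintro g Q hQ h rfl
    exact hQ.ne_top ((Ideal.eq_top_iff_one Q).mpr ((h 1).mpr (mul_zero 1)))
  by_contra hlt
  have hPr : Module.finrank A (P.restrictScalars A) ≤ 1 := by
    have h1 := Submodule.finrank_quotient_add_finrank (P.restrictScalars A)
    rw [(Submodule.Quotient.restrictScalarsEquiv A P).finrank_eq] at h1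
    omega
  have hgP : g ∉ P := by
    intro h
    have h1 : LinearMap.range (LinearMap.mulRight A g) ≤ P.restrictScalars A := by
      rintro _ ⟨b, rfl⟩
      exact P.mul_mem_left b h
    have h2 := Submodule.finrank_mono h1
    rw [finrank_range_mulRight hg] at h2
    omega
  obtain ⟨n, hn, hn0⟩ : ∃ n : B, IsNilpotent n ∧ n ≠ 0 := by
    by_contra! h
    exact hB ⟨h⟩
  have hnP : n ∈ P := by
    obtain ⟨k, hk⟩ := hn
    exact hpr.mem_of_pow_mem k (hk ▸ P.zero_mem)
  have hnil : ∀ b ∈ P, IsNilpotent b := by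
    intro b hb
    have hdep : ¬ LinearIndependent A
        ![(⟨b, hb⟩ : P.restrictScalars A), (⟨n, hnP⟩ : P.restrictScalars A)] := fun h => by
      have := h.fintype_card_le_finrank
      rw [Fintype.card_fin] at this
      omega
    rw [LinearIndependent.pair_iff] at hdep
    push Not at hdep
    obtain ⟨α, β, h1, h2⟩ := hdep
    have h3 : α • b + β • n = 0 := congrArg Subtype.val h1
    have hα : α ≠ 0 := by
      intro hα
      rw [hα, zero_smul, zero_add] at h3
      exact h2 hα ((smul_eq_zero.mp h3).resolve_right hn0)
    have h4 : IsNilpotent (α • b) := by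
      rw [eq_neg_of_add_eq_zero_left h3]
      exact (hn.smul β).neg
    obtain ⟨k, hk⟩ := h4
    rw [smul_pow] at hk
    exact ⟨k, (smul_eq_zero.mp hk).resolve_left (pow_ne_zero k hα)⟩
  obtain ⟨Q, hQ, hQn⟩ := exists_le_isAssociatedPrime_of_isNoetherianRing B n hn0
  obtain ⟨hQp, u, hu⟩ := isAssociatedPrime_iff.mp hQ
  have hQu : ∀ b, b ∈ Q ↔ b * u = 0 := fun b => by
    rw [hu, Submodule.mem_colon_singleton, Submodule.mem_bot, smul_eq_mul]
  have hQmin : Q ∈ minimalPrimes B := mem_minimalPrimes_of_comap_eq_bot (A := A) hQp fun a ha =>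
    comap_eq_bot_of_forall_mem_iff (hg0 hQp hQu) (fun b hb => (hQu b).mp hb) ha
  have hPQ : P ≤ Q := fun b hb => by
    obtain ⟨k, hk⟩ := hnil b hb
    exact hQp.mem_of_pow_mem k (hk ▸ Q.zero_mem)
  refine hgP (hQmin.2 hP.1 hPQ (hQn ?_))
  rw [Submodule.mem_colon_singleton, Submodule.mem_bot, smul_eq_mul, mul_comm]
  exact (hg n).mp hnP

end FiniteTorsionFree

/-! ### Monic equations over an integrally closed base. -/

section IntegrallyClosed

theorem exists_monic_natDegree_eq_aeval_eq_zero {A T : Type*} [CommRing A] [IsDomain A]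
    [IsIntegrallyClosed A] [CommRing T] [IsDomain T] [Algebra A T] [Module.IsTorsionFree A T]
    [Module.Finite A T] {d : ℕ} (hd : Module.finrank A T ≤ d) (t : T) :
    ∃ q : Polynomial A, q.Monic ∧ q.natDegree = d ∧ Polynomial.aeval t q = 0 := by
  have hint : IsIntegral A t := Algebra.IsIntegral.isIntegral t
  have hdep : ¬ LinearIndependent A fun i : Fin (d + 1) => t ^ (i : ℕ) := fun h => by
    have := h.fintype_card_le_finrank
    rw [Fintype.card_fin] at this
    omega
  rw [Fintype.not_linearIndependent_iff] at hdep
  obtain ⟨a, ha, i, hi⟩ := hdep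
  set q : Polynomial A := ∑ i : Fin (d + 1), Polynomial.monomial (i : ℕ) (a i) with hq
  have hcoeff : q.coeff i = a i := by
    rw [hq, Polynomial.finsetSum_coeff, Finset.sum_eq_single i]
    · simp
    · intro j _ hj
      rw [Polynomial.coeff_monomial, if_neg]
      exact fun h => hj (Fin.ext h)
    · simp
  have hq0 : q ≠ 0 := fun h => hi (by rw [← hcoeff, h, Polynomial.coeff_zero])
  have hqd : q.natDegree ≤ d := Polynomial.natDegree_sum_le_of_forall_le _ _ fun j _ =>
    (Polynomial.natDegree_monomial_le _).trans (Nat.lt_succ_iff.mp j.2)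
  have hqt : Polynomial.aeval t q = 0 := by
    rw [hq, map_sum, ← ha]
    refine Finset.sum_congr rfl fun j _ => ?_
    rw [Polynomial.aeval_monomial, Algebra.smul_def]
  have hdvd := minpoly.isIntegrallyClosed_dvd hint hqt
  have hle := (Polynomial.natDegree_le_of_dvd hdvd hq0).trans hqd
  -- A linear relation among 1, t, …, tᵈ bounds the degree of the minimal polynomial, which divides
  -- any annihilating polynomial because A is integrally closed. The power of X pads the degree to
  -- exactly d.
  refine ⟨minpoly A t * Polynomial.X ^ (d - (minpoly A t).natDegree),
    (minpoly.monic hint).mul (Polynomial.monic_X_pow _), ?_, ?_⟩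
  · rw [(minpoly.monic hint).natDegree_mul (Polynomial.monic_X_pow _), Polynomial.natDegree_X_pow]
    omega
  · rw [map_mul, minpoly.aeval, zero_mul]

end IntegrallyClosed

/-! ### Quadratic divisors of a square. -/

section DvdSquare

open MvPolynomial

/-- A squarefree divisor of θ² divides θ. A quadratic form that is not squarefree has, by degrees,
only a constant left beside its square factor. -/
theorem MvPolynomial.dvd_or_eq_C_mul_sq {σ K : Type*} [Field K] {D E θ : MvPolynomial σ K}
    (hD : D.IsHomogeneous 2) (hD0 : D ≠ 0) (h : D * E = θ ^ 2) :
    D ∣ θ ∨ ∃ (c : K) (l : MvPolynomial σ K), D = C c * l ^ 2 := by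
  by_cases hsq : Squarefree D
  · exact Or.inl ((hsq.dvd_pow_iff_dvd two_ne_zero).mp ⟨E, h.symm⟩)
  · right
    rw [Squarefree] at hsq
    push Not at hsq
    obtain ⟨l, ⟨c, hc⟩, hl⟩ := hsq
    have hl0 : l ≠ 0 := by
      rintro rfl
      simp at hc
      exact hD0 hc
    have hc0 : c ≠ 0 := by
      rintro rfl
      simp at hc
      exact hD0 hc
    have hdeg := hD.totalDegree hD0
    rw [hc, totalDegree_mul_of_isDomain (mul_ne_zero hl0 hl0) hc0,
      totalDegree_mul_of_isDomain hl0 hl0] at hdeg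
    have hl1 : l.totalDegree ≠ 0 := by
      intro h0
      rw [totalDegree_eq_zero_iff_eq_C] at h0
      apply hl
      rw [h0] at hl0 ⊢
      refine (isUnit_iff_ne_zero.mpr ?_).map C
      rintro h1
      rw [h1, C_0] at hl0
      exact hl0 rfl
    have hc1 : c.totalDegree = 0 := by omega
    rw [totalDegree_eq_zero_iff_eq_C] at hc1
    exact ⟨_, l, by rw [← hc1, hc]; ring⟩

end DvdSquare

/-! ### Equations of x and y modulo a prime of small rank. -/

namespace NoetherCoordinates

open MvPolynomial

variable {K : Type*} [Field K] {m : ℕ} {I : Ideal (MvPolynomial (Fin (m + 1 + 1)) K)}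
  (N : NoetherCoordinates I)
  [Algebra (MvPolynomial (Fin m) K) (MvPolynomial (Fin (m + 1 + 1)) K)]

local notation "𝕊" => MvPolynomial (Fin (m + 1 + 1)) K
local notation "𝔸" => MvPolynomial (Fin m) K

theorem isTorsionFree_quotient {p : Ideal 𝕊} (hp : p.IsPrime)
    (hpA : ∀ a, algebraMap 𝔸 𝕊 a ∈ p → a = 0) : Module.IsTorsionFree 𝔸 (𝕊 ⧸ p) := by
  rw [Module.isTorsionFree_iff_algebraMap_injective, injective_iff_map_eq_zero]
  intro a ha
  exact hpA a (Ideal.Quotient.eq_zero_iff_mem.mp ha)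

variable [IsScalarTower K (MvPolynomial (Fin m) K) (MvPolynomial (Fin (m + 1 + 1)) K)]
  (hz : ∀ i, algebraMap (MvPolynomial (Fin m) K) (MvPolynomial (Fin (m + 1 + 1)) K) (X i) = N.z i)

include hz

theorem eval_algebraMap_eq_zero {u : Fin (m + 1 + 1) → K} (hu : ∀ i, eval u (N.z i) = 0)
    {a : 𝔸} (ha : a.IsHomogeneous 1) : eval u (algebraMap 𝔸 𝕊 a) = 0 := by
  have h : (eval u).comp (algebraMap 𝔸 𝕊) = eval (0 : Fin m → K) := by
    ext i
    · simp [← C_eq_algebraMap_C]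
    · simp [hz, hu]
  rw [← RingHom.comp_apply, h]
  exact ha.eval_zero_eq_zero one_ne_zero

/-- In rank 1 the class of f satisfies a monic equation of degree 1 over A; the degree 1 component
of that equation remains in p. -/
theorem exists_sub_algebraMap_mem {p : Ideal 𝕊} (hp : p.IsPrime) (hgr : IsGradedIdeal p)
    (hpA : ∀ a, algebraMap 𝔸 𝕊 a ∈ p → a = 0) [Module.Finite 𝔸 (𝕊 ⧸ p)]
    (hr : Module.finrank 𝔸 (𝕊 ⧸ p) ≤ 1) {f : 𝕊} (hf : f.IsHomogeneous 1) :
    ∃ a : 𝔸, a.IsHomogeneous 1 ∧ f - algebraMap 𝔸 𝕊 a ∈ p := by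
  have := isTorsionFree_quotient hp hpA
  obtain ⟨q, hq, hqd, hqf⟩ := exists_monic_natDegree_eq_aeval_eq_zero hr (Ideal.Quotient.mk p f)
  have h1 : algebraMap 𝔸 𝕊 (q.coeff 0) + f ∈ p := by
    rw [← Ideal.Quotient.eq_zero_iff_mem, ← hqf, Polynomial.aeval_eq_sum_range, hqd]
    have : q.coeff 1 = 1 := by rw [← hqd]; exact hq
    simp [Finset.sum_range_succ, this, Algebra.smul_def]
  have h2 := hgr _ h1 1
  rw [map_add, homogeneousComponent_of_mem hf, if_pos rfl,
    homogeneousComponent_algebraMap (fun i => hz i ▸ N.hz i)] at h2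
  refine ⟨-homogeneousComponent 1 (q.coeff 0), (homogeneousComponent_isHomogeneous _ _).neg, ?_⟩
  rw [map_neg, sub_neg_eq_add, add_comm f]
  exact h2

theorem exists_sq_sub_algebraMap_mem [CharZero K] {p : Ideal 𝕊} (hp : p.IsPrime)
    (hgr : IsGradedIdeal p)
    (hpA : ∀ a, algebraMap 𝔸 𝕊 a ∈ p → a = 0) [Module.Finite 𝔸 (𝕊 ⧸ p)]
    (hr : Module.finrank 𝔸 (𝕊 ⧸ p) ≤ 2) {f : 𝕊} (hf : f.IsHomogeneous 1) :
    ∃ a D : 𝔸, a.IsHomogeneous 1 ∧ D.IsHomogeneous 2 ∧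
      (f + algebraMap 𝔸 𝕊 a) ^ 2 - algebraMap 𝔸 𝕊 D ∈ p := by
  have := isTorsionFree_quotient hp hpA
  obtain ⟨q, hq, hqd, hqf⟩ := exists_monic_natDegree_eq_aeval_eq_zero hr (Ideal.Quotient.mk p f)
  have h1 : algebraMap 𝔸 𝕊 (q.coeff 0) + f * algebraMap 𝔸 𝕊 (q.coeff 1) + f ^ 2 ∈ p := by
    rw [← Ideal.Quotient.eq_zero_iff_mem, ← hqf, Polynomial.aeval_eq_sum_range, hqd]
    have : q.coeff 2 = 1 := by rw [← hqd]; exact hq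
    simp only [map_add, map_mul, map_pow, Finset.sum_range_succ, this, Algebra.smul_def,
      Finset.sum_range_zero, zero_add, map_one, one_mul, pow_zero, mul_one, pow_one]
    rw [mul_comm]
    rfl
  have h2 := hgr _ h1 2
  have hc : homogeneousComponent 2 (f * algebraMap 𝔸 𝕊 (q.coeff 1)) =
      f * algebraMap 𝔸 𝕊 (homogeneousComponent 1 (q.coeff 1)) := by
    rw [show 2 = 1 + 1 from rfl, hf.homogeneousComponent_mul,
      homogeneousComponent_algebraMap (fun i => hz i ▸ N.hz i)]
  rw [map_add, map_add, homogeneousComponent_of_mem (hf.pow 2), if_pos rfl, hc,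
    homogeneousComponent_algebraMap (fun i => hz i ▸ N.hz i)] at h2
  have h0 := homogeneousComponent_isHomogeneous 2 (q.coeff 0)
  have h1 := homogeneousComponent_isHomogeneous 1 (q.coeff 1)
  set a := homogeneousComponent 1 (q.coeff 1)
  set b := homogeneousComponent 2 (q.coeff 0)
  have hh : C (2⁻¹ : K) * a + C (2⁻¹ : K) * a = a := by
    rw [← add_mul, ← C_add, ← two_mul, mul_inv_cancel₀ two_ne_zero, C_1, one_mul]
  -- Completing the square in f² + a·f + b.
  refine ⟨C (2⁻¹ : K) * a, (C (2⁻¹ : K) * a) ^ 2 - b, h1.C_mul _, ((h1.C_mul _).pow 2).sub h0, ?_⟩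
  have hh' := congrArg (algebraMap 𝔸 𝕊) hh
  rw [map_add] at hh'
  rw [map_sub, map_pow]
  convert h2 using 1
  linear_combination f * hh'

end NoetherCoordinates

/-! ### Linear forms in graded primes of rank at most two. -/

namespace NoetherCoordinates

open MvPolynomial

variable {K : Type*} [Field K] {m : ℕ} {I : Ideal (MvPolynomial (Fin (m + 1 + 1)) K)}
  (N : NoetherCoordinates I)
  [Algebra (MvPolynomial (Fin m) K) (MvPolynomial (Fin (m + 1 + 1)) K)]
  [IsScalarTower K (MvPolynomial (Fin m) K) (MvPolynomial (Fin (m + 1 + 1)) K)]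
  (hz : ∀ i, algebraMap (MvPolynomial (Fin m) K) (MvPolynomial (Fin (m + 1 + 1)) K) (X i) = N.z i)

local notation "𝕊" => MvPolynomial (Fin (m + 1 + 1)) K
local notation "𝔸" => MvPolynomial (Fin m) K

/-- In rank at most 2 there is a relation a₀ + a₁x + a₂y = 0 in S/p. If a₁ or a₂ vanishes, D or E is
a square in the fraction field of A, hence in A. Otherwise squaring a₁x + a₂y = −a₀ expresses
2a₁a₂·xy in A, and integral closedness allows the division by 2a₁a₂. -/
theorem exists_mul_sub_algebraMap_mem [CharZero K] {p : Ideal 𝕊} (hp : p.IsPrime)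
    (hpA : ∀ a, algebraMap 𝔸 𝕊 a ∈ p → a = 0) [Module.Finite 𝔸 (𝕊 ⧸ p)]
    (hr : Module.finrank 𝔸 (𝕊 ⧸ p) ≤ 2) {x y : 𝕊}
    {D E : 𝔸} (hD : x ^ 2 - algebraMap 𝔸 𝕊 D ∈ p) (hE : y ^ 2 - algebraMap 𝔸 𝕊 E ∈ p) :
    (∃ e : 𝔸, D = e ^ 2) ∨ (∃ e : 𝔸, E = e ^ 2) ∨ ∃ θ : 𝔸, x * y - algebraMap 𝔸 𝕊 θ ∈ p := by
  have hdep : ¬ LinearIndependent 𝔸 ![(1 : 𝕊 ⧸ p), Ideal.Quotient.mk p x, Ideal.Quotient.mk p y] :=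
    fun h => by
      have := h.fintype_card_le_finrank
      rw [Fintype.card_fin] at this
      omega
  rw [Fintype.not_linearIndependent_iff] at hdep
  obtain ⟨a, ha, hane⟩ := hdep
  rw [Fin.sum_univ_three] at ha
  have h1 : algebraMap 𝔸 𝕊 (a 0) + algebraMap 𝔸 𝕊 (a 1) * x + algebraMap 𝔸 𝕊 (a 2) * y ∈ p := by
    have hmk : ∀ (c : 𝔸) (f : 𝕊), Ideal.Quotient.mk p (algebraMap 𝔸 𝕊 c * f) =
        c • Ideal.Quotient.mk p f := fun c f => by
      rw [← Algebra.smul_def]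
      rfl
    rw [← Ideal.Quotient.eq_zero_iff_mem, ← ha, ← mul_one (algebraMap 𝔸 𝕊 (a 0)), map_add, map_add,
      hmk, hmk, hmk, map_one]
    rfl
  have hsq : ∀ {b c D : 𝔸} {x : 𝕊}, x ^ 2 - algebraMap 𝔸 𝕊 D ∈ p → b ≠ 0 →
      algebraMap 𝔸 𝕊 c + algebraMap 𝔸 𝕊 b * x ∈ p → ∃ e : 𝔸, D = e ^ 2 := by
    intro b c D x hD hb h
    have h2 : b ^ 2 * D - c ^ 2 = 0 := by
      apply hpA
      have := p.sub_mem (p.mul_mem_left (algebraMap 𝔸 𝕊 b * x - algebraMap 𝔸 𝕊 c) h)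
        (p.mul_mem_left (algebraMap 𝔸 𝕊 b ^ 2) hD)
      convert this using 1
      simp only [map_sub, map_mul, map_pow]
      ring
    have h3 : b ^ 2 * D = c ^ 2 := sub_eq_zero.mp h2
    obtain ⟨e, rfl⟩ := (IsIntegrallyClosed.pow_dvd_pow_iff two_ne_zero).mp ⟨D, h3.symm⟩
    refine ⟨e, mul_left_cancel₀ (pow_ne_zero 2 hb) ?_⟩
    rw [h3]
    ring
  by_cases ha1 : a 1 = 0
  · by_cases ha2 : a 2 = 0
    · exfalso
      rw [ha1, ha2, map_zero, zero_mul, zero_mul, add_zero, add_zero] at h1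
      have ha0 := hpA _ h1
      obtain ⟨i, hi⟩ := hane
      fin_cases i
      exacts [hi ha0, hi ha1, hi ha2]
    · rw [ha1, map_zero, zero_mul, add_zero] at h1
      exact Or.inr (Or.inl (hsq hE ha2 h1))
  · by_cases ha2 : a 2 = 0
    · rw [ha2, map_zero, zero_mul, add_zero] at h1
      exact Or.inl (hsq hD ha1 h1)
    · right; right
      set γ := C (2 : K) * a 1 * a 2 with hγ
      have hγ0 : γ ≠ 0 := by
        refine mul_ne_zero (mul_ne_zero ?_ ha1) ha2
        rw [Ne, C_eq_zero]
        exact two_ne_zero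
      set δ := a 0 ^ 2 - a 1 ^ 2 * D - a 2 ^ 2 * E with hδ
      have h2 : algebraMap 𝔸 𝕊 γ * (x * y) - algebraMap 𝔸 𝕊 δ ∈ p := by
        have h3 := p.mul_mem_left
          (algebraMap 𝔸 𝕊 (a 1) * x + algebraMap 𝔸 𝕊 (a 2) * y - algebraMap 𝔸 𝕊 (a 0)) h1
        have h4 := p.mul_mem_left (algebraMap 𝔸 𝕊 (a 1) ^ 2) hD
        have h5 := p.mul_mem_left (algebraMap 𝔸 𝕊 (a 2) ^ 2) hE
        convert p.sub_mem h3 (p.add_mem h4 h5) using 1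
        rw [hγ, hδ]
        have h2 : (algebraMap 𝔸 𝕊) (C 2) = 2 := by
          rw [← C_eq_algebraMap_C, map_ofNat C 2]
        simp only [map_sub, map_mul, map_pow, h2]
        ring
      have h3 : γ ^ 2 * (D * E) - δ ^ 2 = 0 := by
        apply hpA
        have h4 := p.mul_mem_left (algebraMap 𝔸 𝕊 γ * (x * y) + algebraMap 𝔸 𝕊 δ) h2
        have h5 := p.mul_mem_left (algebraMap 𝔸 𝕊 γ ^ 2 * y ^ 2) hD
        have h6 := p.mul_mem_left (algebraMap 𝔸 𝕊 γ ^ 2 * algebraMap 𝔸 𝕊 D) hE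
        convert p.sub_mem h4 (p.add_mem h5 h6) using 1
        simp only [map_sub, map_mul, map_pow]
        ring
      obtain ⟨θ, hθ⟩ := (IsIntegrallyClosed.pow_dvd_pow_iff two_ne_zero).mp ⟨D * E, (sub_eq_zero.mp h3).symm⟩
      refine ⟨θ, (hp.mem_or_mem (x := algebraMap 𝔸 𝕊 γ) ?_).resolve_left fun h => hγ0 (hpA _ h)⟩
      rw [hθ] at h2
      convert h2 using 1
      simp only [map_mul]
      ring

include hz

/-- If a linear form is modulo `p` a square root of a scalar multiple of a square in `A`, then
`p` contains a linear form with the same value at a common zero of the `zᵢ`. -/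
theorem exists_linear_mem_of_sq_sub_mem [IsAlgClosed K] {p : Ideal 𝕊} (hp : p.IsPrime)
    (hgr : IsGradedIdeal p) {f : 𝕊} (hf : f.IsHomogeneous 1) {c : K} {l : 𝔸}
    (h : f ^ 2 - algebraMap 𝔸 𝕊 (C c * l ^ 2) ∈ p) :
    ∃ g ∈ p, g.IsHomogeneous 1 ∧
      ∀ u : Fin (m + 1 + 1) → K, (∀ i, eval u (N.z i) = 0) → eval u g = eval u f := by
  have hlin : ∀ a : 𝔸, f - algebraMap 𝔸 𝕊 a ∈ p → ∃ g ∈ p, g.IsHomogeneous 1 ∧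
      ∀ u : Fin (m + 1 + 1) → K, (∀ i, eval u (N.z i) = 0) → eval u g = eval u f := by
    intro a ha
    have h1 := hgr _ ha 1
    have hz1 : ∀ i, (algebraMap 𝔸 𝕊 (X i)).IsHomogeneous 1 := fun i => hz i ▸ N.hz i
    rw [map_sub, homogeneousComponent_of_mem hf, if_pos rfl,
      homogeneousComponent_algebraMap hz1] at h1
    have ha1 := homogeneousComponent_isHomogeneous 1 a
    refine ⟨_, h1, hf.sub (isHomogeneous_algebraMap hz1 ha1), fun u hu => ?_⟩
    rw [map_sub, N.eval_algebraMap_eq_zero hz hu ha1, sub_zero]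
  obtain ⟨s, hs⟩ := IsAlgClosed.exists_pow_nat_eq c (n := 2) zero_lt_two
  -- With s² = c the difference of squares factors, and p contains one of the factors.
  have h1 : (f - algebraMap 𝔸 𝕊 (C s * l)) * (f - algebraMap 𝔸 𝕊 (-(C s * l))) ∈ p := by
    convert h using 1
    rw [← hs]
    simp only [map_neg, map_mul, map_pow]
    ring
  rcases hp.mem_or_mem h1 with h | h
  exacts [hlin _ h, hlin _ h]

/-- A graded prime `p` with `S/p` of rank at most two over `A` contains a nonzero linear form. -/
theorem exists_linear_mem [IsAlgClosed K] [CharZero K] {p : Ideal 𝕊} (hp : p.IsPrime)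
    (hgr : IsGradedIdeal p)
    (hpA : ∀ a, algebraMap 𝔸 𝕊 a ∈ p → a = 0) [Module.Finite 𝔸 (𝕊 ⧸ p)]
    (hr : Module.finrank 𝔸 (𝕊 ⧸ p) ≤ 2) : ∃ g ∈ p, g.IsHomogeneous 1 ∧ g ≠ 0 := by
  have hz1 : ∀ i, (algebraMap 𝔸 𝕊 (X i)).IsHomogeneous 1 := fun i => hz i ▸ N.hz i
  obtain ⟨a, D, ha, hDh, hD⟩ := N.exists_sq_sub_algebraMap_mem hz hp hgr hpA hr N.hx
  obtain ⟨b, E, hb, hEh, hE⟩ := N.exists_sq_sub_algebraMap_mem hz hp hgr hpA hr N.hy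
  have hx := N.hx.add (isHomogeneous_algebraMap hz1 ha)
  have hy := N.hy.add (isHomogeneous_algebraMap hz1 hb)
  have hvx : eval N.v (N.x + algebraMap 𝔸 𝕊 a) = 1 := by
    rw [map_add, N.vx, N.eval_algebraMap_eq_zero hz N.vz ha, add_zero]
  have hwx : eval N.w (N.x + algebraMap 𝔸 𝕊 a) = 0 := by
    rw [map_add, N.wx, N.eval_algebraMap_eq_zero hz N.wz ha, add_zero]
  have hwy : eval N.w (N.y + algebraMap 𝔸 𝕊 b) = 1 := by
    rw [map_add, N.wy, N.eval_algebraMap_eq_zero hz N.wz hb, add_zero]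
  set x := N.x + algebraMap 𝔸 𝕊 a
  set y := N.y + algebraMap 𝔸 𝕊 b
  -- The linear forms found below are nonzero because their value at v or w is 1: forms in the zᵢ
  -- vanish at both points.
  have hxD : ∀ (c : K) (l : 𝔸), D = C c * l ^ 2 → ∃ g ∈ p, g.IsHomogeneous 1 ∧ g ≠ 0 := by
    rintro c l rfl
    obtain ⟨g, hg, hg1, hgu⟩ := N.exists_linear_mem_of_sq_sub_mem hz hp hgr hx hD
    refine ⟨g, hg, hg1, ?_⟩
    rintro rfl
    have := hgu N.v N.vz
    rw [hvx, map_zero] at this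
    exact zero_ne_one this
  rcases exists_mul_sub_algebraMap_mem hp hpA hr hD hE with
    ⟨e, he⟩ | ⟨e, rfl⟩ | ⟨θ, hθ⟩
  · exact hxD 1 e (by rw [he, C_1, one_mul])
  · obtain ⟨g, hg, hg1, hgu⟩ := N.exists_linear_mem_of_sq_sub_mem hz hp hgr hy (c := 1) (l := e)
      (by rw [C_1, one_mul]; exact hE)
    refine ⟨g, hg, hg1, ?_⟩
    rintro rfl
    have := hgu N.w N.wz
    rw [hwy, map_zero] at this
    exact zero_ne_one this
  · by_cases hD0 : D = 0
    · exact hxD 0 0 (by rw [hD0, C_0, zero_mul])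
    have hDE : D * E = θ ^ 2 := by
      apply sub_eq_zero.mp
      apply hpA
      have h4 := p.mul_mem_left (x * y + algebraMap 𝔸 𝕊 θ) hθ
      have h5 := p.mul_mem_left (y ^ 2) hD
      have h6 := p.mul_mem_left (algebraMap 𝔸 𝕊 D) hE
      convert p.sub_mem h4 (p.add_mem h5 h6) using 1
      simp only [map_sub, map_mul, map_pow]
      ring
    rcases dvd_or_eq_C_mul_sq hDh hD0 hDE with ⟨c, hc⟩ | ⟨c, l, hl⟩
    -- With θ = c·D, the relation xy ≡ θ ≡ c·x² factors.
    · have h1 : x * (y - algebraMap 𝔸 𝕊 c * x) ∈ p := by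
        convert p.sub_mem hθ (p.mul_mem_left (algebraMap 𝔸 𝕊 c) hD) using 1
        rw [hc]
        simp only [map_mul]
        ring
      rcases hp.mem_or_mem h1 with h1 | h1
      · refine ⟨x, h1, hx, ?_⟩
        intro h
        rw [h, map_zero] at hvx
        exact zero_ne_one hvx
      -- The quotient c need not be homogeneous, so only its constant term is kept, by passing to
      -- degree 1.
      · have h2 := hgr _ h1 1
        have h3 : homogeneousComponent 1 (algebraMap 𝔸 𝕊 c * x) = C (coeff 0 c) * x := by
          have h4 := hx.homogeneousComponent_mul (algebraMap 𝔸 𝕊 c) 0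
          rw [zero_add] at h4
          rw [mul_comm, h4, homogeneousComponent_algebraMap hz1, homogeneousComponent_zero,
            ← C_eq_algebraMap_C, mul_comm]
        rw [map_sub, homogeneousComponent_of_mem hy, if_pos rfl, h3] at h2
        refine ⟨_, h2, hy.sub (hx.C_mul _), fun h => ?_⟩
        have := congrArg (eval N.w) h
        rw [map_sub, hwy, map_mul, hwx, mul_zero, sub_zero, map_zero] at this
        exact one_ne_zero this
    · exact hxD c l hl

/-- Modulo p both x and y are congruent to linear forms a, b of A. Modulo J = (x − a, y − b) every
polynomial comes from A, and p meets A in 0, so nothing lies between J and p. -/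
theorem isLinearPrime_of_finrank_le_one {p : Ideal 𝕊} (hp : p.IsPrime) (hgr : IsGradedIdeal p)
    (hpA : ∀ a, algebraMap 𝔸 𝕊 a ∈ p → a = 0) [Module.Finite 𝔸 (𝕊 ⧸ p)]
    (hr : Module.finrank 𝔸 (𝕊 ⧸ p) ≤ 1) : IsLinearPrime p := by
  have hz1 : ∀ i, (algebraMap 𝔸 𝕊 (X i)).IsHomogeneous 1 := fun i => hz i ▸ N.hz i
  obtain ⟨a, ha, hxa⟩ := N.exists_sub_algebraMap_mem hz hp hgr hpA hr N.hx
  obtain ⟨b, hb, hyb⟩ := N.exists_sub_algebraMap_mem hz hp hgr hpA hr N.hy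
  refine ⟨N.x - algebraMap 𝔸 𝕊 a, N.y - algebraMap 𝔸 𝕊 b,
    N.hx.sub (isHomogeneous_algebraMap hz1 ha), N.hy.sub (isHomogeneous_algebraMap hz1 hb), ?_, ?_⟩
  · rw [LinearIndependent.pair_iff]
    intro s t h
    have h1 := congrArg (eval N.v) h
    have h2 := congrArg (eval N.w) h
    simp only [map_add, smul_eval, map_sub, N.vx, N.vy, N.wx, N.wy, map_zero,
      N.eval_algebraMap_eq_zero hz N.vz ha, N.eval_algebraMap_eq_zero hz N.vz hb,
      N.eval_algebraMap_eq_zero hz N.wz ha, N.eval_algebraMap_eq_zero hz N.wz hb] at h1 h2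
    constructor
    · linear_combination h1
    · linear_combination h2
  · set J := Ideal.span {N.x - algebraMap 𝔸 𝕊 a, N.y - algebraMap 𝔸 𝕊 b} with hJ
    have hJp : J ≤ p := by
      rw [hJ, Ideal.span_le]
      rintro _ (rfl | rfl)
      exacts [hxa, hyb]
    have hlin : ∀ l ∈ Submodule.span K (insert N.x (insert N.y (Set.range N.z))),
        ∃ c : 𝔸, l - algebraMap 𝔸 𝕊 c ∈ J := by
      intro l hl
      induction hl using Submodule.span_induction with
      | mem u hu =>
        rcases hu with rfl | rfl | ⟨i, rfl⟩
        · exact ⟨a, Ideal.subset_span (Or.inl rfl)⟩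
        · exact ⟨b, Ideal.subset_span (Or.inr rfl)⟩
        · exact ⟨X i, by rw [hz, sub_self]; exact J.zero_mem⟩
      | zero => exact ⟨0, by simp⟩
      | add f g _ _ hf hg =>
        obtain ⟨c, hc⟩ := hf
        obtain ⟨d, hd⟩ := hg
        refine ⟨c + d, ?_⟩
        convert J.add_mem hc hd using 1
        rw [map_add]
        ring
      | smul r f _ hf =>
        obtain ⟨c, hc⟩ := hf
        refine ⟨C r * c, ?_⟩
        convert J.mul_mem_left (C r) hc using 1
        rw [map_mul, ← C_eq_algebraMap_C, smul_eq_C_mul, mul_sub]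
    have hall : ∀ f : 𝕊, ∃ c : 𝔸, f - algebraMap 𝔸 𝕊 c ∈ J := by
      intro f
      induction f using MvPolynomial.induction_on with
      | C r => exact ⟨C r, by rw [← C_eq_algebraMap_C, sub_self]; exact J.zero_mem⟩
      | add f g hf hg =>
        obtain ⟨c, hc⟩ := hf
        obtain ⟨d, hd⟩ := hg
        refine ⟨c + d, ?_⟩
        convert J.add_mem hc hd using 1
        rw [map_add]
        ring
      | mul_X f i hf =>
        obtain ⟨c, hc⟩ := hf
        obtain ⟨d, hd⟩ := hlin _ (N.X_mem i)
        refine ⟨c * d, ?_⟩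
        convert J.add_mem (J.mul_mem_left (X i) hc) (J.mul_mem_left (algebraMap 𝔸 𝕊 c) hd) using 1
        rw [map_mul]
        ring
    refine le_antisymm (fun f hf => ?_) hJp
    obtain ⟨c, hc⟩ := hall f
    have hcp : algebraMap 𝔸 𝕊 c ∈ p := by
      have := p.sub_mem hf (hJp hc)
      rwa [sub_sub_cancel] at this
    rw [hpA c hcp, map_zero, sub_zero] at hc
    exact hc

end NoetherCoordinates

/-! ### Eliminating a variable and the shape of primes containing a linear form. -/

section Elimination

open MvPolynomial

variable {K : Type*} [Field K] {n : ℕ}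

theorem MvPolynomial.exists_elimination {l : MvPolynomial (Fin (n + 1)) K} (hl : l.IsHomogeneous 1)
    (hl0 : l ≠ 0) :
    ∃ (π : MvPolynomial (Fin (n + 1)) K →ₐ[K] MvPolynomial (Fin n) K)
      (ι : MvPolynomial (Fin n) K →ₐ[K] MvPolynomial (Fin (n + 1)) K),
      (∀ i, (π (X i)).IsHomogeneous 1) ∧ (∀ i, (ι (X i)).IsHomogeneous 1) ∧
      (∀ g, π (ι g) = g) ∧ ∀ f, π f = 0 ↔ l ∣ f := by
  have hspan : l ∈ Submodule.span K (Set.range (X : Fin (n + 1) → MvPolynomial (Fin (n + 1)) K)) := by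
    rwa [← homogeneousSubmodule_one_eq_span_X, mem_homogeneousSubmodule]
  obtain ⟨c, hc⟩ := (Submodule.mem_span_range_iff_exists_fun K).mp hspan
  obtain ⟨j, hj⟩ : ∃ j, c j ≠ 0 := by
    by_contra! h
    exact hl0 (by rw [← hc]; simp [h])
  rw [Fin.sum_univ_succAbove _ j] at hc
  -- The equation l = 0 solved for the variable X j, whose coefficient in l is nonzero.
  let t : MvPolynomial (Fin n) K := C (-(c j)⁻¹) * ∑ i, c (j.succAbove i) • X i
  let π : MvPolynomial (Fin (n + 1)) K →ₐ[K] MvPolynomial (Fin n) K := aeval (j.insertNth t X)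
  let ι : MvPolynomial (Fin n) K →ₐ[K] MvPolynomial (Fin (n + 1)) K :=
    aeval fun i => X (j.succAbove i)
  have hπj : π (X j) = t := by simp [π]
  have hπs : ∀ i, π (X (j.succAbove i)) = X i := fun i => by simp [π]
  have hι : ∀ i, ι (X i) = X (j.succAbove i) := fun i => by simp [ι]
  have ht : t.IsHomogeneous 1 := by
    refine IsHomogeneous.C_mul (IsHomogeneous.sum _ _ _ fun i _ => ?_) _
    rw [smul_eq_C_mul]
    exact (isHomogeneous_X K i).C_mul _
  have hcc : C (c j) * C (-(c j)⁻¹) = (-1 : MvPolynomial (Fin n) K) := by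
    rw [← C_mul, mul_neg, mul_inv_cancel₀ hj, C_neg, C_1]
  have hcc' : C (c j) * C (-(c j)⁻¹) = (-1 : MvPolynomial (Fin (n + 1)) K) := by
    rw [← C_mul, mul_neg, mul_inv_cancel₀ hj, C_neg, C_1]
  have hπι : ∀ g, π (ι g) = g := fun g => by
    have : π.comp ι = AlgHom.id K _ := by
      ext i : 1
      simp [hι, hπs]
    exact DFunLike.congr_fun this g
  have hπl : π l = 0 := by
    rw [← hc, map_add, map_sum, map_smul, hπj, smul_eq_C_mul]
    simp only [map_smul, hπs, t]
    rw [← mul_assoc, hcc]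
    ring
  have hmod : ∀ f, f - ι (π f) ∈ Ideal.span {l} := fun f => by
    have : (Ideal.Quotient.mkₐ K (Ideal.span {l})).comp (ι.comp π) =
        Ideal.Quotient.mkₐ K (Ideal.span {l}) := by
      ext i : 1
      rw [AlgHom.comp_apply, AlgHom.comp_apply]
      rcases Fin.eq_self_or_eq_succAbove j i with rfl | ⟨i, rfl⟩
      · rw [hπj]
        refine Ideal.Quotient.eq.mpr (Ideal.mem_span_singleton.mpr ⟨C (-(c i)⁻¹), ?_⟩)
        rw [← hc]
        simp only [t, map_mul, map_sum, map_smul, hι]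
        rw [show ι (C (-(c i)⁻¹)) = C (-(c i)⁻¹) from ι.commutes _, smul_eq_C_mul]
        linear_combination (-X i) * hcc'
      · rw [hπs, hι]
    exact Ideal.Quotient.eq.mp (DFunLike.congr_fun this f).symm
  refine ⟨π, ι, fun i => ?_, fun i => ?_, hπι, fun f => ⟨fun h => ?_, ?_⟩⟩
  · rcases Fin.eq_self_or_eq_succAbove j i with rfl | ⟨i, rfl⟩
    · rw [hπj]
      exact ht
    · rw [hπs]
      exact isHomogeneous_X K i
  · rw [hι]
    exact isHomogeneous_X K _
  · have := hmod f
    rwa [h, map_zero, sub_zero, Ideal.mem_span_singleton] at this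
  · rintro ⟨g, rfl⟩
    rw [map_mul, hπl, zero_mul]

theorem MvPolynomial.isUnit_of_totalDegree_eq_zero {f : MvPolynomial (Fin n) K} (hf0 : f ≠ 0)
    (hf : f.totalDegree = 0) : IsUnit f := by
  rw [totalDegree_eq_zero_iff_eq_C] at hf
  rw [hf] at hf0 ⊢
  exact (isUnit_iff_ne_zero.mpr fun h => hf0 (by rw [h, C_0])).map C

theorem MvPolynomial.IsHomogeneous.irreducible {f : MvPolynomial (Fin n) K} (hf : f.IsHomogeneous 1)
    (hf0 : f ≠ 0) : Irreducible f := by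
  refine ⟨hf.not_isUnit one_ne_zero, ?_⟩
  rintro a b rfl
  obtain ⟨ha0, hb0⟩ := mul_ne_zero_iff.mp hf0
  have hdeg := hf.totalDegree hf0
  rw [totalDegree_mul_of_isDomain ha0 hb0] at hdeg
  rcases Nat.eq_zero_or_pos a.totalDegree with h | h
  · exact Or.inl (isUnit_of_totalDegree_eq_zero ha0 h)
  · exact Or.inr (isUnit_of_totalDegree_eq_zero hb0 (by omega))

/-- A prime that is minimal over an ideal with two generators and contains a linear form `l` is
generated by `l` and any of its elements that is irreducible modulo `l`. -/
theorem eq_span_pair_of_irreducible {l Q₁ Q₂ : MvPolynomial (Fin (n + 1)) K}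
    (hl0 : l ≠ 0) {p : Ideal (MvPolynomial (Fin (n + 1)) K)}
    (hp : p ∈ (Ideal.span {Q₁, Q₂}).minimalPrimes) (hlp : l ∈ p)
    (π : MvPolynomial (Fin (n + 1)) K →ₐ[K] MvPolynomial (Fin n) K)
    (ι : MvPolynomial (Fin n) K →ₐ[K] MvPolynomial (Fin (n + 1)) K)
    (hπι : ∀ g, π (ι g) = g) (hker : ∀ f, π f = 0 ↔ l ∣ f) {G : MvPolynomial (Fin (n + 1)) K}
    (hG : G ∈ p) (hirr : Irreducible (π G)) : p = Ideal.span {l, G} := by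
  have hprime : (Ideal.span {π G}).IsPrime :=
    (Ideal.span_singleton_prime hirr.ne_zero).mpr hirr.prime
  have hP : Ideal.comap π (Ideal.span {π G}) = Ideal.span {l, G} := by
    apply le_antisymm
    · intro f hf
      obtain ⟨h, hh⟩ := Ideal.mem_span_singleton.mp (Ideal.mem_comap.mp hf)
      have h1 : π (f - G * ι h) = 0 := by rw [map_sub, map_mul, hπι, hh, sub_self]
      obtain ⟨k, hk⟩ := (hker _).mp h1
      exact Ideal.mem_span_pair.mpr ⟨k, ι h, by linear_combination -hk⟩
    · rw [Ideal.span_le]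
      rintro _ (rfl | rfl)
      · rw [SetLike.mem_coe, Ideal.mem_comap, (hker _).mpr dvd_rfl]
        exact Ideal.zero_mem _
      · exact Ideal.mem_span_singleton_self _
  have hPprime : (Ideal.span {l, G}).IsPrime := hP ▸ Ideal.comap_isPrime π _
  have hLprime : (Ideal.span {l}).IsPrime := by
    have h : Ideal.comap π ⊥ = Ideal.span {l} := by
      ext f
      rw [Ideal.mem_comap, Ideal.mem_bot, hker, Ideal.mem_span_singleton]
    exact h ▸ Ideal.comap_isPrime π _
  have hp' := hp.1.1
  have hle : Ideal.span {l, G} ≤ p := by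
    rw [Ideal.span_le]
    rintro _ (rfl | rfl)
    exacts [hlp, hG]
  by_contra hne
  -- If p were larger, 0 ⊂ (l) ⊂ (l, G) ⊂ p would give height at least 3, whereas Krull's theorem
  -- bounds the height of a minimal prime of a two-generated ideal by 2.
  have h1 := Ideal.height_add_one_le_of_lt_of_isPrime (lt_of_le_of_ne hle (Ne.symm hne))
  have h2 := Ideal.height_add_one_le_of_lt_of_isPrime (I := Ideal.span {l}) (J := Ideal.span {l, G})
    (lt_of_le_of_ne (Ideal.span_mono (by simp)) fun h => hirr.ne_zero ((hker G).mpr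
      (Ideal.mem_span_singleton.mp (h ▸ Ideal.subset_span (Or.inr rfl)))))
  have h3 := Ideal.height_add_one_le_of_lt_of_isPrime (I := ⊥) (J := Ideal.span {l})
    (bot_lt_iff_ne_bot.mpr fun h => hl0 (Ideal.span_singleton_eq_bot.mp h))
  classical
  have h4 : p.height ≤ 2 := by
    have h := Ideal.height_le_card_of_mem_minimalPrimes_span_finset (s := {Q₁, Q₂}) (p := p)
      (by simpa using hp)
    exact h.trans (by exact_mod_cast Finset.card_le_two)
  have h5 : (3 : ℕ∞) ≤ p.height := by
    calc (3 : ℕ∞) = 0 + 1 + 1 + 1 := by norm_num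
      _ ≤ _ := by gcongr; exact zero_le
      _ ≤ _ := add_le_add_left (add_le_add_left h3 1) 1
      _ ≤ _ := add_le_add_left h2 1
      _ ≤ _ := h1
  exact absurd (h5.trans h4) (by norm_num)

/-- Coprimality provides a quadric Q among Q₁, Q₂ that l does not divide. Modulo l it is either
irreducible, or a product of two degree 1 factors, one of which lies in p. -/
theorem isLinearPrime_or_isQuadraticPrime {Q₁ Q₂ : MvPolynomial (Fin (n + 1)) K}
    (hQ₁ : Q₁.IsHomogeneous 2) (hQ₂ : Q₂.IsHomogeneous 2) (hcop : IsRelPrime Q₁ Q₂)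
    {p : Ideal (MvPolynomial (Fin (n + 1)) K)}
    (hp : p ∈ (Ideal.span {Q₁, Q₂}).minimalPrimes) (hgr : IsGradedIdeal p)
    {l : MvPolynomial (Fin (n + 1)) K} (hl : l.IsHomogeneous 1) (hl0 : l ≠ 0) (hlp : l ∈ p) :
    IsLinearPrime p ∨ IsQuadraticPrime p := by
  obtain ⟨π, ι, hπ, hι, hπι, hker⟩ := exists_elimination hl hl0
  have hp' := hp.1.1
  obtain ⟨Q, hQ, hQp, hlQ⟩ : ∃ Q : MvPolynomial (Fin (n + 1)) K, Q.IsHomogeneous 2 ∧ Q ∈ p ∧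
      ¬ l ∣ Q := by
    by_contra! h
    exact hl.not_isUnit one_ne_zero (hcop (h Q₁ hQ₁ (hp.1.2 (Ideal.subset_span (Or.inl rfl))))
      (h Q₂ hQ₂ (hp.1.2 (Ideal.subset_span (Or.inr rfl)))))
  have hπh : ∀ {f d}, f.IsHomogeneous d → (π f).IsHomogeneous d := by
    intro f d hf
    have h := hf.aeval _ hπ
    rw [one_mul] at h
    convert h using 1
    exact DFunLike.congr_fun (aeval_unique π) f
  have hιh : ∀ {f d}, f.IsHomogeneous d → (ι f).IsHomogeneous d := by
    intro f d hf
    have h := hf.aeval _ hι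
    rw [one_mul] at h
    convert h using 1
    exact DFunLike.congr_fun (aeval_unique ι) f
  have hπQ0 : π Q ≠ 0 := fun h => hlQ ((hker Q).mp h)
  by_cases hirr : Irreducible (π Q)
  · right
    refine ⟨l, Q, hl, hl0, hQ, ?_, eq_span_pair_of_irreducible hl0 hp hlp π ι hπι hker hQp hirr⟩
    have hsurj : Function.Surjective π.toRingHom := fun g => ⟨ι g, hπι g⟩
    have hk : RingHom.ker π.toRingHom = Ideal.span {l} := by
      ext f
      rw [RingHom.mem_ker, Ideal.mem_span_singleton]
      exact hker f
    exact (MulEquiv.irreducible_iff ((Ideal.quotEquivOfEq hk.symm).trans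
      (RingHom.quotientKerEquivOfSurjective hsurj))).mp hirr
  · left
    -- The factors of π Q are only known to have total degree 1. Since p is graded, the linear
    -- component of the factor can be used instead.
    have hlin : ∀ a, a.totalDegree = 1 → ι a ∈ p → IsLinearPrime p := by
      intro a ha hap
      have hsum := sum_homogeneousComponent a
      rw [ha, Finset.sum_range_succ, Finset.sum_range_one] at hsum
      have h0 := homogeneousComponent_isHomogeneous 0 a
      have h1 := homogeneousComponent_isHomogeneous 1 a
      set a₀ := homogeneousComponent 0 a
      set a₁ := homogeneousComponent 1 a
      have ha₁ : a₁ ≠ 0 := fun h => by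
        rw [← hsum, h, add_zero] at ha
        have := h0.totalDegree_le
        omega
      have h2 := hgr _ hap 1
      rw [← hsum, map_add, map_add, homogeneousComponent_of_mem (hιh h0),
        homogeneousComponent_of_mem (hιh h1), if_pos rfl, if_neg one_ne_zero, zero_add] at h2
      refine ⟨l, ι a₁, hl, hιh h1, ?_, eq_span_pair_of_irreducible hl0 hp hlp π ι hπι hker h2 ?_⟩
      · rw [LinearIndependent.pair_iff]
        intro s t hst
        have h3 := congrArg π hst
        rw [map_add, map_smul, map_smul, hπι, (hker l).mpr dvd_rfl, smul_zero, zero_add,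
          map_zero] at h3
        have ht := (smul_eq_zero.mp h3).resolve_right ha₁
        rw [ht, zero_smul, add_zero] at hst
        exact ⟨(smul_eq_zero.mp hst).resolve_right hl0, ht⟩
      · rw [hπι]
        exact h1.irreducible ha₁
    have hnu := (hπh hQ).not_isUnit two_ne_zero
    rw [irreducible_iff] at hirr
    push Not at hirr
    obtain ⟨a, b, hab, ha, hb⟩ := hirr hnu
    obtain ⟨ha0, hb0⟩ := mul_ne_zero_iff.mp (hab ▸ hπQ0)
    have hdeg := (hπh hQ).totalDegree hπQ0
    rw [hab, totalDegree_mul_of_isDomain ha0 hb0] at hdeg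
    have hda : a.totalDegree ≠ 0 := fun h => ha (isUnit_of_totalDegree_eq_zero ha0 h)
    have hdb : b.totalDegree ≠ 0 := fun h => hb (isUnit_of_totalDegree_eq_zero hb0 h)
    have hmem : ι a * ι b ∈ p := by
      obtain ⟨k, hk⟩ := (hker (Q - ι a * ι b)).mp (by
        rw [map_sub, map_mul, hπι, hπι, hab, sub_self])
      have := p.sub_mem hQp (p.mul_mem_right k hlp)
      rwa [← hk, sub_sub_cancel] at this
    rcases hp'.mem_or_mem hmem with h | h
    · exact hlin a (by omega) h
    · exact hlin b (by omega) h

end Elimination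

/-! ### Gradedness of minimal primes and of primary components. -/

section GradedPrimary

open MvPolynomial

variable {σ K : Type*} [Field K]

/-- The substitution `Xᵢ ↦ 2 Xᵢ`. -/
noncomputable def doubleVars (σ K : Type*) [Field K] : MvPolynomial σ K →ₐ[K] MvPolynomial σ K :=
  aeval fun i => C 2 * X i

theorem doubleVars_of_isHomogeneous {f : MvPolynomial σ K} {k : ℕ} (hf : f.IsHomogeneous k) :
    doubleVars σ K f = C (2 ^ k) * f := by
  classical
  have hmon : ∀ (d : σ →₀ ℕ) (a : K), d.degree = k →
      doubleVars σ K (monomial d a) = C (2 ^ k) * monomial d a := by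
    intro d a hd
    have h2 : (C (2 ^ k) : MvPolynomial σ K) = ∏ x ∈ d.support, C 2 ^ d x := by
      rw [Finset.prod_pow_eq_pow_sum, ← map_pow, ← hd]
      rfl
    rw [doubleVars, aeval_monomial, monomial_eq, Finsupp.prod, Finsupp.prod, h2, algebraMap_eq]
    simp only [mul_pow, Finset.prod_mul_distrib]
    ring
  rw [f.as_sum, map_sum, Finset.mul_sum]
  refine Finset.sum_congr rfl fun d hd => hmon d _ ?_
  by_contra h
  exact mem_support_iff.mp hd (hf.coeff_eq_zero h)

theorem homogeneousComponent_doubleVars (f : MvPolynomial σ K) (k : ℕ) :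
    homogeneousComponent k (doubleVars σ K f) = C (2 ^ k) * homogeneousComponent k f := by
  conv_lhs => rw [← sum_homogeneousComponent f, map_sum, map_sum]
  have h : ∀ i ∈ Finset.range (f.totalDegree + 1), homogeneousComponent k
      (doubleVars σ K (homogeneousComponent i f)) =
        if i = k then C (2 ^ k) * homogeneousComponent k f else 0 := fun i _ => by
    rw [doubleVars_of_isHomogeneous (homogeneousComponent_isHomogeneous i f),
      homogeneousComponent_C_mul,
      homogeneousComponent_of_mem (homogeneousComponent_isHomogeneous i f)]
    by_cases hik : i = k
    · rw [if_pos hik.symm, if_pos hik, hik]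
    · rw [if_neg (Ne.symm hik), if_neg hik, mul_zero]
  rw [Finset.sum_congr rfl h, Finset.sum_ite_eq']
  split_ifs with hk
  · rfl
  · rw [homogeneousComponent_eq_zero, mul_zero]
    simpa using hk

theorem IsGradedIdeal.mem_of_forall {J : Ideal (MvPolynomial σ K)} {f : MvPolynomial σ K}
    (h : ∀ k, homogeneousComponent k f ∈ J) : f ∈ J := by
  rw [← sum_homogeneousComponent f]
  exact J.sum_mem fun k _ => h k

theorem IsGradedIdeal.doubleVars_mem_iff [CharZero K] {J : Ideal (MvPolynomial σ K)}
    (hJ : IsGradedIdeal J) {f : MvPolynomial σ K} : doubleVars σ K f ∈ J ↔ f ∈ J := by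
  constructor
  · refine fun h => IsGradedIdeal.mem_of_forall fun k => ?_
    have h1 := J.mul_mem_left (C (2 ^ k)⁻¹) (hJ _ h k)
    rwa [homogeneousComponent_doubleVars, ← mul_assoc, ← C_mul,
      inv_mul_cancel₀ (pow_ne_zero k two_ne_zero), C_1, one_mul] at h1
  · refine fun h => IsGradedIdeal.mem_of_forall fun k => ?_
    rw [homogeneousComponent_doubleVars]
    exact J.mul_mem_left _ (hJ _ h k)

/-- Scaling by 2 acts on degree k as 2ᵏ, and these eigenvalues are distinct in characteristic zero.
Subtracting 2ᴺ times the identity kills the top component, and induction separates the rest. -/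
theorem isGradedIdeal_of_doubleVars_mem [CharZero K] {J : Ideal (MvPolynomial σ K)}
    (hJ : ∀ f ∈ J, doubleVars σ K f ∈ J) : IsGradedIdeal J := by
  have key : ∀ (N : ℕ) (g : ℕ → MvPolynomial σ K), (∀ k, (g k).IsHomogeneous k) →
      ∑ k ∈ Finset.range N, g k ∈ J → ∀ k < N, g k ∈ J := by
    intro N
    induction N with
    | zero => exact fun g _ _ k hk => absurd hk (Nat.not_lt_zero k)
    | succ N ih =>
      intro g hg hsum
      have h1 : ∑ k ∈ Finset.range N, C ((2 : K) ^ k - 2 ^ N) * g k ∈ J := by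
        have h2 := J.sub_mem (hJ _ hsum) (J.mul_mem_left (C (2 ^ N)) hsum)
        rw [map_sum, Finset.mul_sum, ← Finset.sum_sub_distrib, Finset.sum_range_succ,
          doubleVars_of_isHomogeneous (hg N), sub_self, add_zero] at h2
        convert h2 using 2 with k _
        rw [doubleVars_of_isHomogeneous (hg k), C_sub, sub_mul]
      have h2 : ∀ k < N, g k ∈ J := by
        intro k hk
        have h3 := J.mul_mem_left (C ((2 : K) ^ k - 2 ^ N)⁻¹)
          (ih _ (fun k => (hg k).C_mul _) h1 k hk)
        have h4 : (2 : K) ^ k - 2 ^ N ≠ 0 := by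
          rw [sub_ne_zero]
          intro h
          exact hk.ne (Nat.pow_right_injective le_rfl (by exact_mod_cast h))
        rwa [← mul_assoc, ← C_mul, inv_mul_cancel₀ h4, C_1, one_mul] at h3
      intro k hk
      rcases Nat.lt_succ_iff_lt_or_eq.mp hk with hk | rfl
      · exact h2 k hk
      · rw [Finset.sum_range_succ] at hsum
        exact (J.add_mem_iff_right (J.sum_mem fun i hi => h2 i (Finset.mem_range.mp hi))).mp hsum
  intro f hf k
  by_cases hk : k < f.totalDegree + 1
  · exact key _ (fun k => homogeneousComponent k f)
      (fun k => homogeneousComponent_isHomogeneous k f)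
      (by rwa [sum_homogeneousComponent]) k hk
  · rw [homogeneousComponent_eq_zero _ _ (by omega)]
    exact J.zero_mem

-- The homogeneous core of a prime is prime and still contains the graded ideal I, so by minimality
-- it is p itself.
attribute [local instance] MvPolynomial.gradedAlgebra in
theorem isGradedIdeal_of_mem_minimalPrimes {I p : Ideal (MvPolynomial σ K)}
    (hI : IsGradedIdeal I) (hp : p ∈ I.minimalPrimes) : IsGradedIdeal p := by
  have hcore : (Ideal.homogeneousCore (homogeneousSubmodule σ K) p).toIdeal.IsPrime :=
    hp.1.1.homogeneousCore
  have hle : I ≤ (Ideal.homogeneousCore (homogeneousSubmodule σ K) p).toIdeal := fun f hf =>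
    IsGradedIdeal.mem_of_forall fun k => Ideal.mem_homogeneousCore_of_homogeneous_of_mem
      ⟨k, homogeneousComponent_isHomogeneous k f⟩ (hp.1.2 (hI f hf k))
  have heq : p = (Ideal.homogeneousCore (homogeneousSubmodule σ K) p).toIdeal :=
    le_antisymm (hp.2 ⟨hcore, hle⟩ (Ideal.toIdeal_homogeneousCore_le _ _))
      (Ideal.toIdeal_homogeneousCore_le _ _)
  intro f hf k
  rw [heq] at hf ⊢
  have := (Ideal.homogeneousCore (homogeneousSubmodule σ K) p).2 k hf
  rw [← decomposition.decompose'_apply]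
  exact this

variable {R : Type*} [CommRing R]

/-- A component over a minimal prime is the contraction of the localization of I: the other
components together are not contained in that prime, so a multiplier s outside it exists. The
component thus depends only on I and its radical. -/
theorem Ideal.mem_iff_exists_mul_mem_of_isMinimalPrimaryDecomposition {I : Ideal R}
    {t : Finset (Ideal R)} (ht : Submodule.IsMinimalPrimaryDecomposition I t)
    (hmin : ∀ q ∈ t, q.radical ∈ I.minimalPrimes) {q : Ideal R} (hq : q ∈ t) {f : R} :
    f ∈ q ↔ ∃ s ∉ q.radical, s * f ∈ I := by
  classical
  constructor
  · intro hf
    have hp := (hmin q hq).1.1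
    have h : ¬ (t.erase q).inf id ≤ q.radical := by
      intro h
      obtain ⟨q', hq', hle⟩ := (Ideal.IsPrime.inf_le' hp).mp h
      obtain ⟨hne, hq't⟩ := Finset.mem_erase.mp hq'
      have h1 : q'.radical ≤ q.radical := hp.radical_le_iff.mpr hle
      have h2 := (hmin q hq).2 (hmin q' hq't).1 h1
      refine ht.distinct hq't hq hne ?_
      simp only [Submodule.colon_univ]
      exact le_antisymm h1 h2
    obtain ⟨s, hs, hsq⟩ := SetLike.not_le_iff_exists.mp h
    refine ⟨s, hsq, ?_⟩
    rw [← ht.inf_eq, ← Finset.insert_erase hq, Finset.inf_insert]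
    exact ⟨q.mul_mem_left s hf, Ideal.mul_mem_right f _ hs⟩
  · rintro ⟨s, hs, hsf⟩
    have hIq : I ≤ q := ht.inf_eq.symm.trans_le (Finset.inf_le hq)
    have := (Ideal.isPrimary_iff.mp (ht.primary hq)).2 (x := f) (y := s)
      (by rw [mul_comm]; exact hIq hsf)
    exact this.resolve_right hs

/-- I and the radical of q are graded, hence stable under scaling by 2. The description of q by I
and its radical makes q stable as well. -/
theorem isGradedIdeal_of_mem_isMinimalPrimaryDecomposition [CharZero K]
    {I : Ideal (MvPolynomial σ K)} (hI : IsGradedIdeal I) {t : Finset (Ideal (MvPolynomial σ K))}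
    (ht : Submodule.IsMinimalPrimaryDecomposition I t)
    (hmin : ∀ q ∈ t, q.radical ∈ I.minimalPrimes) {q : Ideal (MvPolynomial σ K)} (hq : q ∈ t) :
    IsGradedIdeal q := by
  apply isGradedIdeal_of_doubleVars_mem
  intro f hf
  have hp := isGradedIdeal_of_mem_minimalPrimes hI (hmin q hq)
  rw [Ideal.mem_iff_exists_mul_mem_of_isMinimalPrimaryDecomposition ht hmin hq] at hf ⊢
  obtain ⟨s, hs, hsf⟩ := hf
  refine ⟨doubleVars σ K s, fun h => hs (hp.doubleVars_mem_iff.mp h), ?_⟩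
  rw [← map_mul]
  exact hI.doubleVars_mem_iff.mpr hsf

end GradedPrimary

/-! ### Transfer between S and S/I, and absence of embedded primes. -/

section IntersectionOfQuadrics

open MvPolynomial

theorem map_mk_mem_minimalPrimes {R : Type*} [CommRing R] {I p : Ideal R}
    (hp : p ∈ I.minimalPrimes) : p.map (Ideal.Quotient.mk I) ∈ minimalPrimes (R ⧸ I) := by
  rw [Ideal.minimalPrimes_eq_comap] at hp
  obtain ⟨P, hP, rfl⟩ := hp
  rwa [Ideal.map_comap_of_surjective _ Ideal.Quotient.mk_surjective]

theorem mem_minimalPrimes_of_map_mk_mem {R : Type*} [CommRing R] {I p : Ideal R} (hle : I ≤ p)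
    (hp : p.map (Ideal.Quotient.mk I) ∈ minimalPrimes (R ⧸ I)) : p ∈ I.minimalPrimes := by
  rw [Ideal.minimalPrimes_eq_comap]
  refine ⟨_, hp, ?_⟩
  rw [Ideal.comap_map_of_surjective _ Ideal.Quotient.mk_surjective, ← RingHom.ker_eq_comap_bot,
    Ideal.mk_ker, sup_eq_left.mpr hle]

theorem map_mk_injOn_minimalPrimes {R : Type*} [CommRing R] {I p q : Ideal R} (hp : I ≤ p)
    (hq : I ≤ q) (h : p.map (Ideal.Quotient.mk I) = q.map (Ideal.Quotient.mk I)) : p = q := by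
  have h1 := congrArg (Ideal.comap (Ideal.Quotient.mk I)) h
  rwa [Ideal.comap_map_of_surjective _ Ideal.Quotient.mk_surjective,
    Ideal.comap_map_of_surjective _ Ideal.Quotient.mk_surjective, ← RingHom.ker_eq_comap_bot,
    Ideal.mk_ker, sup_eq_left.mpr hp, sup_eq_left.mpr hq] at h1

variable {K : Type*} [Field K] {m : ℕ}

local notation "𝕊" => MvPolynomial (Fin (m + 1 + 1)) K
local notation "𝔸" => MvPolynomial (Fin m) K

/-- p contains l together with one of the two quadrics not divisible by l, and these form a regular
sequence of degrees 1 and 2. -/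
theorem hilbertFn_le_of_linear_mem {Q₁ Q₂ : 𝕊}
    (hQ₁ : Q₁.IsHomogeneous 2) (hQ₂ : Q₂.IsHomogeneous 2) (hcop : IsRelPrime Q₁ Q₂) {p : Ideal 𝕊}
    (hQ₁p : Q₁ ∈ p) (hQ₂p : Q₂ ∈ p) {l : 𝕊} (hl : l.IsHomogeneous 1) (hl0 : l ≠ 0) (hlp : l ∈ p)
    (k : ℕ) : hilbertFn p k ≤ ∑ i, if (![0, 1] : Fin 2 → ℕ) i ≤ k then
        m.multichoose (k - (![0, 1] : Fin 2 → ℕ) i) else 0 := by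
  obtain ⟨Q, hQ, hQp, hlQ⟩ : ∃ Q : 𝕊, Q.IsHomogeneous 2 ∧ Q ∈ p ∧ ¬ l ∣ Q := by
    by_contra! h
    exact hl.not_isUnit one_ne_zero (hcop (h Q₁ hQ₁ hQ₁p) (h Q₂ hQ₂ hQ₂p))
  have hle : Ideal.span {l, Q} ≤ p := by
    rw [Ideal.span_le]
    rintro _ (rfl | rfl)
    exacts [hlp, hQp]
  refine (hilbertFn_anti hle k).trans (hilbertFn_span_pair_of_one_two hl hQ hl0 ?_ ?_ k).le
  · rintro rfl
    exact hlQ (dvd_zero l)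
  · exact fun h hh => ((hl.irreducible hl0).prime.dvd_or_dvd hh).resolve_left hlQ

variable [Algebra (MvPolynomial (Fin m) K) (MvPolynomial (Fin (m + 1 + 1)) K)]
  {I : Ideal (MvPolynomial (Fin (m + 1 + 1)) K)}

theorem finite_quotient_of_le [Module.Finite 𝔸 (𝕊 ⧸ I)] {p : Ideal 𝕊} (hle : I ≤ p) :
    Module.Finite 𝔸 (𝕊 ⧸ p) :=
  Module.Finite.of_surjective (Ideal.Quotient.factorₐ 𝔸 hle).toLinearMap
    (Ideal.Quotient.factor_surjective hle)

theorem finrank_quotient_map_mk {p : Ideal 𝕊} (hle : I ≤ p) :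
    Module.finrank 𝔸 ((𝕊 ⧸ I) ⧸ p.map (Ideal.Quotient.mk I)) = Module.finrank 𝔸 (𝕊 ⧸ p) :=
  (DoubleQuot.quotQuotEquivQuotOfLEₐ 𝔸 hle).toLinearEquiv.finrank_eq

theorem eq_zero_of_algebraMap_mem_minimalPrimes [Module.IsTorsionFree 𝔸 (𝕊 ⧸ I)] {p : Ideal 𝕊}
    (hp : p ∈ I.minimalPrimes) {a : 𝔸} (ha : algebraMap 𝔸 𝕊 a ∈ p) : a = 0 := by
  have hP := map_mk_mem_minimalPrimes hp
  obtain ⟨g, hg⟩ := exists_forall_mem_iff_mul_eq_zero hP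
  refine comap_eq_bot_of_forall_mem_iff (B := 𝕊 ⧸ I) ?_ (fun b hb => (hg b).mp hb)
    (Ideal.mem_map_of_mem (Ideal.Quotient.mk I) ha)
  rintro rfl
  exact hP.1.1.ne_top ((Ideal.eq_top_iff_one _).mpr ((hg 1).mpr (mul_zero 1)))

/-- Irredundance gives f outside q but in all other components. If a ∈ A lies in the radical of q,
then aᵏf ∈ I for some k, so a = 0 by torsion-freeness. A prime over I that meets A in 0 is minimal.
-/
theorem radical_mem_minimalPrimes [Module.IsTorsionFree 𝔸 (𝕊 ⧸ I)] [Module.Finite 𝔸 (𝕊 ⧸ I)]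
    {t : Finset (Ideal 𝕊)} (ht : Submodule.IsMinimalPrimaryDecomposition I t) {q : Ideal 𝕊}
    (hq : q ∈ t) : q.radical ∈ I.minimalPrimes := by
  classical
  have hIq : I ≤ q := ht.inf_eq.symm.trans_le (Finset.inf_le hq)
  have hIp : I ≤ q.radical := hIq.trans Ideal.le_radical
  have hp : q.radical.IsPrime := Ideal.isPrime_radical (ht.primary hq)
  obtain ⟨f, hf, hfq⟩ := SetLike.not_le_iff_exists.mp (ht.minimal hq)
  have hpA : ∀ a : 𝔸, algebraMap 𝔸 𝕊 a ∈ q.radical → a = 0 := by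
    rintro a ⟨k, hk⟩
    have h1 : algebraMap 𝔸 𝕊 a ^ k * f ∈ I := by
      rw [← ht.inf_eq, ← Finset.insert_erase hq, Finset.inf_insert]
      exact ⟨q.mul_mem_right f hk, Ideal.mul_mem_left _ _ hf⟩
    rw [← map_pow, ← Algebra.smul_def, ← Ideal.Quotient.eq_zero_iff_mem] at h1
    have h2 : (a ^ k) • Ideal.Quotient.mk I f = 0 := h1
    rcases smul_eq_zero.mp h2 with h | h
    · exact eq_zero_of_pow_eq_zero h
    · exact absurd (hIq (Ideal.Quotient.eq_zero_iff_mem.mp h)) hfq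
  apply mem_minimalPrimes_of_map_mk_mem hIp
  refine mem_minimalPrimes_of_comap_eq_bot (A := 𝔸) ?_ fun a ha => hpA a ?_
  · exact Ideal.map_isPrime_of_surjective Ideal.Quotient.mk_surjective (by rwa [Ideal.mk_ker])
  · have h1 : algebraMap 𝔸 𝕊 a ∈ (q.radical.map (Ideal.Quotient.mk I)).comap (Ideal.Quotient.mk I) :=
      ha
    rwa [Ideal.comap_map_of_surjective _ Ideal.Quotient.mk_surjective, ← RingHom.ker_eq_comap_bot,
      Ideal.mk_ker, sup_eq_left.mpr hIp] at h1

variable [IsScalarTower K (MvPolynomial (Fin m) K) (MvPolynomial (Fin (m + 1 + 1)) K)]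

theorem NoetherCoordinates.exists_hasMultiplicity_le (N : NoetherCoordinates I)
    (hz : ∀ i, algebraMap 𝔸 𝕊 (X i) = N.z i) [Module.Finite 𝔸 (𝕊 ⧸ I)] {q : Ideal 𝕊}
    (hIq : I ≤ q) (hgr : IsGradedIdeal q) (hqA : ∀ a, algebraMap 𝔸 𝕊 a ∈ q → a = 0)
    {c : ℕ} (s : Fin c → ℕ)
    (hbound : ∀ k, hilbertFn q k ≤ ∑ i, if s i ≤ k then m.multichoose (k - s i) else 0) :
    ∃ e : ℕ, HasMultiplicity q e ∧ e ≤ c := by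
  have := finite_quotient_of_le (I := I) hIq
  exact _root_.exists_hasMultiplicity_le (fun i => hz i ▸ N.hz i) hgr hqA
    (fun P hP hqP h => N.le_idealOfVars hP (hIq.trans hqP) fun i => hz i ▸ h i) s hbound

end IntersectionOfQuadrics

theorem exists_primes_ne_of_isRadical {R : Type*} [CommRing R] {I : Ideal R} (hI : I ≠ ⊤)
    (hrad : I.IsRadical) (hpr : ¬ I.IsPrime) :
    ∃ p ∈ I.minimalPrimes, ∃ q ∈ I.minimalPrimes, p ≠ q := by
  obtain ⟨p, hp⟩ := Ideal.nonempty_minimalPrimes hI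
  refine ⟨p, hp, ?_⟩
  by_contra! h
  have h1 : I.minimalPrimes = {p} := by
    ext q
    exact ⟨fun hq => (h q hq).symm, fun hq => hq ▸ hp⟩
  have h2 := I.sInf_minimalPrimes
  rw [h1, sInf_singleton, hrad.radical] at h2
  exact hpr (h2 ▸ hp.1.1)

/-! ### The classification for intersections of two quadrics. -/

open MvPolynomial in
theorem proposition3p7 {K : Type*} [Field K] [IsAlgClosed K] [CharZero K] (n : ℕ)
    (Q₁ Q₂ : MvPolynomial (Fin (n + 1)) K)
    (hQ₁ : Q₁.IsHomogeneous 2) (hQ₂ : Q₂.IsHomogeneous 2)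
    (hcop : IsRelPrime Q₁ Q₂)
    (I : Ideal (MvPolynomial (Fin (n + 1)) K)) (hI : I = Ideal.span {Q₁, Q₂})
    (t : Finset (Ideal (MvPolynomial (Fin (n + 1)) K)))
    (ht : Submodule.IsMinimalPrimaryDecomposition I t) :
    (∀ q ∈ t, q.radical ∈ I.minimalPrimes) ∧
    (∀ q ∈ t, ∃ e : ℕ, HasMultiplicity q e ∧ e ≤ 4) ∧
    (¬ I.IsRadical → ∀ q ∈ t, ∃ e : ℕ, HasMultiplicity q.radical e ∧ e ≤ 2) ∧
    (¬ I.IsRadical → ∀ q ∈ t, IsLinearPrime q.radical ∨ IsQuadraticPrime q.radical) ∧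
    (I.IsRadical → ¬ I.IsPrime →
      (∃ p ∈ I.minimalPrimes, IsLinearPrime p) ∨
      (I.minimalPrimes.ncard = 2 ∧ ∀ p ∈ I.minimalPrimes, IsQuadraticPrime p)) := by
  have : Infinite K := IsAlgClosed.instInfinite
  obtain ⟨m, rfl⟩ : ∃ m, n = m + 1 :=
    ⟨n - 1, (Nat.sub_add_cancel (one_le_of_isRelPrime hQ₁ hQ₂ hcop)).symm⟩
  obtain ⟨N⟩ := nonempty_noetherCoordinates hQ₁ hQ₂ hcop
  rw [← hI] at N
  let φ : MvPolynomial (Fin m) K →ₐ[K] MvPolynomial (Fin (m + 1 + 1)) K := aeval N.z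
  let _ : Algebra (MvPolynomial (Fin m) K) (MvPolynomial (Fin (m + 1 + 1)) K) :=
    φ.toRingHom.toAlgebra
  have : IsScalarTower K (MvPolynomial (Fin m) K) (MvPolynomial (Fin (m + 1 + 1)) K) :=
    IsScalarTower.of_algebraMap_eq fun r => (φ.commutes r).symm
  have hz : ∀ i, algebraMap (MvPolynomial (Fin m) K) (MvPolynomial (Fin (m + 1 + 1)) K) (X i) =
      N.z i := fun i => aeval_X N.z i
  have hIgr : IsGradedIdeal I := hI ▸ isGradedIdeal_span_pair hQ₁ hQ₂
  have hfn := fun k => hI ▸ hilbertFn_span_pair_of_two_two hQ₁ hQ₂ hcop k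
  obtain ⟨b⟩ := N.nonempty_basis hz hIgr hfn
  have : Module.IsTorsionFree (MvPolynomial (Fin m) K) (MvPolynomial (Fin (m + 1 + 1)) K ⧸ I) :=
    b.isTorsionFree
  have hfin : Module.Finite (MvPolynomial (Fin m) K) (MvPolynomial (Fin (m + 1 + 1)) K ⧸ I) :=
    Module.Finite.of_basis b
  have hrank : Module.finrank (MvPolynomial (Fin m) K) (MvPolynomial (Fin (m + 1 + 1)) K ⧸ I) = 4 :=
    Module.finrank_eq_card_basis b
  have hmin : ∀ q ∈ t, q.radical ∈ I.minimalPrimes := fun q hq => radical_mem_minimalPrimes ht hq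
  have hgr : ∀ p ∈ I.minimalPrimes, IsGradedIdeal p := fun p hp =>
    isGradedIdeal_of_mem_minimalPrimes hIgr hp
  have hpA : ∀ p ∈ I.minimalPrimes, ∀ a, algebraMap (MvPolynomial (Fin m) K)
      (MvPolynomial (Fin (m + 1 + 1)) K) a ∈ p → a = 0 := fun p hp a ha =>
    eq_zero_of_algebraMap_mem_minimalPrimes hp ha
  have hmem₁ : ∀ p ∈ I.minimalPrimes, Q₁ ∈ p := fun p hp =>
    hp.1.2 (hI ▸ Ideal.subset_span (Or.inl rfl))
  have hmem₂ : ∀ p ∈ I.minimalPrimes, Q₂ ∈ p := fun p hp =>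
    hp.1.2 (hI ▸ Ideal.subset_span (Or.inr rfl))
  have hlin : ∀ p ∈ I.minimalPrimes, Module.finrank (MvPolynomial (Fin m) K)
      (MvPolynomial (Fin (m + 1 + 1)) K ⧸ p) ≤ 2 → ∃ g ∈ p, g.IsHomogeneous 1 ∧ g ≠ 0 := by
    intro p hp hr
    have := finite_quotient_of_le (m := m) hp.1.2
    exact N.exists_linear_mem hz hp.1.1 (hgr p hp) (hpA p hp) hr
  have hclass : ∀ p ∈ I.minimalPrimes, Module.finrank (MvPolynomial (Fin m) K)
      (MvPolynomial (Fin (m + 1 + 1)) K ⧸ p) ≤ 2 → IsLinearPrime p ∨ IsQuadraticPrime p := by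
    intro p hp hr
    obtain ⟨l, hlp, hl, hl0⟩ := hlin p hp hr
    exact isLinearPrime_or_isQuadraticPrime hQ₁ hQ₂ hcop (hI ▸ hp) (hgr p hp) hl hl0 hlp
  have hmult : ∀ p ∈ I.minimalPrimes, Module.finrank (MvPolynomial (Fin m) K)
      (MvPolynomial (Fin (m + 1 + 1)) K ⧸ p) ≤ 2 → ∃ e : ℕ, HasMultiplicity p e ∧ e ≤ 2 := by
    intro p hp hr
    obtain ⟨l, hlp, hl, hl0⟩ := hlin p hp hr
    exact N.exists_hasMultiplicity_le hz hp.1.2 (hgr p hp) (hpA p hp) _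
      (hilbertFn_le_of_linear_mem hQ₁ hQ₂ hcop (hmem₁ p hp) (hmem₂ p hp) hl hl0 hlp)
  have hnonred : ¬ I.IsRadical → ∀ p ∈ I.minimalPrimes, Module.finrank (MvPolynomial (Fin m) K)
      (MvPolynomial (Fin (m + 1 + 1)) K ⧸ p) ≤ 2 := by
    intro hrad p hp
    rw [Ideal.isRadical_iff_quotient_reduced] at hrad
    rw [← finrank_quotient_map_mk hp.1.2]
    exact finrank_quotient_le_two_of_not_isReduced hrad hrank (map_mk_mem_minimalPrimes hp)
  refine ⟨hmin, ?_, ?_, ?_, ?_⟩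
  · intro q hq
    have hIq : I ≤ q := ht.inf_eq.symm.trans_le (Finset.inf_le hq)
    exact N.exists_hasMultiplicity_le hz hIq
      (isGradedIdeal_of_mem_isMinimalPrimaryDecomposition hIgr ht hmin hq)
      (fun a ha => hpA _ (hmin q hq) a (Ideal.le_radical ha)) _
      -- Since I ≤ q, the Hilbert function of S/q is bounded by that of S/I, a free module of rank
      -- 4.
      (fun k => (hilbertFn_anti hIq k).trans (hfn k).le)
  · exact fun hrad q hq => hmult _ (hmin q hq) (hnonred hrad _ (hmin q hq))
  · exact fun hrad q hq => hclass _ (hmin q hq) (hnonred hrad _ (hmin q hq))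
  · intro hrad hpr
    by_cases hex : ∃ p ∈ I.minimalPrimes, IsLinearPrime p
    · exact Or.inl hex
    right
    push Not at hex
    have hge : ∀ p ∈ I.minimalPrimes, 2 ≤ Module.finrank (MvPolynomial (Fin m) K)
        (MvPolynomial (Fin (m + 1 + 1)) K ⧸ p) := by
      intro p hp
      by_contra hlt
      have := finite_quotient_of_le (m := m) hp.1.2
      exact hex p hp
        (N.isLinearPrime_of_finrank_le_one hz hp.1.1 (hgr p hp) (hpA p hp) (by omega))
    have hItop : I ≠ ⊤ := by
      rintro h
      have h1 : I ≤ RingHom.ker (eval (0 : Fin (m + 1 + 1) → K)) := by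
        rw [hI, Ideal.span_le]
        rintro _ (rfl | rfl)
        exacts [hQ₁.eval_zero_eq_zero two_ne_zero, hQ₂.eval_zero_eq_zero two_ne_zero]
      rw [h, top_le_iff] at h1
      exact RingHom.ker_ne_top _ h1
    obtain ⟨p, hp, q, hq, hpq⟩ := exists_primes_ne_of_isRadical hItop hrad hpr
    have hne : ∀ {p q}, p ∈ I.minimalPrimes → q ∈ I.minimalPrimes → p ≠ q →
        p.map (Ideal.Quotient.mk I) ≠ q.map (Ideal.Quotient.mk I) := fun hp hq h h' =>
      h (map_mk_injOn_minimalPrimes hp.1.2 hq.1.2 h')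
    -- All ranks are at least 2 and the total is at most 4. This makes both ranks equal to 2 and
    -- leaves no room for a third prime.
    have h2 := finrank_quotient_add_two_le (A := MvPolynomial (Fin m) K)
      (map_mk_mem_minimalPrimes hp) (map_mk_mem_minimalPrimes hq) (hne hp hq hpq)
    rw [hrank, finrank_quotient_map_mk hp.1.2, finrank_quotient_map_mk hq.1.2] at h2
    have hp2 := hge p hp
    have hq2 := hge q hq
    have hall : I.minimalPrimes = {p, q} := by
      ext r
      refine ⟨fun hr => ?_, ?_⟩
      · by_contra hrpq
        rw [Set.mem_insert_iff, Set.mem_singleton_iff, not_or] at hrpq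
        have h3 := finrank_quotient_add_three_le (A := MvPolynomial (Fin m) K)
          (map_mk_mem_minimalPrimes hp) (map_mk_mem_minimalPrimes hq) (map_mk_mem_minimalPrimes hr)
          (hne hp hq hpq) (hne hp hr (Ne.symm hrpq.1)) (hne hq hr (Ne.symm hrpq.2))
        rw [hrank, finrank_quotient_map_mk hp.1.2, finrank_quotient_map_mk hq.1.2,
          finrank_quotient_map_mk hr.1.2] at h3
        have := hge r hr
        omega
      · rintro (rfl | rfl)
        exacts [hp, hq]
    refine ⟨by rw [hall, Set.ncard_pair hpq], fun r hr => (hclass r hr ?_).resolve_left (hex r hr)⟩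
    rw [hall] at hr
    rcases hr with rfl | rfl <;> omega
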